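/- Let $k$ be an algebraically closed field. A weak bialgebra over $k$ is a $k$-algebra $A$ which is also a $k$-coalgebra $(A,\Delta,\varepsilon)$ such that $\Delta(ab)=\Delta(a)\Delta(b)$ for all $a,b\in A$, $$(\Delta(1)\otimes 1)(1\otimes\Delta(1))=(\Delta\otimes \mathrm{id})\Delta(1)=(1\otimes\Delta(1))(\Delta(1)\otimes 1),$$ $$\varepsilon(xyz)=\sum\varepsilon(xy_{(1)})\,\varepsilon(y_{(2)}z)=\sum\varepsilon(xy_{(2)})\,\varepsilon(y_{(1)}z)\qquad(x,y,z\in A).$$ It is a bialgebra if moreover $\Delta(1)=1\otimes 1$ and $\varepsilon$ is a unital algebra map. For a finite-dimensional weak bialgebra $A$, let $A\text{-mod}$ be the $k$-linear abelian category of finite-dimensional left $A$-modules. It is monoidal with the tensor product $M\otimes N:=\Delta(1)(M\otimes_k N)$, on which $A$ acts through $\Delta$, with the associativity constraint inherited from vector spaces, and with unit object $A/\{a\in A:\varepsilon(xa)=0\text{ for all }x\in A\}$ and unit constraints induced by $\varepsilon$. This tensor product is exact in each variable, so that the total tensor product of bounded complexes makes the bounded derived category $D^b(A\text{-mod})$ a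 monoidal triangulated category. The monoidal category $A\text{-mod}$ is called discrete if its morphism spaces are finite-dimensional over $k$, its objects have finite length, it has only finitely many simple objects $S_1,\dots,S_n$ up to isomorphism, and $S_i\otimes S_i\cong S_i$ for all $i$ while $S_i\otimes S_j=0$ for $i\neq j$. **Theorem.** Let $A$ and $B$ be finite-dimensional weak bialgebras over $k$ whose underlying algebras are hereditary (all left ideals are projective). Assume that $A$ is a bialgebra or that $A\text{-mod}$ is discrete. Suppose that $D^b(A\text{-mod})$ and $D^b(B\text{-mod})$ are equivalent as monoidal triangulated categories over $k$, that is, that there is a $k$-linear, strong monoidal equivalence between them which is a triangulated functor. Then $A\text{-mod}$ and $B\text{-mod}$ are equivalent as monoidal abelian categories over $k$, that is, there is a $k$-linear, strong monoidal equivalence between them. -/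

import Mathlib

open CategoryTheory MonoidalCategory TensorProduct

universe u

set_option linter.unusedSectionVars false

namespace WeakBialg

/-! ## Weak bialgebras and the monoidal category of their modules -/

section Mods

section Generic

/-- Axioms of a monoidal category can be checked after applying a faithful functor with an
oplax structure all of whose comparison maps are (stably) monomorphisms. -/
@[reducible] def monoidalOfOplax.{v₁, v₂, u₁, u₂} {C : Type u₁} {V : Type u₂} [Category.{v₁} C] [Category.{v₂} V]
    [MonoidalCategory V] [MonoidalCategoryStruct C] (F : C ⥤ V) [F.Faithful]
    (j : ∀ X Y : C, F.obj (X ⊗ Y) ⟶ F.obj X ⊗ F.obj Y) (e : F.obj (𝟙_ C) ⟶ 𝟙_ V)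
    (m₁ : ∀ X Y, Mono (j X Y)) (m₂ : ∀ (W : V) X Y, Mono (W ◁ j X Y))
    (m₃ : ∀ (W W' : V) X Y, Mono (W ◁ W' ◁ j X Y))
    (hT : ∀ {X X' Y Y' : C} (f : X ⟶ X') (g : Y ⟶ Y'),
      F.map (f ⊗ₘ g) ≫ j X' Y' = j X Y ≫ (F.map f ⊗ₘ F.map g))
    (hL : ∀ (X : C) {Y Y' : C} (g : Y ⟶ Y'), (𝟙 X ⊗ₘ g) = X ◁ g)
    (hR : ∀ {X X' : C} (g : X ⟶ X') (Y : C), (g ⊗ₘ 𝟙 Y) = g ▷ Y)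
    (hα : ∀ X Y Z : C, F.map (α_ X Y Z).hom ≫ j X (Y ⊗ Z) ≫ F.obj X ◁ j Y Z =
      j (X ⊗ Y) Z ≫ j X Y ▷ F.obj Z ≫ (α_ _ _ _).hom)
    (hl : ∀ X : C, F.map (λ_ X).hom = j _ _ ≫ (e ▷ _) ≫ (λ_ _).hom)
    (hr : ∀ X : C, F.map (ρ_ X).hom = j _ _ ≫ (_ ◁ e) ≫ (ρ_ _).hom) :
    MonoidalCategory C := by
  have hwL (X : C) {Y Y' : C} (g : Y ⟶ Y') : F.map (X ◁ g) ≫ j X Y' = j X Y ≫ F.obj X ◁ F.map g := by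
    rw [← hL, hT, F.map_id, id_tensorHom]
  have hwR {X X' : C} (g : X ⟶ X') (Y : C) : F.map (g ▷ Y) ≫ j X' Y = j X Y ≫ F.map g ▷ F.obj Y := by
    rw [← hR, hT, F.map_id, tensorHom_id]
  have ext₃ {W X Y Z : C} (f g : W ⟶ X ⊗ Y ⊗ Z) (h : F.map f ≫ j X (Y ⊗ Z) ≫ F.obj X ◁ j Y Z =
      F.map g ≫ j X (Y ⊗ Z) ≫ F.obj X ◁ j Y Z) : f = g := by
    apply F.map_injective
    rwa [← cancel_mono (j _ _), ← cancel_mono (_ ◁ j _ _), Category.assoc, Category.assoc]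
  have ext₄ {V W X Y Z : C} (f g : V ⟶ W ⊗ X ⊗ Y ⊗ Z)
      (h : F.map f ≫ j _ _ ≫ _ ◁ j X (Y ⊗ Z) ≫ _ ◁ F.obj X ◁ j Y Z =
      F.map g ≫ j _ _ ≫ _ ◁ j X (Y ⊗ Z) ≫ _ ◁ F.obj X ◁ j Y Z) : f = g := by
    apply F.map_injective
    rwa [← cancel_mono (j _ _), ← cancel_mono (_ ◁ j _ _), ← cancel_mono (_ ◁ _ ◁ j _ _),
      Category.assoc, Category.assoc, Category.assoc, Category.assoc]
  refine MonoidalCategory.ofTensorHom ?_ hL hR ?_ ?_ ?_ ?_ ?_ ?_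
  · intro M N
    apply F.map_injective
    rw [← cancel_mono (j _ _), hT]
    simp
  · intros
    apply F.map_injective
    rw [← cancel_mono (j _ _)]
    simp [hT, reassoc_of% @hT]
  · intro M N P M' N' P' f g h
    apply ext₃
    simp only [Functor.map_comp, Category.assoc, hα, reassoc_of% @hT]
    have e1 : (F.map (f ⊗ₘ g) ⊗ₘ F.map h) ≫ j M' N' ▷ F.obj P' =
      j M N ▷ _ ≫ ((F.map f ⊗ₘ F.map g) ⊗ₘ F.map h) := by
      rw [← tensorHom_id, ← tensorHom_id, tensorHom_comp_tensorHom, tensorHom_comp_tensorHom, hT]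
      simp
    have e2 : (F.map f ⊗ₘ F.map (g ⊗ₘ h)) ≫ _ ◁ j N' P' =
      _ ◁ j N P ≫ (F.map f ⊗ₘ (F.map g ⊗ₘ F.map h)) := by
      rw [← id_tensorHom, ← id_tensorHom, tensorHom_comp_tensorHom, tensorHom_comp_tensorHom, hT]
      simp
    rw [reassoc_of% e1, e2, reassoc_of% hα M N P, associator_naturality]
  · intro X Y f
    apply F.map_injective
    simp only [hL, Functor.map_comp, hl, reassoc_of% @hwL]
    simp [whisker_exchange_assoc]
  · intro X Y f
    apply F.map_injective
    simp only [hR, Functor.map_comp, hr, reassoc_of% @hwR]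
    simp [← whisker_exchange_assoc]
  · intro W X Y Z
    apply ext₄
    have e1 : F.map (W ◁ (α_ X Y Z).hom) ≫ j W (X ⊗ Y ⊗ Z) ≫ _ ◁ j X (Y ⊗ Z) ≫ _ ◁ _ ◁ j Y Z =
      j W ((X ⊗ Y) ⊗ Z) ≫ _ ◁ j (X ⊗ Y) Z ≫ _ ◁ (j X Y ▷ _) ≫ _ ◁ (α_ _ _ _).hom := by
      rw [reassoc_of% @hwL]
      simp only [← MonoidalCategory.whiskerLeft_comp, hα]
    have e2 : F.map ((α_ W X Y).hom ▷ Z) ≫ j (W ⊗ X ⊗ Y) Z ≫ j W (X ⊗ Y) ▷ _ ≫ (_ ◁ j X Y) ▷ _ =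
      j _ _ ≫ j (W ⊗ X) Y ▷ _ ≫ (j W X ▷ _ ▷ _) ≫ (α_ _ _ _).hom ▷ _ := by
      rw [reassoc_of% @hwR]
      simp only [← MonoidalCategory.comp_whiskerRight, hα]
    simp only [hL, hR, Functor.map_comp, Category.assoc, e1, reassoc_of% @hα]
    rw [← associator_naturality_middle_assoc, reassoc_of% e2,
      ← associator_naturality_right, ← whisker_exchange_assoc, reassoc_of% hα (W ⊗ X) Y Z,
      ← associator_naturality_left_assoc, MonoidalCategory.pentagon]
  · intro X Y
    apply F.map_injective
    rw [← cancel_mono (j _ _)]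
    have e1 : F.map (X ◁ (λ_ Y).hom) ≫ j X Y = j X (𝟙_ C ⊗ Y) ≫ _ ◁ j (𝟙_ C) Y ≫
        _ ◁ (e ▷ _) ≫ _ ◁ (λ_ _).hom := by
      rw [hwL, hl]
      simp
    have e2 : F.map ((ρ_ X).hom ▷ Y) ≫ j X Y = j (X ⊗ 𝟙_ C) Y ≫ j X (𝟙_ C) ▷ _ ≫
        (_ ◁ e) ▷ _ ≫ (ρ_ _).hom ▷ _ := by
      rw [hwR, hr]
      simp
    rw [hL, hR, Functor.map_comp, Category.assoc, e1, e2, reassoc_of% @hα]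
    simp
end Generic

/-- A weak bialgebra: an algebra and coalgebra `A` such that `Δ` is multiplicative,
`(Δ(1) ⊗ 1)(1 ⊗ Δ(1)) = (Δ ⊗ id)Δ(1) = (1 ⊗ Δ(1))(Δ(1) ⊗ 1)` in `A ⊗ (A ⊗ A)`, and
`ε(xyz) = ∑ ε(x y₁) ε(y₂ z) = ∑ ε(x y₂) ε(y₁ z)` where `Δ(y) = ∑ y₁ ⊗ y₂`. -/
class IsWeakBialgebra (k : outParam (Type u)) (A : Type u) [Field k] [Ring A] [Algebra k A]
    [Coalgebra k A] : Prop where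
  comul_mul (a b : A) :
    Coalgebra.comul (R := k) (a * b) = Coalgebra.comul (R := k) a * Coalgebra.comul (R := k) b
  comul_one₁ :
    (TensorProduct.assoc k A A A) ((Coalgebra.comul (R := k) (1 : A)) ⊗ₜ[k] (1 : A)) *
      ((1 : A) ⊗ₜ[k] (Coalgebra.comul (R := k) (1 : A))) =
    (TensorProduct.assoc k A A A)
      ((Coalgebra.comul (R := k) (A := A)).rTensor A (Coalgebra.comul (R := k) (1 : A)))
  comul_one₂ :
    ((1 : A) ⊗ₜ[k] (Coalgebra.comul (R := k) (1 : A))) *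
      (TensorProduct.assoc k A A A) ((Coalgebra.comul (R := k) (1 : A)) ⊗ₜ[k] (1 : A)) =
    (TensorProduct.assoc k A A A)
      ((Coalgebra.comul (R := k) (A := A)).rTensor A (Coalgebra.comul (R := k) (1 : A)))
  counit_mul₁ (x y z : A) :
    Coalgebra.counit (R := k) (x * y * z) =
      LinearMap.mul' k k (TensorProduct.map
        (Coalgebra.counit ∘ₗ LinearMap.mulLeft k x) (Coalgebra.counit ∘ₗ LinearMap.mulRight k z)
        (Coalgebra.comul y))
  counit_mul₂ (x y z : A) :
    Coalgebra.counit (R := k) (x * y * z) =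
      LinearMap.mul' k k (TensorProduct.map
        (Coalgebra.counit ∘ₗ LinearMap.mulRight k z) (Coalgebra.counit ∘ₗ LinearMap.mulLeft k x)
        (Coalgebra.comul y))

variable (k : Type u) {A : Type u} [Field k] [Ring A] [Algebra k A]

/-- The underlying vector space of a module. -/
noncomputable abbrev resk (A : Type u) [Ring A] [Algebra k A] : ModuleCat.{u} A ⥤ ModuleCat.{u} k :=
  ModuleCat.restrictScalars (algebraMap k A)

section Act
variable {k}

/-- The action of `A` on the underlying vector space of an `A`-module. -/
noncomputable def act (M : ModuleCat.{u} A) : A →ₗ[k] Module.End k ((resk k A).obj M) where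
  toFun a :=
    { toFun := fun m => (a • (m : M) : M)
      map_add' := fun x y => smul_add a (x : M) (y : M)
      map_smul' := fun c x => by
        change a • (algebraMap k A c • (x : M)) = algebraMap k A c • a • (x : M)
        rw [smul_smul, smul_smul, Algebra.commutes] }
  map_add' a b := by ext x; exact add_smul a b (x : M)
  map_smul' c a := by
    ext x
    change (c • a) • (x : M) = algebraMap k A c • a • (x : M)
    rw [smul_smul, Algebra.smul_def]

lemma act_apply (M : ModuleCat.{u} A) (a : A) (x : M) : (act (k := k) M a : M → M) x = a • x := rfl

lemma act_one (M : ModuleCat.{u} A) : act (k := k) M 1 = 1 := by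
  ext x; exact one_smul A (x : M)

lemma act_mul (M : ModuleCat.{u} A) (a b : A) :
    act (k := k) M (a * b) = act M a * act M b := by
  ext x; exact mul_smul a b (x : M)

/-- `f` intertwines two families of operators. -/
def Equivar {R : Type*} {V W : ModuleCat.{u} k} (ρ : R → Module.End k V) (σ : R → Module.End k W)
    (f : V ⟶ W) : Prop := ∀ a x, f (ρ a x) = σ a (f x)

lemma Equivar.comp {R : Type*} {V W X : ModuleCat.{u} k} {ρ : R → Module.End k V}
    {σ : R → Module.End k W} {τ : R → Module.End k X} {f : V ⟶ W} {g : W ⟶ X}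
    (hf : Equivar ρ σ f) (hg : Equivar σ τ g) : Equivar ρ τ (f ≫ g) := fun a x => by
  simp only [ConcreteCategory.comp_apply, hf a, hg a]

lemma equivar_map {M N : ModuleCat.{u} A} (f : M ⟶ N) :
    Equivar (k := k) (act M) (act N) ((resk k A).map f) := fun a x =>
  map_smul f.hom a (x : M)

/-- An equivariant map between the underlying vector spaces is a morphism of modules. -/
noncomputable def homOfEquivar {M N : ModuleCat.{u} A} (f : (resk k A).obj M ⟶ (resk k A).obj N)
    (hf : Equivar (act M) (act N) f) : M ⟶ N := ModuleCat.ofHom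
  { toFun := fun x => f x
    map_add' := fun x y => map_add f.hom x y
    map_smul' := fun a x => hf a x }

lemma map_homOfEquivar {M N : ModuleCat.{u} A} (f : (resk k A).obj M ⟶ (resk k A).obj N)
    (hf : Equivar (act M) (act N) f) : (resk k A).map (homOfEquivar f hf) = f := rfl

section
variable {R S : Type u} [AddCommGroup R] [Module k R] [AddCommGroup S] [Module k S]
variable {V W V' W' : ModuleCat.{u} k}

/-- The tensor product of two families of operators. -/
noncomputable def tl (ρ : R →ₗ[k] Module.End k V) (τ : S →ₗ[k] Module.End k W) :
    R ⊗[k] S →ₗ[k] Module.End k (V ⊗ W : ModuleCat k) :=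
  (TensorProduct.homTensorHomMap (RingHom.id k) V W V W) ∘ₗ TensorProduct.map ρ τ

lemma tl_tmul (ρ : R →ₗ[k] Module.End k V) (τ : S →ₗ[k] Module.End k W) (a : R) (b : S)
    (x : V) (y : W) :
    tl ρ τ (a ⊗ₜ b) (x ⊗ₜ[k] y : V ⊗[k] W) = (ρ a x) ⊗ₜ[k] (τ b y) := rfl

lemma tl_equivar {ρ : R →ₗ[k] Module.End k V} {τ : S →ₗ[k] Module.End k W}
    {ρ' : R →ₗ[k] Module.End k V'} {τ' : S →ₗ[k] Module.End k W'} {f : V ⟶ V'} {g : W ⟶ W'}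
    (hf : Equivar ρ ρ' f) (hg : Equivar τ τ' g) :
    Equivar (tl ρ τ) (tl ρ' τ') (f ⊗ₘ g) := fun t x => by
  have : (f ⊗ₘ g).hom ∘ₗ tl ρ τ t = tl ρ' τ' t ∘ₗ (f ⊗ₘ g).hom := by
    induction t with
    | zero => simp
    | add s t hs ht => simp only [map_add, LinearMap.comp_add, LinearMap.add_comp, hs, ht]
    | tmul a b =>
      refine TensorProduct.ext' fun x y => ?_
      change (f (ρ a x)) ⊗ₜ[k] (g (τ b y)) = _
      rw [hf, hg]; rfl
  exact LinearMap.congr_fun this x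

end
end Act

section Corner
variable {k}
variable {V : ModuleCat.{u} k} (σ : A →ₙₐ[k] Module.End k V)

/-- If `A` acts on `V` through `σ`, where the action of `1` is only an idempotent, this is the
`A`-module `σ(1) V`. -/
def Corner : Type u := LinearMap.range (σ 1)

namespace Corner
noncomputable instance : AddCommGroup (Corner σ) := inferInstanceAs (AddCommGroup (LinearMap.range (σ 1)))

lemma σ_one_val (x : LinearMap.range (σ 1)) : σ 1 x.1 = x.1 := by
  obtain ⟨_, y, rfl⟩ := x
  change (σ 1 * σ 1) y = σ 1 y
  rw [← map_mul, mul_one]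

noncomputable instance : Module A (Corner σ) where
  smul a x := (⟨σ a (Subtype.val x), σ a (Subtype.val x), by
    change (σ 1 * σ a) _ = _
    rw [← map_mul, one_mul]⟩ : LinearMap.range (σ 1))
  one_smul x := Subtype.ext (σ_one_val σ x)
  mul_smul a b x := Subtype.ext (by
    change σ (a * b) (Subtype.val x) = (σ a * σ b) (Subtype.val x)
    rw [map_mul])
  smul_zero a := Subtype.ext (map_zero (σ a))
  smul_add a x y := Subtype.ext (map_add (σ a) _ _)
  add_smul a b x := Subtype.ext (by
    change σ (a + b) (Subtype.val x) = (σ a + σ b) (Subtype.val x)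
    rw [map_add])
  zero_smul x := Subtype.ext (by
    change σ 0 (Subtype.val x) = 0
    rw [map_zero]; rfl)

/-- The `A`-module `σ(1) V`. -/
noncomputable abbrev mod : ModuleCat.{u} A := ModuleCat.of A (Corner σ)

lemma smul_val (a : A) (x : Corner σ) :
    Subtype.val (p := fun v => v ∈ LinearMap.range (σ 1)) (a • x) =
      σ a (Subtype.val (p := fun v => v ∈ LinearMap.range (σ 1)) x) := rfl

/-- The inclusion of `σ(1) V` in `V`, as a function. -/
noncomputable def inclFun (x : Corner σ) : V := Subtype.val (p := fun v => v ∈ LinearMap.range (σ 1)) x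

/-- The projection `v ↦ σ(1) v`, as a function. -/
noncomputable def projFun (v : V) : Corner σ := (⟨σ 1 v, v, rfl⟩ : LinearMap.range (σ 1))

/-- The inclusion of `σ(1) V` in `V`. -/
noncomputable def incl : (resk k A).obj (mod σ) ⟶ V := ModuleCat.ofHom
  (X := ((resk k A).obj (mod σ) : Type u))
  { toFun := inclFun σ
    map_add' := fun _ _ => rfl
    map_smul' := fun c x => by
      change σ (algebraMap k A c) (inclFun σ x) = _
      rw [Algebra.algebraMap_eq_smul_one, map_smul]
      change c • σ 1 _ = _
      erw [σ_one_val]; rfl }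

/-- The projection `v ↦ σ(1) v`. -/
noncomputable def proj : V ⟶ (resk k A).obj (mod σ) := ModuleCat.ofHom
  (Y := ((resk k A).obj (mod σ) : Type u))
  { toFun := projFun σ
    map_add' := fun _ _ => Subtype.ext (map_add (σ 1) _ _)
    map_smul' := fun c x => Subtype.ext (by
      change σ 1 (c • x) = σ (algebraMap k A c) (σ 1 x)
      rw [Algebra.algebraMap_eq_smul_one, map_smul, map_smul]
      change _ = c • (σ 1 * σ 1) x
      rw [← map_mul, one_mul]) }

lemma incl_equivar : Equivar (act (mod σ)) σ (incl σ) := fun _ _ => rfl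

lemma incl_proj : incl σ ≫ proj σ = 𝟙 _ := by
  ext x
  exact Subtype.ext (σ_one_val σ x)

lemma proj_incl (v : V) : incl σ (proj σ v) = σ 1 v := rfl

lemma proj_equivar : Equivar σ (act (mod σ)) (proj σ) := fun a v =>
  Subtype.ext (by
    change (σ 1 * σ a) v = (σ a * σ 1) v
    rw [← map_mul, ← map_mul, one_mul, mul_one])

instance : Mono (incl σ) := (SplitMono.mk (proj σ) (incl_proj σ)).mono

lemma incl_injective : Function.Injective (incl σ) := fun _ _ h => Subtype.ext h

lemma eq_σ_one {X : ModuleCat.{u} A} {h : (resk k A).obj X ⟶ V} (hh : Equivar (act X) σ h) (x) :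
    σ 1 (h x) = h x := by rw [← hh, act_one]; rfl

/-- An equivariant map factors through the corner. -/
noncomputable def lift {X : ModuleCat.{u} A} (h : (resk k A).obj X ⟶ V)
    (hh : Equivar (act X) σ h) : X ⟶ mod σ := homOfEquivar (h ≫ proj σ) (hh.comp (proj_equivar σ))

lemma lift_incl {X : ModuleCat.{u} A} (h : (resk k A).obj X ⟶ V) (hh : Equivar (act X) σ h) :
    (resk k A).map (lift σ h hh) ≫ incl σ = h := by
  ext x
  exact eq_σ_one σ hh x

end Corner
end Corner

section WB
variable {k}
lemma tl_act_mul (M N : ModuleCat.{u} A) (s t : A ⊗[k] A) :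
    tl (act M) (act N) (s * t) = tl (act (k := k) M) (act N) s * tl (act M) (act N) t := by
  induction s with
  | zero => simp
  | add s t hs ht => simp only [map_add, add_mul, hs, ht]
  | tmul a b =>
    induction t with
    | zero => simp
    | add s t hs ht => simp only [map_add, mul_add, hs, ht]
    | tmul c d =>
      refine TensorProduct.ext' fun x y => ?_
      rw [Algebra.TensorProduct.tmul_mul_tmul]
      erw [tl_tmul, act_mul, act_mul]
      rfl

variable [Coalgebra k A] [IsWeakBialgebra k A]

/-- The (non-unital) action of `A` on `M ⊗ₖ N` through the comultiplication. -/
noncomputable def tensorAct (M N : ModuleCat.{u} A) :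
    A →ₙₐ[k] Module.End k (((resk k A).obj M ⊗ (resk k A).obj N : ModuleCat k)) where
  toFun a := tl (act M) (act N) (Coalgebra.comul a)
  map_smul' c a := by simp
  map_zero' := by simp
  map_add' a b := by simp
  map_mul' a b := by rw [IsWeakBialgebra.comul_mul, tl_act_mul]

/-- The tensor product `Δ(1)(M ⊗ₖ N)`. -/
noncomputable abbrev tens (M N : ModuleCat.{u} A) : ModuleCat.{u} A := Corner.mod (tensorAct M N)

/-- The inclusion of `Δ(1)(M ⊗ₖ N)` in `M ⊗ₖ N`. -/
noncomputable abbrev jj (M N : ModuleCat.{u} A) :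
    (resk k A).obj (tens M N) ⟶ (resk k A).obj M ⊗ (resk k A).obj N := Corner.incl _

/-- The projection of `M ⊗ₖ N` to `Δ(1)(M ⊗ₖ N)`, given by the action of `Δ(1)`. -/
noncomputable abbrev pp (M N : ModuleCat.{u} A) :
    (resk k A).obj M ⊗ (resk k A).obj N ⟶ (resk k A).obj (tens M N) := Corner.proj _

lemma tensMap_equivar {M N M' N' : ModuleCat.{u} A} (f : M ⟶ M') (g : N ⟶ N') :
    Equivar (tensorAct M N) (tensorAct M' N') ((resk k A).map f ⊗ₘ (resk k A).map g) :=
  fun _ _ => tl_equivar (equivar_map f) (equivar_map g) _ _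

/-- The tensor product of two morphisms, the restriction of their tensor product over `k`. -/
noncomputable def tensMap {M N M' N' : ModuleCat.{u} A} (f : M ⟶ M') (g : N ⟶ N') :
    tens M N ⟶ tens M' N' :=
  Corner.lift _ (jj M N ≫ ((resk k A).map f ⊗ₘ (resk k A).map g))
    ((Corner.incl_equivar _).comp (tensMap_equivar f g))

lemma tensMap_jj {M N M' N' : ModuleCat.{u} A} (f : M ⟶ M') (g : N ⟶ N') :
    (resk k A).map (tensMap f g) ≫ jj M' N' =
      jj M N ≫ ((resk k A).map f ⊗ₘ (resk k A).map g) :=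
  Corner.lift_incl _ _ _

lemma pp_tensMap {M N M' N' : ModuleCat.{u} A} (f : M ⟶ M') (g : N ⟶ N') :
    pp M N ≫ (resk k A).map (tensMap f g) =
      ((resk k A).map f ⊗ₘ (resk k A).map g) ≫ pp M' N' := by
  rw [← cancel_mono (jj M' N'), Category.assoc, tensMap_jj]
  ext x
  exact (tensMap_equivar f g 1 x)

section Assoc
variable (M N P : ModuleCat.{u} A)

lemma id_equivar {R : Type*} {V : ModuleCat.{u} k} (ρ : R → Module.End k V) :
    Equivar ρ ρ (𝟙 _) := fun _ _ => rfl

lemma Equivar.precomp {R S : Type*} {V W : ModuleCat.{u} k} {ρ : R → Module.End k V}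
    {σ : R → Module.End k W} {f : V ⟶ W} (hf : Equivar ρ σ f) (g : S → R) :
    Equivar (fun s => ρ (g s)) (fun s => σ (g s)) f := fun s x => hf (g s) x

section
variable {R S T R' S' : Type u} [AddCommGroup R] [Module k R] [AddCommGroup S] [Module k S]
  [AddCommGroup T] [Module k T] [AddCommGroup R'] [Module k R'] [AddCommGroup S'] [Module k S']
variable {V W X : ModuleCat.{u} k}

lemma assoc_equivar (ρ : R →ₗ[k] Module.End k V) (σ : S →ₗ[k] Module.End k W)
    (τ : T →ₗ[k] Module.End k X) :
    Equivar (tl (tl ρ σ) τ) (fun t => tl ρ (tl σ τ) (TensorProduct.assoc k R S T t))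
      (α_ V W X).hom := by
  intro t v
  have : (α_ V W X).hom.hom ∘ₗ (tl (tl ρ σ) τ t) =
      tl ρ (tl σ τ) (TensorProduct.assoc k R S T t) ∘ₗ (α_ V W X).hom.hom := by
    induction t with
    | zero => simp
    | add s t hs ht => simp only [map_add, LinearMap.comp_add, LinearMap.add_comp, hs, ht]
    | tmul s c =>
      induction s with
      | zero => simp
      | add s t hs ht =>
        simp only [TensorProduct.add_tmul, map_add, LinearMap.comp_add, LinearMap.add_comp, hs, ht]
      | tmul a b => exact TensorProduct.ext_threefold fun x y z => rfl
  exact LinearMap.congr_fun this v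

lemma assoc_inv_equivar (ρ : R →ₗ[k] Module.End k V) (σ : S →ₗ[k] Module.End k W)
    (τ : T →ₗ[k] Module.End k X) :
    Equivar (tl ρ (tl σ τ)) (fun t => tl (tl ρ σ) τ ((TensorProduct.assoc k R S T).symm t))
      (α_ V W X).inv := by
  intro t v
  have := assoc_equivar ρ σ τ ((TensorProduct.assoc k R S T).symm t) ((α_ V W X).inv v)
  have h : Function.Injective (α_ V W X).hom := (ModuleCat.mono_iff_injective _).1 inferInstance
  apply h
  rw [this]
  simp

lemma tl_comp_left (ρ : R →ₗ[k] Module.End k V) (τ : S →ₗ[k] Module.End k W) (f : R' →ₗ[k] R) :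
    tl (ρ ∘ₗ f) τ = tl ρ τ ∘ₗ f.rTensor S := TensorProduct.ext' fun _ _ => rfl

lemma tl_comp_right (ρ : R →ₗ[k] Module.End k V) (τ : S →ₗ[k] Module.End k W) (f : S' →ₗ[k] S) :
    tl ρ (τ ∘ₗ f) = tl ρ τ ∘ₗ f.lTensor R := TensorProduct.ext' fun _ _ => rfl

end

lemma jj_whiskerRight_equivar : Equivar (tl (act (tens M N)) (act (k := k) P))
    (fun t => tl (tl (act M) (act N)) (act P) (Coalgebra.comul.rTensor A t))
    (jj M N ▷ (resk k A).obj P) := by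
  have h2 := tl_equivar (ρ := act (tens M N)) (ρ' := tl (act M) (act N) ∘ₗ Coalgebra.comul)
    (τ := act (k := k) P) (τ' := act P) (f := jj M N) (g := 𝟙 _)
    (Corner.incl_equivar (tensorAct M N)) (id_equivar _)
  rw [tl_comp_left, tensorHom_id] at h2
  exact h2

lemma whiskerLeft_jj_equivar : Equivar (tl (act (k := k) M) (act (tens N P)))
    (fun t => tl (act M) (tl (act N) (act P)) (Coalgebra.comul.lTensor A t))
    ((resk k A).obj M ◁ jj N P) := by
  have h2 := tl_equivar (ρ := act (k := k) M) (τ' := tl (act N) (act P) ∘ₗ Coalgebra.comul)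
    (τ := act (k := k) (tens N P)) (ρ' := act M) (g := jj N P) (f := 𝟙 _)
    (id_equivar _) (Corner.incl_equivar (tensorAct N P))
  rw [tl_comp_right, id_tensorHom] at h2
  exact h2

lemma pp_whiskerRight_equivar :
    Equivar (fun t => tl (tl (act M) (act N)) (act P) (Coalgebra.comul.rTensor A t))
    (tl (act (tens M N)) (act (k := k) P))
    (pp M N ▷ (resk k A).obj P) := by
  have h2 := tl_equivar (ρ' := act (tens M N)) (ρ := tl (act M) (act N) ∘ₗ Coalgebra.comul)
    (τ := act (k := k) P) (τ' := act P) (f := pp M N) (g := 𝟙 _)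
    (Corner.proj_equivar (tensorAct M N)) (id_equivar _)
  rw [tl_comp_left, tensorHom_id] at h2
  exact h2

lemma whiskerLeft_pp_equivar :
    Equivar (fun t => tl (act M) (tl (act N) (act P)) (Coalgebra.comul.lTensor A t))
    (tl (act (k := k) M) (act (tens N P)))
    ((resk k A).obj M ◁ pp N P) := by
  have h2 := tl_equivar (ρ := act (k := k) M) (τ := tl (act N) (act P) ∘ₗ Coalgebra.comul)
    (τ' := act (k := k) (tens N P)) (ρ' := act M) (g := pp N P) (f := 𝟙 _)
    (id_equivar _) (Corner.proj_equivar (tensorAct N P))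
  rw [tl_comp_right, id_tensorHom] at h2
  exact h2

/-- The inclusion of `(M ⊗ N) ⊗ P` in `M ⊗ₖ (N ⊗ₖ P)`. -/
noncomputable def jjl : (resk k A).obj (tens (tens M N) P) ⟶
    (resk k A).obj M ⊗ ((resk k A).obj N ⊗ (resk k A).obj P) :=
  jj _ _ ≫ (jj M N ▷ _) ≫ (α_ _ _ _).hom

/-- The inclusion of `M ⊗ (N ⊗ P)` in `(M ⊗ₖ N) ⊗ₖ P`. -/
noncomputable def jjr : (resk k A).obj (tens M (tens N P)) ⟶
    ((resk k A).obj M ⊗ (resk k A).obj N) ⊗ (resk k A).obj P :=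
  jj _ _ ≫ (_ ◁ jj N P) ≫ (α_ _ _ _).inv

lemma jjl_equivar : Equivar (act _) (fun a => tl (act M) (tl (act N) (act P))
    (Coalgebra.comul.lTensor A (Coalgebra.comul a))) (jjl M N P) := by
  have := (Corner.incl_equivar (tensorAct (tens M N) P)).comp
    (((jj_whiskerRight_equivar M N P).precomp Coalgebra.comul).comp
      ((assoc_equivar (act M) (act N) (act P)).precomp
        (fun a => Coalgebra.comul.rTensor A (Coalgebra.comul a))))
  simp only [Coalgebra.coassoc_apply] at this
  exact this

lemma jjr_equivar : Equivar (act _) (fun a => tl (tl (act M) (act N)) (act P)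
    (Coalgebra.comul.rTensor A (Coalgebra.comul a))) (jjr M N P) := by
  have := (Corner.incl_equivar (tensorAct M (tens N P))).comp
    (((whiskerLeft_jj_equivar M N P).precomp Coalgebra.comul).comp
      ((assoc_inv_equivar (act M) (act N) (act P)).precomp
        (fun a => Coalgebra.comul.lTensor A (Coalgebra.comul a))))
  simp only [Coalgebra.coassoc_symm_apply] at this
  exact this

/-- The associator, the restriction of the one over `k`. -/
noncomputable def assocHom : tens (tens M N) P ⟶ tens M (tens N P) :=
  Corner.lift _ (jjl M N P ≫ _ ◁ pp N P)
    ((jjl_equivar M N P).comp ((whiskerLeft_pp_equivar M N P).precomp Coalgebra.comul))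

/-- The inverse of the associator. -/
noncomputable def assocInv : tens M (tens N P) ⟶ tens (tens M N) P :=
  Corner.lift _ (jjr M N P ≫ pp M N ▷ _)
    ((jjr_equivar M N P).comp ((pp_whiskerRight_equivar M N P).precomp Coalgebra.comul))

lemma tl_absorb_right (s : A ⊗[k] A) (v : ((resk k A).obj M ⊗ ((resk k A).obj N ⊗ (resk k A).obj P) : ModuleCat k)) :
    ((resk k A).obj M ◁ (pp N P ≫ jj N P)) (tl (act M) (tl (act N) (act P))
      (Coalgebra.comul.lTensor A s) v) =
    tl (act M) (tl (act N) (act P)) (Coalgebra.comul.lTensor A s) v := by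
  have : ((resk k A).obj M ◁ (pp N P ≫ jj N P)).hom ∘ₗ (tl (act M) (tl (act N) (act P))
      (Coalgebra.comul.lTensor A s)) =
    tl (act M) (tl (act N) (act P)) (Coalgebra.comul.lTensor A s) := by
    induction s with
    | zero => simp
    | add s t hs ht => simp only [map_add, LinearMap.comp_add, hs, ht]
    | tmul a b =>
      refine TensorProduct.ext' fun x y => ?_
      change (act M a x) ⊗ₜ[k] ((tensorAct N P 1 * tensorAct N P b) y) =
        (act M a x) ⊗ₜ[k] (tensorAct N P b y)
      rw [← map_mul, one_mul]
  exact LinearMap.congr_fun this v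

lemma tl_absorb_left (s : A ⊗[k] A) (v : (((resk k A).obj M ⊗ (resk k A).obj N) ⊗ (resk k A).obj P : ModuleCat k)) :
    ((pp M N ≫ jj M N) ▷ (resk k A).obj P) (tl (tl (act M) (act N)) (act P)
      (Coalgebra.comul.rTensor A s) v) =
    tl (tl (act M) (act N)) (act P) (Coalgebra.comul.rTensor A s) v := by
  have : ((pp M N ≫ jj M N) ▷ (resk k A).obj P).hom ∘ₗ (tl (tl (act M) (act N)) (act P)
      (Coalgebra.comul.rTensor A s)) =
    tl (tl (act M) (act N)) (act P) (Coalgebra.comul.rTensor A s) := by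
    induction s with
    | zero => simp
    | add s t hs ht => simp only [map_add, LinearMap.comp_add, hs, ht]
    | tmul a b =>
      refine TensorProduct.ext' fun x y => ?_
      change ((tensorAct M N 1 * tensorAct M N a) x) ⊗ₜ[k] (act P b y) =
        (tensorAct M N a x) ⊗ₜ[k] (act P b y)
      rw [← map_mul, one_mul]
  exact LinearMap.congr_fun this v

lemma assocHom_jj : (resk k A).map (assocHom M N P) ≫ jj M (tens N P) ≫ _ ◁ jj N P =
    jj (tens M N) P ≫ (jj M N ▷ _) ≫ (α_ _ _ _).hom := by
  change _ = jjl M N P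
  have : (resk k A).map (assocHom M N P) ≫ jj M (tens N P) = jjl M N P ≫ _ ◁ pp N P :=
    Corner.lift_incl _ _ _
  rw [reassoc_of% this, ← MonoidalCategory.whiskerLeft_comp]
  ext x
  have h := jjl_equivar M N P 1 x
  rw [act_one] at h
  replace h : jjl M N P x = _ := h
  rw [ConcreteCategory.comp_apply, h]
  exact tl_absorb_right M N P _ _

lemma assocInv_jj : (resk k A).map (assocInv M N P) ≫ jj (tens M N) P ≫ jj M N ▷ _ =
    jj M (tens N P) ≫ (_ ◁ jj N P) ≫ (α_ _ _ _).inv := by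
  change _ = jjr M N P
  have : (resk k A).map (assocInv M N P) ≫ jj (tens M N) P = jjr M N P ≫ pp M N ▷ _ :=
    Corner.lift_incl _ _ _
  rw [reassoc_of% this, ← MonoidalCategory.comp_whiskerRight]
  ext x
  have h := jjr_equivar M N P 1 x
  rw [act_one] at h
  replace h : jjr M N P x = _ := h
  rw [ConcreteCategory.comp_apply, h]
  exact tl_absorb_left M N P _ _

instance : Mono (jj M N ▷ (resk k A).obj P) :=
  (SplitMono.mk (pp M N ▷ (resk k A).obj P) (by
    rw [← MonoidalCategory.comp_whiskerRight, Corner.incl_proj, id_whiskerRight])).mono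

instance mono_whiskerLeft (X : ModuleCat.{u} k) : Mono (X ◁ jj N P) :=
  (SplitMono.mk (X ◁ pp N P) (by
    rw [← MonoidalCategory.whiskerLeft_comp, Corner.incl_proj, whiskerLeft_id])).mono

/-- The associator. -/
noncomputable def assocIso : tens (tens M N) P ≅ tens M (tens N P) where
  hom := assocHom M N P
  inv := assocInv M N P
  hom_inv_id := by
    apply (resk k A).map_injective
    rw [← cancel_mono (jj (tens M N) P ≫ jj M N ▷ _), Functor.map_comp, Category.assoc,
      assocInv_jj, reassoc_of% assocHom_jj]
    simp
  inv_hom_id := by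
    apply (resk k A).map_injective
    rw [← cancel_mono (jj M (tens N P) ≫ _ ◁ jj N P), Functor.map_comp, Category.assoc,
      assocHom_jj, reassoc_of% assocInv_jj]
    simp

end Assoc
end WB

section Unit
variable {k : Type u} {A : Type u} [Field k] [Ring A] [Algebra k A] [Coalgebra k A]

open Coalgebra
/-- `a ⊗ b ↦ f a • b` -/
noncomputable def cL (f : A →ₗ[k] k) : A ⊗[k] A →ₗ[k] A :=
  TensorProduct.lift (LinearMap.lsmul k A ∘ₗ f)

/-- `a ⊗ b ↦ f b • a` -/
noncomputable def cR (f : A →ₗ[k] k) : A ⊗[k] A →ₗ[k] A :=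
  TensorProduct.lift (LinearMap.lsmul k A ∘ₗ f).flip

lemma cL_tmul (f : A →ₗ[k] k) (a b : A) : cL f (a ⊗ₜ b) = f a • b := rfl
lemma cR_tmul (f : A →ₗ[k] k) (a b : A) : cR f (a ⊗ₜ b) = f b • a := rfl

/-- `a ↦ ε (z * a)` -/
noncomputable def epsL (z : A) : A →ₗ[k] k := counit ∘ₗ LinearMap.mulLeft k z
/-- `a ↦ ε (a * x)` -/
noncomputable def epsR (x : A) : A →ₗ[k] k := counit ∘ₗ LinearMap.mulRight k x

lemma epsL_apply (z a : A) : epsL (k := k) z a = counit (z * a) := rfl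
lemma epsR_apply (z a : A) : epsR (k := k) z a = counit (a * z) := rfl

lemma cL_counit_comul (a : A) : cL (counit (R := k)) (comul a) = a := by
  have h : cL (counit (R := k) (A := A)) = (TensorProduct.lid k A).toLinearMap ∘ₗ counit.rTensor A :=
    TensorProduct.ext' fun x y => by simp [cL_tmul]
  rw [h]; simp

lemma cR_counit_comul (a : A) : cR (counit (R := k)) (comul a) = a := by
  have h : cR (counit (R := k) (A := A)) = (TensorProduct.rid k A).toLinearMap ∘ₗ counit.lTensor A :=
    TensorProduct.ext' fun x y => by simp [cR_tmul]
  rw [h]; simp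

lemma cL_coassoc (f : A →ₗ[k] k) (a : A) :
    (cL f ∘ₗ comul).rTensor A (comul a) = comul (cL f (comul a)) := by
  have h1 (t : A ⊗[k] A) : comul (cL f t) = (TensorProduct.lift (LinearMap.lsmul k (A ⊗[k] A) ∘ₗ f))
      (comul.lTensor A t) := by
    induction t with
    | zero => simp
    | add s t hs ht => simp only [map_add, hs, ht]
    | tmul a b => simp [cL_tmul]
  have h2 (t : (A ⊗[k] A) ⊗[k] A) : (cL f).rTensor A t =
      (TensorProduct.lift (LinearMap.lsmul k (A ⊗[k] A) ∘ₗ f)) (TensorProduct.assoc k A A A t) := by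
    have : (cL f).rTensor A = (TensorProduct.lift (LinearMap.lsmul k (A ⊗[k] A) ∘ₗ f)) ∘ₗ
       (TensorProduct.assoc k A A A).toLinearMap :=
      TensorProduct.ext_threefold fun x y z => by simp [cL_tmul, TensorProduct.smul_tmul']
    rw [this]; rfl
  rw [h1, LinearMap.rTensor_comp, LinearMap.comp_apply, h2, coassoc_apply]

lemma cR_coassoc (f : A →ₗ[k] k) (a : A) :
    (cR f ∘ₗ comul).lTensor A (comul a) = comul (cR f (comul a)) := by
  have h1 (t : A ⊗[k] A) : comul (cR f t) = (TensorProduct.lift (LinearMap.lsmul k (A ⊗[k] A) ∘ₗ f).flip)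
      (comul.rTensor A t) := by
    induction t with
    | zero => simp
    | add s t hs ht => simp only [map_add, hs, ht]
    | tmul a b => simp [cR_tmul]
  have h2 (t : (A ⊗[k] A) ⊗[k] A) : (cR f).lTensor A (TensorProduct.assoc k A A A t) =
      (TensorProduct.lift (LinearMap.lsmul k (A ⊗[k] A) ∘ₗ f).flip) t := by
    have : (cR f).lTensor A ∘ₗ (TensorProduct.assoc k A A A).toLinearMap = (TensorProduct.lift (LinearMap.lsmul k (A ⊗[k] A) ∘ₗ f).flip) :=
      TensorProduct.ext_threefold fun x y z => by simp [cR_tmul]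
    rw [← this]; rfl
  rw [h1, LinearMap.lTensor_comp, LinearMap.comp_apply, ← coassoc_apply, h2]

variable [IsWeakBialgebra k A]

lemma counit_L_L (x y z : A) : counit (R := k) (x * y * z) = counit (R := k) (cL (epsL (k := k) x) (comul y) * z) := by
  rw [IsWeakBialgebra.counit_mul₁]
  generalize (comul y : A ⊗[k] A) = t
  induction t with
  | zero => simp
  | add s t hs ht => simp only [map_add, add_mul, hs, ht]
  | tmul a b => simp [cL_tmul, epsL_apply]

lemma counit_R_R (x y z : A) : counit (R := k) (x * y * z) = counit (R := k) (x * cR (epsR (k := k) z) (comul y)) := by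
  rw [IsWeakBialgebra.counit_mul₁]
  generalize (comul y : A ⊗[k] A) = t
  induction t with
  | zero => simp
  | add s t hs ht => simp only [map_add, mul_add, hs, ht]
  | tmul a b => simp [cR_tmul, epsR_apply, mul_comm]

lemma counit_L_R (x y z : A) : counit (R := k) (x * y * z) = counit (R := k) (x * cL (epsR (k := k) z) (comul y)) := by
  rw [IsWeakBialgebra.counit_mul₂]
  generalize (comul y : A ⊗[k] A) = t
  induction t with
  | zero => simp
  | add s t hs ht => simp only [map_add, mul_add, hs, ht]
  | tmul a b => simp [cL_tmul, epsR_apply]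

lemma counit_R_L (x y z : A) : counit (R := k) (x * y * z) = counit (R := k) (cR (epsL (k := k) x) (comul y) * z) := by
  rw [IsWeakBialgebra.counit_mul₂]
  generalize (comul y : A ⊗[k] A) = t
  induction t with
  | zero => simp
  | add s t hs ht => simp only [map_add, add_mul, hs, ht]
  | tmul a b => simp [cR_tmul, epsL_apply, mul_comm]

lemma cL_epsR_comul (a x : A) : cL (epsR (k := k) x) (comul a) = a * cL (epsR (k := k) x) (comul 1) := by
  have h (s u : A ⊗[k] A) : cL (epsR (k := k) x) (s * u) =
      cL counit (s * (cL (epsR x) ∘ₗ comul).rTensor A u) := by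
    induction s with
    | zero => simp
    | add s t hs ht => simp only [map_add, add_mul, hs, ht]
    | tmul b c =>
      induction u with
      | zero => simp
      | add s t hs ht => simp only [map_add, mul_add, hs, ht]
      | tmul p q => simp [cL_tmul, epsR_apply, counit_L_R]
  rw [← mul_one a, IsWeakBialgebra.comul_mul, h, cL_coassoc, ← IsWeakBialgebra.comul_mul,
    cL_counit_comul, mul_one]

lemma cL_epsL_comul (a x : A) : cL (epsL (k := k) x) (comul a) = cL (epsL (k := k) x) (comul 1) * a := by
  have h (s u : A ⊗[k] A) : cL (epsL (k := k) x) (u * s) =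
      cL counit ((cL (epsL x) ∘ₗ comul).rTensor A u * s) := by
    induction s with
    | zero => simp
    | add s t hs ht => simp only [map_add, mul_add, hs, ht]
    | tmul b c =>
      induction u with
      | zero => simp
      | add s t hs ht => simp only [map_add, add_mul, hs, ht]
      | tmul p q => simp [cL_tmul, epsL_apply, ← counit_L_L, ← mul_assoc]
  rw [← one_mul a, IsWeakBialgebra.comul_mul, h, cL_coassoc, ← IsWeakBialgebra.comul_mul,
    cL_counit_comul, one_mul]

lemma cR_epsR_comul (a x : A) : cR (epsR (k := k) x) (comul a) = a * cR (epsR (k := k) x) (comul 1) := by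
  have h (s u : A ⊗[k] A) : cR (epsR (k := k) x) (s * u) =
      cR counit (s * (cR (epsR x) ∘ₗ comul).lTensor A u) := by
    induction s with
    | zero => simp
    | add s t hs ht => simp only [map_add, add_mul, hs, ht]
    | tmul b c =>
      induction u with
      | zero => simp
      | add s t hs ht => simp only [map_add, mul_add, hs, ht]
      | tmul p q => simp [cR_tmul, epsR_apply, counit_R_R]
  rw [← mul_one a, IsWeakBialgebra.comul_mul, h, cR_coassoc, ← IsWeakBialgebra.comul_mul,
    cR_counit_comul, mul_one]

lemma cR_epsL_comul (a x : A) : cR (epsL (k := k) x) (comul a) = cR (epsL (k := k) x) (comul 1) * a := by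
  have h (s u : A ⊗[k] A) : cR (epsL (k := k) x) (u * s) =
      cR counit ((cR (epsL x) ∘ₗ comul).lTensor A u * s) := by
    induction s with
    | zero => simp
    | add s t hs ht => simp only [map_add, mul_add, hs, ht]
    | tmul b c =>
      induction u with
      | zero => simp
      | add s t hs ht => simp only [map_add, add_mul, hs, ht]
      | tmul p q => simp [cR_tmul, epsL_apply, ← counit_R_L, ← mul_assoc]
  rw [← one_mul a, IsWeakBialgebra.comul_mul, h, cR_coassoc, ← IsWeakBialgebra.comul_mul,
    cR_counit_comul, one_mul]

lemma cL_key (z x : A) : cL (counit (R := k) ∘ₗ LinearMap.mulLeft k z ∘ₗ LinearMap.mulRight k x) (comul 1) =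
    cL (epsL (k := k) z) (comul 1) * cL (epsR (k := k) x) (comul 1) := by
  rw [← cL_epsL_comul, ← cL_coassoc]
  generalize (comul 1 : A ⊗[k] A) = t
  induction t with
  | zero => simp
  | add s t hs ht => simp only [map_add, hs, ht]
  | tmul a b => simp [cL_tmul, epsL_apply, ← counit_L_R, ← mul_assoc]

lemma cR_key (z x : A) : cR (counit (R := k) ∘ₗ LinearMap.mulLeft k z ∘ₗ LinearMap.mulRight k x) (comul 1) =
    cR (epsL (k := k) z) (comul 1) * cR (epsR (k := k) x) (comul 1) := by
  rw [← cR_epsL_comul, ← cR_coassoc]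
  generalize (comul 1 : A ⊗[k] A) = t
  induction t with
  | zero => simp
  | add s t hs ht => simp only [map_add, hs, ht]
  | tmul a b => simp [cR_tmul, epsL_apply, ← counit_R_R, ← mul_assoc]

lemma counit_mul_epsT (z a : A) : counit (R := k) (z * cL (epsR (k := k) a) (comul 1)) = counit (R := k) (z * a) := by
  rw [← counit_L_R, mul_one]

end Unit

section UnitObj
open Coalgebra
variable {k : Type u} {A : Type u} [Field k] [Ring A] [Algebra k A] [Coalgebra k A]

/-- The left ideal of all `a` with `ε (x * a) = 0` for all `x`. -/
def unitIdeal (k A : Type u) [Field k] [Ring A] [Algebra k A] [Coalgebra k A] : Submodule A A where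
  carrier := {a | ∀ x : A, counit (R := k) (x * a) = 0}
  add_mem' ha hb x := by rw [mul_add, map_add, ha, hb, add_zero]
  zero_mem' x := by simp
  smul_mem' b a ha x := by rw [smul_eq_mul, ← mul_assoc]; exact ha _

/-- The unit module `A / {a | ∀ x, ε (x * a) = 0}`. The target counital map
`a ↦ ε(1₁ a) 1₂` identifies it with the target counital subalgebra of `A`, on which `A` acts by
`a • b = ε(1₁ a b) 1₂`; for a bialgebra it is the trivial module. -/
noncomputable def unitObj (k A : Type u) [Field k] [Ring A] [Algebra k A] [Coalgebra k A] : ModuleCat.{u} A :=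
  ModuleCat.of A (A ⧸ unitIdeal k A)

/-- The quotient map of `A` to the unit module. -/
noncomputable def unitMk (k A : Type u) [Field k] [Ring A] [Algebra k A] [Coalgebra k A] : A →ₗ[k] (resk k A).obj (unitObj k A) where
  toFun a := (unitIdeal k A).mkQ a
  map_add' a b := map_add _ a b
  map_smul' c a := by
    rw [Algebra.smul_def]; exact (unitIdeal k A).mkQ.map_smul (algebraMap k A c) a

lemma unitMk_surjective : Function.Surjective (unitMk k A) := (unitIdeal k A).mkQ_surjective

lemma act_unitMk (a x : A) : act (unitObj k A) a (unitMk k A x) = unitMk k A (a * x) := rfl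

/-- The map induced by `ε` on the unit module. -/
noncomputable def eps : (resk k A).obj (unitObj k A) ⟶ 𝟙_ (ModuleCat.{u} k) :=
  ModuleCat.ofHom (X := (resk k A).obj (unitObj k A)) (Y := k)
  { toFun := Quotient.lift (s := (unitIdeal k A).quotientRel) (fun a => counit (R := k) a) (fun a b h => by
      have := ((Submodule.quotientRel_def _).1 h) 1
      rw [one_mul, map_sub, sub_eq_zero] at this
      exact this)
    map_add' := by
      intro x y
      obtain ⟨x, rfl⟩ := unitMk_surjective x
      obtain ⟨y, rfl⟩ := unitMk_surjective y
      exact map_add counit x y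
    map_smul' := by
      intro c x
      obtain ⟨x, rfl⟩ := unitMk_surjective x
      exact (congrArg _ (map_smul (unitMk k A) c x)).symm.trans (map_smul counit c x) }

lemma eps_unitMk (a : A) : (eps (k := k) (unitMk k A a) : k) = counit (R := k) a := rfl

/-- The map `a ⊗ m ↦ ε(a) m`. -/
noncomputable def El (M : ModuleCat.{u} A) : (resk k A).obj (unitObj k A) ⊗ (resk k A).obj M ⟶ (resk k A).obj M :=
  (eps ▷ _) ≫ (λ_ _).hom
/-- The map `m ⊗ a ↦ ε(a) m`. -/
noncomputable def Er (M : ModuleCat.{u} A) : (resk k A).obj M ⊗ (resk k A).obj (unitObj k A) ⟶ (resk k A).obj M :=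
  (_ ◁ eps) ≫ (ρ_ _).hom

lemma El_tl (M : ModuleCat.{u} A) (t : A ⊗[k] A) (x : A) (m : (resk k A).obj M) :
    El M (tl (act (unitObj k A)) (act M) t (unitMk k A x ⊗ₜ[k] m :)) = act M (cL (epsR x) t) m := by
  induction t with
  | zero => simp
  | add s t hs ht => simp only [map_add, LinearMap.add_apply, hs, ht]
  | tmul a b =>
    rw [cL_tmul, map_smul]
    rfl

lemma Er_tl (M : ModuleCat.{u} A) (t : A ⊗[k] A) (x : A) (m : (resk k A).obj M) :
    Er M (tl (act M) (act (unitObj k A)) t (m ⊗ₜ[k] unitMk k A x :)) = act M (cR (epsR x) t) m := by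
  induction t with
  | zero => simp
  | add s t hs ht => simp only [map_add, LinearMap.add_apply, hs, ht]
  | tmul a b =>
    rw [cR_tmul, map_smul]
    rfl

variable [IsWeakBialgebra k A]

lemma unitMk_epsT (a : A) : unitMk k A (cL (epsR (k := k) a) (comul 1)) = unitMk k A a := by
  refine (Submodule.Quotient.eq _).2 fun z => ?_
  rw [mul_sub, map_sub, counit_mul_epsT, sub_self]

/-- `z ⊗ w ↦ (a ↦ ε (z * a) • w)` -/
noncomputable def epsTw : A ⊗[k] A →ₗ[k] A →ₗ[k] A :=
  TensorProduct.lift (LinearMap.smulRightₗ ∘ₗ (LinearMap.mul k A).compr₂ counit)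

lemma epsTw_tmul (z w a : A) : epsTw (k := k) (z ⊗ₜ w) a = counit (R := k) (z * a) • w := rfl

lemma unitMk_epsTw (a : A) : unitMk k A (epsTw (comul (R := k) (1 : A)) a) = unitMk k A a := by
  have (t : A ⊗[k] A) : epsTw t a = cL (epsR (k := k) a) t := by
    induction t with
    | zero => simp
    | add s t hs ht => simp only [map_add, LinearMap.add_apply, hs, ht]
    | tmul b c => rfl
  rw [this, unitMk_epsT]

lemma key_left (x : A) :
    TensorProduct.map (unitMk k A ∘ₗ LinearMap.mulRight k x) LinearMap.id
      (comul (R := k) (1 : A)) =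
    TensorProduct.map (unitMk k A) (LinearMap.mulRight k (cL (epsR (k := k) x) (comul 1)))
      (comul (R := k) (1 : A)) := by
  set y := cL (epsR (k := k) x) (comul 1) with hy
  have h1 (u : A ⊗[k] A) :
      TensorProduct.map (epsTw u ∘ₗ LinearMap.mulRight k x) LinearMap.id (comul (R := k) (1 : A)) =
      TensorProduct.map (epsTw u) (LinearMap.mulRight k y) (comul (R := k) (1 : A)) := by
    induction u with
    | zero => simp
    | add s t hs ht =>
      simp only [map_add, LinearMap.add_comp, TensorProduct.map_add_left, LinearMap.add_apply, hs, ht]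
    | tmul z w =>
      have e1 (s : A ⊗[k] A) : TensorProduct.map (epsTw (z ⊗ₜ w) ∘ₗ LinearMap.mulRight k x)
          LinearMap.id s = w ⊗ₜ[k]
            cL (counit (R := k) ∘ₗ LinearMap.mulLeft k z ∘ₗ LinearMap.mulRight k x) s := by
        induction s with
        | zero => simp
        | add s t hs ht => simp only [map_add, TensorProduct.tmul_add, hs, ht]
        | tmul a b => simp [cL_tmul, epsTw_tmul, TensorProduct.smul_tmul]
      have e2 (s : A ⊗[k] A) : TensorProduct.map (epsTw (z ⊗ₜ w)) (LinearMap.mulRight k y) s =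
          w ⊗ₜ[k] (cL (epsL z) s * y) := by
        induction s with
        | zero => simp
        | add s t hs ht => simp only [map_add, add_mul, TensorProduct.tmul_add, hs, ht]
        | tmul a b => simp [cL_tmul, epsTw_tmul, epsL_apply, TensorProduct.smul_tmul]
      rw [e1, e2, cL_key]
  have h2 : (unitMk k A) = unitMk k A ∘ₗ epsTw (comul (R := k) (1 : A)) := by
    ext a; exact (unitMk_epsTw a).symm
  have h3 := congrArg (TensorProduct.map (unitMk k A) LinearMap.id) (h1 (comul 1))
  rw [TensorProduct.map_map, TensorProduct.map_map, ← LinearMap.comp_assoc, ← h2] at h3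
  exact h3

lemma key_right (x : A) :
    TensorProduct.map LinearMap.id (unitMk k A ∘ₗ LinearMap.mulRight k x)
      (comul (R := k) (1 : A)) =
    TensorProduct.map (LinearMap.mulRight k (cR (epsR (k := k) x) (comul 1))) (unitMk k A)
      (comul (R := k) (1 : A)) := by
  set y := cR (epsR (k := k) x) (comul 1) with hy
  have h1 (u : A ⊗[k] A) :
      TensorProduct.map LinearMap.id (epsTw u ∘ₗ LinearMap.mulRight k x) (comul (R := k) (1 : A)) =
      TensorProduct.map (LinearMap.mulRight k y) (epsTw u) (comul (R := k) (1 : A)) := by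
    induction u with
    | zero => simp
    | add s t hs ht =>
      simp only [map_add, LinearMap.add_comp, TensorProduct.map_add_right, LinearMap.add_apply, hs, ht]
    | tmul z w =>
      have e1 (s : A ⊗[k] A) : TensorProduct.map LinearMap.id
          (epsTw (z ⊗ₜ w) ∘ₗ LinearMap.mulRight k x) s =
            cR (counit (R := k) ∘ₗ LinearMap.mulLeft k z ∘ₗ LinearMap.mulRight k x) s ⊗ₜ[k] w := by
        induction s with
        | zero => simp
        | add s t hs ht => simp only [map_add, TensorProduct.add_tmul, hs, ht]
        | tmul a b => simp [cR_tmul, epsTw_tmul, TensorProduct.smul_tmul]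
      have e2 (s : A ⊗[k] A) : TensorProduct.map (LinearMap.mulRight k y) (epsTw (z ⊗ₜ w)) s =
          (cR (epsL z) s * y) ⊗ₜ[k] w := by
        induction s with
        | zero => simp
        | add s t hs ht => simp only [map_add, add_mul, TensorProduct.add_tmul, hs, ht]
        | tmul a b => simp [cR_tmul, epsTw_tmul, epsL_apply, TensorProduct.smul_tmul]
      rw [e1, e2, cR_key]
  have h2 : (unitMk k A) = unitMk k A ∘ₗ epsTw (comul (R := k) (1 : A)) := by
    ext a; exact (unitMk_epsTw a).symm
  have h3 := congrArg (TensorProduct.map LinearMap.id (unitMk k A)) (h1 (comul 1))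
  rw [TensorProduct.map_map, TensorProduct.map_map, ← LinearMap.comp_assoc, ← h2] at h3
  exact h3

section Unitors
variable (M : ModuleCat.{u} A)

lemma El_equivar : Equivar (act (tens (unitObj k A) M)) (act M) (jj _ _ ≫ El M) := by
  intro a y
  have h := Corner.eq_σ_one _ (Corner.incl_equivar (tensorAct (unitObj k A) M)) y
  rw [ConcreteCategory.comp_apply, Corner.incl_equivar, ConcreteCategory.comp_apply]
  conv_rhs => rw [jj, ← h]
  generalize Corner.incl (tensorAct (unitObj k A) M) y = v
  have : (El M).hom ∘ₗ (tensorAct (unitObj k A) M a) =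
      (act M a) ∘ₗ (El M).hom ∘ₗ (tensorAct (unitObj k A) M 1) := by
    refine TensorProduct.ext' fun x m => ?_
    obtain ⟨x, rfl⟩ := unitMk_surjective x
    change El M (tl (act (unitObj k A)) (act M) (comul a) (unitMk k A x ⊗ₜ[k] m :)) =
      act M a (El M (tl (act (unitObj k A)) (act M) (comul 1) (unitMk k A x ⊗ₜ[k] m :)))
    rw [El_tl, El_tl, cL_epsR_comul, act_mul]; rfl
  exact LinearMap.congr_fun this v

lemma Er_equivar : Equivar (act (tens M (unitObj k A))) (act M) (jj _ _ ≫ Er M) := by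
  intro a y
  have h := Corner.eq_σ_one _ (Corner.incl_equivar (tensorAct M (unitObj k A))) y
  rw [ConcreteCategory.comp_apply, Corner.incl_equivar, ConcreteCategory.comp_apply]
  conv_rhs => rw [jj, ← h]
  generalize Corner.incl (tensorAct M (unitObj k A)) y = v
  have : (Er M).hom ∘ₗ (tensorAct M (unitObj k A) a) =
      (act M a) ∘ₗ (Er M).hom ∘ₗ (tensorAct M (unitObj k A) 1) := by
    refine TensorProduct.ext' fun m x => ?_
    obtain ⟨x, rfl⟩ := unitMk_surjective x
    change Er M (tl (act M) (act (unitObj k A)) (comul a) (m ⊗ₜ[k] unitMk k A x :)) =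
      act M a (Er M (tl (act M) (act (unitObj k A)) (comul 1) (m ⊗ₜ[k] unitMk k A x :)))
    rw [Er_tl, Er_tl, cR_epsR_comul, act_mul]; rfl
  exact LinearMap.congr_fun this v

/-- `m ↦ [1] ⊗ m` -/
noncomputable def insL : (resk k A).obj M ⟶ (resk k A).obj (unitObj k A) ⊗ (resk k A).obj M :=
  ModuleCat.ofHom (X := (resk k A).obj M)
    (Y := (((resk k A).obj (unitObj k A) ⊗ (resk k A).obj M : ModuleCat k)))
    (TensorProduct.mk k _ _ (unitMk k A 1))

/-- `m ↦ m ⊗ [1]` -/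
noncomputable def insR : (resk k A).obj M ⟶ (resk k A).obj M ⊗ (resk k A).obj (unitObj k A) :=
  ModuleCat.ofHom (X := (resk k A).obj M)
    (Y := (((resk k A).obj M ⊗ (resk k A).obj (unitObj k A) : ModuleCat k)))
    ((TensorProduct.mk k _ _).flip (unitMk k A 1))

lemma insL_El : (insL M ≫ pp _ _) ≫ jj _ _ ≫ El M = 𝟙 _ := by
  ext m
  change El M (tl (act (unitObj k A)) (act M) (comul 1) (unitMk k A 1 ⊗ₜ[k] m :)) = m
  have h : epsR (k := k) (1 : A) = counit := by ext; simp [epsR_apply]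
  rw [El_tl, h, cL_counit_comul, act_one]; rfl

lemma insR_Er : (insR M ≫ pp _ _) ≫ jj _ _ ≫ Er M = 𝟙 _ := by
  ext m
  change Er M (tl (act M) (act (unitObj k A)) (comul 1) (m ⊗ₜ[k] unitMk k A 1 :)) = m
  have h : epsR (k := k) (1 : A) = counit := by ext; simp [epsR_apply]
  rw [Er_tl, h, cR_counit_comul, act_one]; rfl

lemma El_insL : (jj _ _ ≫ El M) ≫ (insL M ≫ pp _ _) = 𝟙 _ := by
  rw [← cancel_mono (jj _ _)]
  ext y
  have h := Corner.eq_σ_one _ (Corner.incl_equivar (tensorAct (unitObj k A) M)) y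
  simp only [ConcreteCategory.comp_apply, Category.id_comp]
  rw [Corner.proj_incl]
  conv_lhs => rw [jj, ← h]
  conv_rhs => rw [jj, ← h]
  generalize Corner.incl (tensorAct (unitObj k A) M) y = v
  have : (tensorAct (unitObj k A) M 1) ∘ₗ (insL M).hom ∘ₗ (El M).hom ∘ₗ
      (tensorAct (unitObj k A) M 1) = (tensorAct (unitObj k A) M 1) := by
    refine TensorProduct.ext' fun x m => ?_
    obtain ⟨x, rfl⟩ := unitMk_surjective x
    change tl (act (unitObj k A)) (act M) (comul 1) (unitMk k A 1 ⊗ₜ[k]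
      (El M (tl (act (unitObj k A)) (act M) (comul 1) (unitMk k A x ⊗ₜ[k] m :))) :) =
      (tl (act (unitObj k A)) (act M) (comul 1) (unitMk k A x ⊗ₜ[k] m :))
    rw [El_tl]
    have e (x y : A) (t : A ⊗[k] A) : tl (act (unitObj k A)) (act M) t
        (unitMk k A x ⊗ₜ[k] act M y m :) =
        TensorProduct.map LinearMap.id ((act (k := k) M).flip m)
          (TensorProduct.map (unitMk k A ∘ₗ LinearMap.mulRight k x) (LinearMap.mulRight k y) t) := by
      induction t with
      | zero => simp
      | add s t hs ht => simp only [map_add, LinearMap.add_apply, hs, ht]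
      | tmul a b =>
        simp only [TensorProduct.map_tmul, LinearMap.comp_apply, LinearMap.flip_apply, LinearMap.mulRight_apply, act_mul, LinearMap.id_apply, ← act_unitMk]
        rfl
    have e1 := e x 1 (comul 1)
    rw [act_one] at e1
    refine Eq.trans (e 1 _ (comul 1)) (Eq.trans ?_ e1.symm)
    rw [LinearMap.mulRight_one, key_left]
    rfl
  exact LinearMap.congr_fun this v

lemma Er_insR : (jj _ _ ≫ Er M) ≫ (insR M ≫ pp _ _) = 𝟙 _ := by
  rw [← cancel_mono (jj _ _)]
  ext y
  have h := Corner.eq_σ_one _ (Corner.incl_equivar (tensorAct M (unitObj k A))) y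
  simp only [ConcreteCategory.comp_apply, Category.id_comp]
  rw [Corner.proj_incl]
  conv_lhs => rw [jj, ← h]
  conv_rhs => rw [jj, ← h]
  generalize Corner.incl (tensorAct M (unitObj k A)) y = v
  have : (tensorAct M (unitObj k A) 1) ∘ₗ (insR M).hom ∘ₗ (Er M).hom ∘ₗ
      (tensorAct M (unitObj k A) 1) = (tensorAct M (unitObj k A) 1) := by
    refine TensorProduct.ext' fun m x => ?_
    obtain ⟨x, rfl⟩ := unitMk_surjective x
    change tl (act M) (act (unitObj k A)) (comul 1)
      ((Er M (tl (act M) (act (unitObj k A)) (comul 1) (m ⊗ₜ[k] unitMk k A x :))) ⊗ₜ[k] unitMk k A 1 :) =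
      (tl (act M) (act (unitObj k A)) (comul 1) (m ⊗ₜ[k] unitMk k A x :))
    rw [Er_tl]
    have e (x y : A) (t : A ⊗[k] A) : tl (act M) (act (unitObj k A)) t
        (act M y m ⊗ₜ[k] unitMk k A x :) =
        TensorProduct.map ((act (k := k) M).flip m) LinearMap.id
          (TensorProduct.map (LinearMap.mulRight k y) (unitMk k A ∘ₗ LinearMap.mulRight k x) t) := by
      induction t with
      | zero => simp
      | add s t hs ht => simp only [map_add, LinearMap.add_apply, hs, ht]
      | tmul a b =>
        simp only [TensorProduct.map_tmul, LinearMap.comp_apply, LinearMap.flip_apply, LinearMap.mulRight_apply, act_mul, LinearMap.id_apply, ← act_unitMk]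
        rfl
    have e1 := e x 1 (comul 1)
    rw [act_one] at e1
    refine Eq.trans (e 1 _ (comul 1)) (Eq.trans ?_ e1.symm)
    rw [LinearMap.mulRight_one, key_right]
    rfl
  exact LinearMap.congr_fun this v

/-- The left unitor, the restriction of `a ⊗ m ↦ ε(a) m`. -/
noncomputable def leftU : tens (unitObj k A) M ⟶ M := homOfEquivar _ (El_equivar M)
/-- The right unitor, the restriction of `m ⊗ a ↦ ε(a) m`. -/
noncomputable def rightU : tens M (unitObj k A) ⟶ M := homOfEquivar _ (Er_equivar M)

instance : IsIso (leftU (k := k) M) := by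
  have : IsIso ((resk k A).map (leftU (k := k) M)) :=
    ⟨(insL M ≫ pp _ _), El_insL M, insL_El M⟩
  exact isIso_of_reflects_iso _ (resk k A)

instance : IsIso (rightU (k := k) M) := by
  have : IsIso ((resk k A).map (rightU (k := k) M)) :=
    ⟨(insR M ≫ pp _ _), Er_insR M, insR_Er M⟩
  exact isIso_of_reflects_iso _ (resk k A)

end Unitors

/-- The tensor product `Δ(1)(M ⊗ₖ N)` of modules over a weak bialgebra, with the constraints
inherited from the tensor product of vector spaces. -/
noncomputable instance monStruct : MonoidalCategoryStruct (ModuleCat.{u} A) where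
  tensorObj M N := tens M N
  whiskerLeft M _ _ f := tensMap (𝟙 M) f
  whiskerRight f N := tensMap f (𝟙 N)
  tensorHom f g := tensMap f g
  tensorUnit := unitObj k A
  associator M N P := assocIso M N P
  leftUnitor M := asIso (leftU M)
  rightUnitor M := asIso (rightU M)

lemma map_leftUnitor (M : ModuleCat.{u} A) : (resk k A).map (λ_ M).hom = jj _ _ ≫ (eps ▷ _) ≫ (λ_ _).hom := rfl
lemma map_rightUnitor (M : ModuleCat.{u} A) : (resk k A).map (ρ_ M).hom = jj _ _ ≫ (_ ◁ eps) ≫ (ρ_ _).hom := rfl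
lemma map_assoc_jj (M N P : ModuleCat.{u} A) :
   (resk k A).map (α_ M N P).hom ≫ jj M (N ⊗ P) ≫ _ ◁ jj N P =
    jj (M ⊗ N) P ≫ (jj M N ▷ _) ≫ (α_ _ _ _).hom := assocHom_jj M N P
lemma map_tensor_jj {M N M' N' : ModuleCat.{u} A} (f : M ⟶ M') (g : N ⟶ N') :
    (resk k A).map (f ⊗ₘ g) ≫ jj M' N' =
      jj M N ≫ ((resk k A).map f ⊗ₘ (resk k A).map g) := tensMap_jj f g


lemma map_whiskerLeft_jj (M : ModuleCat.{u} A) {N N' : ModuleCat.{u} A} (g : N ⟶ N') :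
    (resk k A).map (M ◁ g) ≫ jj M N' = jj M N ≫ (resk k A).obj M ◁ (resk k A).map g := by
  refine (tensMap_jj (𝟙 M) g).trans ?_
  rw [CategoryTheory.Functor.map_id, id_tensorHom]

lemma map_whiskerRight_jj {M M' : ModuleCat.{u} A} (f : M ⟶ M') (N : ModuleCat.{u} A) :
    (resk k A).map (f ▷ N) ≫ jj M' N = jj M N ≫ (resk k A).map f ▷ (resk k A).obj N := by
  refine (tensMap_jj f (𝟙 N)).trans ?_
  rw [CategoryTheory.Functor.map_id, tensorHom_id]

instance (V : ModuleCat.{u} k) {X Y : ModuleCat.{u} k} (f : X ⟶ Y) [Mono f] : Mono (V ◁ f) := by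
  rw [ModuleCat.mono_iff_injective] at *
  exact Module.Flat.lTensor_preserves_injective_linearMap f.hom ‹_›

/-- The monoidal category of left modules over a weak bialgebra. -/
noncomputable instance monCat : MonoidalCategory (ModuleCat.{u} A) :=
  monoidalOfOplax (resk k A) jj eps inferInstance inferInstance inferInstance
    map_tensor_jj (fun _ _ _ _ => rfl) (fun _ _ => rfl) map_assoc_jj
    map_leftUnitor map_rightUnitor

end UnitObj

end Mods

/-! ## The tensor product is bilinear and preserves colimits -/

section Colims

open Limits
section ColimRetract
variable {C D : Type*} [Category* C] [Category* D] {J : Type*} [Category* J]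

/-- A retract of a colimit preserving functor preserves colimits. -/
lemma preservesColimit_of_retract {F G : C ⥤ D} (i : F ⟶ G) (p : G ⟶ F) (h : i ≫ p = 𝟙 F)
    (K : J ⥤ C) [PreservesColimit K G] : PreservesColimit K F where
  preserves {c} hc := ⟨by
    have h' (X : C) : i.app X ≫ p.app X = 𝟙 _ := by rw [← NatTrans.comp_app, h, NatTrans.id_app]
    let s' (s : Cocone (K ⋙ F)) : Cocone (K ⋙ G) :=
      (Cocone.precompose (Functor.whiskerLeft K p)).obj s
    let hG := isColimitOfPreserves G hc
    refine ⟨fun s => i.app c.pt ≫ hG.desc (s' s), fun s j => ?_, fun s m hm => ?_⟩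
    · change F.map (c.ι.app j) ≫ i.app c.pt ≫ hG.desc (s' s) = _
      refine (i.naturality_assoc (c.ι.app j) (hG.desc (s' s))).trans ?_
      refine (congrArg (i.app (K.obj j) ≫ ·) (hG.fac (s' s) j)).trans ?_
      change i.app _ ≫ p.app _ ≫ s.ι.app j = _
      rw [reassoc_of% h']
    · have : p.app c.pt ≫ m = hG.desc (s' s) := hG.hom_ext fun j => by
        rw [hG.fac]
        change G.map (c.ι.app j) ≫ p.app c.pt ≫ m = p.app _ ≫ s.ι.app j
        refine (p.naturality_assoc (c.ι.app j) m).trans ?_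
        rw [← hm j]; rfl
      rw [← this, reassoc_of% h']⟩
end ColimRetract

section
variable {k A : Type u} [Field k] [Ring A] [Algebra k A]

instance : (resk k A).Linear k where
  map_smul f c := by ext x; rfl

end

section
variable {k A : Type u} [Field k] [Ring A] [Algebra k A] [Coalgebra k A] [IsWeakBialgebra k A]

instance : MonoidalPreadditive (ModuleCat.{u} A) where
  whiskerLeft_zero {X Y Z} := by
    apply (resk k A).map_injective; rw [← cancel_mono (jj _ _), map_whiskerLeft_jj]; simp
  zero_whiskerRight {X Y Z} := by
    apply (resk k A).map_injective; rw [← cancel_mono (jj _ _), map_whiskerRight_jj]; simp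
  whiskerLeft_add {X Y Z} f g := by
    apply (resk k A).map_injective
    rw [← cancel_mono (jj _ _), map_whiskerLeft_jj, Functor.map_add, Functor.map_add, Preadditive.add_comp, map_whiskerLeft_jj, map_whiskerLeft_jj]; simp
  add_whiskerRight {X Y Z} f g := by
    apply (resk k A).map_injective
    rw [← cancel_mono (jj _ _), map_whiskerRight_jj, Functor.map_add, Functor.map_add, Preadditive.add_comp, map_whiskerRight_jj, map_whiskerRight_jj]; simp

/-- The inclusion of `M ⊗ N` in `M ⊗ₖ N`, natural in `N`. -/
noncomputable def tensorLeftIncl (M : ModuleCat.{u} A) : tensorLeft M ⋙ resk k A ⟶ resk k A ⋙ tensorLeft ((resk k A).obj M) where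
  app N := jj M N
  naturality _ _ f := map_whiskerLeft_jj M f

lemma pp_map {M N M' N' : ModuleCat.{u} A} (f : M ⟶ M') (g : N ⟶ N') :
    pp M N ≫ (resk k A).map (f ⊗ₘ g) =
      ((resk k A).map f ⊗ₘ (resk k A).map g) ≫ pp M' N' := pp_tensMap f g

/-- The projection of `M ⊗ₖ N` to `M ⊗ N`, natural in `N`. -/
noncomputable def tensorLeftProj (M : ModuleCat.{u} A) : resk k A ⋙ tensorLeft ((resk k A).obj M) ⟶ tensorLeft M ⋙ resk k A where
  app N := pp M N
  naturality _ _ f := by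
    have := pp_map (k := k) (𝟙 M) f
    rw [CategoryTheory.Functor.map_id] at this
    simpa using this.symm

/-- The inclusion of `N ⊗ M` in `N ⊗ₖ M`, natural in `N`. -/
noncomputable def tensorRightIncl (M : ModuleCat.{u} A) : tensorRight M ⋙ resk k A ⟶ resk k A ⋙ tensorRight ((resk k A).obj M) where
  app N := jj N M
  naturality _ _ f := map_whiskerRight_jj f M

/-- The projection of `N ⊗ₖ M` to `N ⊗ M`, natural in `N`. -/
noncomputable def tensorRightProj (M : ModuleCat.{u} A) : resk k A ⋙ tensorRight ((resk k A).obj M) ⟶ tensorRight M ⋙ resk k A where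
  app N := pp N M
  naturality _ _ f := by
    have := pp_map (k := k) f (𝟙 M)
    rw [CategoryTheory.Functor.map_id] at this
    simpa using this.symm

lemma pres (J : Type) [Category.{0} J] (M : ModuleCat.{u} A) : PreservesColimitsOfShape J (tensorLeft M) := ⟨fun {K} => by
  have : PreservesColimit K (tensorLeft M ⋙ resk k A) :=
    preservesColimit_of_retract (tensorLeftIncl M) (tensorLeftProj M) (by
      ext N : 2; exact Corner.incl_proj _) K
  have : ReflectsColimitsOfShape J (resk k A) := reflectsColimitsOfShape_of_reflectsIsomorphisms
  exact preservesColimit_of_reflects_of_preserves (tensorLeft M) (resk k A)⟩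



lemma pres' (J : Type) [Category.{0} J] (M : ModuleCat.{u} A) : PreservesColimitsOfShape J (tensorRight M) := ⟨fun {K} => by
  have : PreservesColimit K (tensorRight M ⋙ resk k A) :=
    preservesColimit_of_retract (tensorRightIncl M) (tensorRightProj M) (by
      ext N : 2; exact Corner.incl_proj _) K
  have : ReflectsColimitsOfShape J (resk k A) := reflectsColimitsOfShape_of_reflectsIsomorphisms
  exact preservesColimit_of_reflects_of_preserves (tensorRight M) (resk k A)⟩

instance : MonoidalLinear k (ModuleCat.{u} A) where
  whiskerLeft_smul X {Y Z} r f := by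
    apply (resk k A).map_injective
    rw [← cancel_mono (jj _ _), map_whiskerLeft_jj, Functor.map_smul, Functor.map_smul,
      Linear.smul_comp, map_whiskerLeft_jj]; simp
  smul_whiskerRight r {Y Z} f X := by
    apply (resk k A).map_injective
    rw [← cancel_mono (jj _ _), map_whiskerRight_jj, Functor.map_smul, Functor.map_smul,
      Linear.smul_comp, map_whiskerRight_jj]; simp


instance (J : Type) [Category.{0} J] (M : ModuleCat.{u} A) :
    PreservesColimitsOfShape J ((curriedTensor (ModuleCat.{u} A)).obj M) := pres J M

instance (J : Type) [Category.{0} J] (M : ModuleCat.{u} A) :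
    PreservesColimitsOfShape J ((curriedTensor (ModuleCat.{u} A)).flip.obj M) := pres' J M

end

end Colims

/-! ## Finite-dimensional modules -/

section FDim

open Limits
section FD
variable (k A : Type u) [Field k] [Ring A] [Algebra k A]

/-- The finite-dimensional modules among all left `A`-modules. -/
def isFD : ObjectProperty (ModuleCat.{u} A) := fun M => Module.Finite k ((resk k A).obj M)

/-- `A`-mod: finite-dimensional left modules. -/
abbrev FDMod := (isFD k A).FullSubcategory

variable {k A} in
lemma isFD_of_mono {M N : ModuleCat.{u} A} (f : M ⟶ N) [Mono f] (h : isFD k A N) : isFD k A M := by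
  have : Module.Finite k ((resk k A).obj N) := h
  exact Module.Finite.of_injective ((resk k A).map f).hom ((ModuleCat.mono_iff_injective _).1 inferInstance)

variable {k A} in
lemma isFD_of_epi {M N : ModuleCat.{u} A} (f : M ⟶ N) [Epi f] (h : isFD k A M) : isFD k A N := by
  have : Module.Finite k ((resk k A).obj M) := h
  exact Module.Finite.of_surjective ((resk k A).map f).hom ((ModuleCat.epi_iff_surjective _).1 inferInstance)

instance : (isFD k A).IsClosedUnderIsomorphisms where
  of_iso e h := isFD_of_epi e.hom h

instance : (isFD k A).ContainsZero where
  exists_zero := ⟨ModuleCat.of A PUnit, ModuleCat.isZero_of_subsingleton _, by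
    have : Finite ((resk k A).obj (ModuleCat.of A PUnit)) := inferInstanceAs (Finite PUnit)
    exact Module.Finite.of_finite⟩

instance : (isFD k A).IsClosedUnderKernels where
  kernels_le := by
    rintro _ ⟨f, c, hc, hf⟩
    have : Mono c.ι := Fork.IsLimit.mono hc
    exact isFD_of_mono c.ι hf.1

instance : (isFD k A).IsClosedUnderCokernels where
  cokernels_le := by
    rintro _ ⟨f, c, hc, hf⟩
    have : Epi c.π := Cofork.IsColimit.epi hc
    exact isFD_of_epi c.π hf.2

instance : (isFD k A).IsClosedUnderFiniteProducts where
  isClosedUnderLimitsOfShape J _ := ⟨by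
    rintro X ⟨p⟩
    have hp (j : J) : Module.Finite k ((resk k A).obj (p.diag.obj ⟨j⟩)) := p.prop_diag_obj ⟨j⟩
    refine Module.Finite.of_injective
      (LinearMap.pi fun j : J => ((resk k A).map (p.π.app ⟨j⟩)).hom) fun x y h => ?_
    exact Concrete.isLimit_ext _ p.isLimit x y fun ⟨j⟩ => congrFun h j⟩


variable [Coalgebra k A] [IsWeakBialgebra k A] [FiniteDimensional k A]

instance : (isFD k A).IsMonoidal where
  prop_unit := by
    exact Module.Finite.of_surjective (unitMk k A) unitMk_surjective
  prop_tensor M N hM hN := by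
    have : Module.Finite k ((resk k A).obj M) := hM
    have : Module.Finite k ((resk k A).obj N) := hN
    have : Module.Finite k ((resk k A).obj M ⊗ (resk k A).obj N : ModuleCat k) :=
      inferInstanceAs (Module.Finite k ((resk k A).obj M ⊗[k] (resk k A).obj N))
    exact Module.Finite.of_injective (jj M N).hom (Corner.incl_injective _)

end FD

end FDim

/-! ## The bounded derived category as a localization of the category of bounded complexes -/

section BddDer

open Limits Pretriangulated HomotopicalAlgebra HomologicalComplex ZeroObject

section Bdd
variable (C : Type*) [Category* C] [Abelian C]

/-- Bounded complexes. -/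
def bddCochain : ObjectProperty (CochainComplex C ℤ) := fun K =>
  ∃ a b : ℤ, K.IsStrictlyGE a ∧ K.IsStrictlyLE b

/-- The category of bounded complexes. -/
abbrev Chb := (bddCochain C).FullSubcategory

/-- Objects of the homotopy category that are isomorphic to a bounded complex. -/
def bddH : ObjectProperty (HomotopyCategory C (.up ℤ)) := fun K =>
  ∃ L : CochainComplex C ℤ, bddCochain C L ∧
    Nonempty (K ≅ (HomotopyCategory.quotient C (.up ℤ)).obj L)

instance : (bddH C).IsClosedUnderIsomorphisms where
  of_iso := by
    rintro _ _ e ⟨L, hL, ⟨e'⟩⟩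
    exact ⟨L, hL, ⟨e.symm ≪≫ e'⟩⟩

instance : (bddH C).ContainsZero where
  exists_zero := ⟨(HomotopyCategory.quotient _ _).obj 0,
    Functor.map_isZero (HomotopyCategory.quotient C (.up ℤ)) (isZero_zero _),
    ⟨0, ⟨0, 0, inferInstance, inferInstance⟩, ⟨Iso.refl _⟩⟩⟩

instance : (bddH C).IsStableUnderShift ℤ where
  isStableUnderShiftBy n :=
    { le_shift K hK := by
        obtain ⟨L, ⟨p, q, hp, hq⟩, ⟨e⟩⟩ := hK
        refine (bddH C).prop_of_iso ((shiftFunctor _ n).mapIso e).symm ?_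
        rw [HomotopyCategory.shift_quotient_obj]
        exact ⟨_, ⟨p - n, q - n, L.isStrictlyGE_shift p n (p - n) (by lia),
          L.isStrictlyLE_shift q n (q - n) (by lia)⟩, ⟨Iso.refl _⟩⟩ }

variable {C} in
lemma isStrictlyLE_mappingCone {K L : CochainComplex C ℤ} (f : K ⟶ L)
    (a b n : ℤ) (ha : a ≤ n) (hb : b ≤ n) [K.IsStrictlyLE a] [L.IsStrictlyLE b] :
    (CochainComplex.mappingCone f).IsStrictlyLE n := by
  rw [CochainComplex.isStrictlyLE_iff]
  intro i hi
  simp only [CochainComplex.mappingCone.isZero_X_iff]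
  exact ⟨K.isZero_of_isStrictlyLE a _ (by lia), L.isZero_of_isStrictlyLE b _⟩

instance : (bddH C).IsTriangulatedClosed₃ where
  ext₃' T hT h₁ h₂ := by
    obtain ⟨L₁, ⟨p₁, q₁, _, _⟩, ⟨e₁⟩⟩ := h₁
    obtain ⟨L₂, ⟨p₂, q₂, _, _⟩, ⟨e₂⟩⟩ := h₂
    obtain ⟨f, hf⟩ :=
      (HomotopyCategory.quotient _ _).map_surjective (e₁.inv ≫ T.mor₁ ≫ e₂.hom)
    refine ⟨_, ⟨_, ⟨min (p₁ - 1) p₂, max q₁ q₂,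
      CochainComplex.isStrictlyGE_mappingCone f p₁ p₂ _ (by simp) (by simp),
      isStrictlyLE_mappingCone f q₁ q₂ _ (by simp) (by simp)⟩, ⟨Iso.refl _⟩⟩,
      ⟨Triangle.π₃.mapIso (isoTriangleOfIso₁₂ T _ hT
        (HomotopyCategory.mappingCone_triangleh_distinguished f) e₁ e₂ ?_)⟩⟩
    change T.mor₁ ≫ e₂.hom = e₁.hom ≫ (HomotopyCategory.quotient _ _).map f
    simp [hf]

instance : (bddH C).IsTriangulated where
  toIsTriangulatedClosed₂ := .of_isTriangulatedClosed₃

/-- The bounded objects of `K⁺`. -/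
abbrev bddPlus : ObjectProperty (HomotopyCategory.Plus C) :=
  (bddH C).inverseImage (HomotopyCategory.Plus.ι C)

/-- The bounded homotopy category. -/
abbrev Kb := (bddPlus C).FullSubcategory

instance : (bddPlus C).IsVerdierLeftLocalizing (HomotopyCategory.Plus.subcategoryAcyclic C) where
  fac {K L} φ hK hL := by
    obtain ⟨K', ⟨p, n, hp, hn⟩, ⟨e⟩⟩ := hK
    obtain ⟨L, rfl⟩ := HomotopyCategory.Plus.quotient_obj_surjective L
    obtain ⟨m, hm⟩ := L.property
    obtain ⟨ψ, hψ⟩ := (HomotopyCategory.quotient _ _).map_surjective (e.inv ≫ φ.hom)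
    replace hL : L.obj.Acyclic := by
      rw [← HomotopyCategory.quotient_obj_mem_subcategoryAcyclic_iff_acyclic]
      exact hL
    let Z : CochainComplex.Plus C := ⟨L.obj.truncLE n, m, inferInstance⟩
    refine ⟨(HomotopyCategory.Plus.quotient C).obj Z,
      ObjectProperty.homMk (e.hom ≫ (HomotopyCategory.quotient _ _).map
        (inv (K'.ιTruncLE n) ≫ CochainComplex.truncLEMap ψ n)),
      (HomotopyCategory.Plus.quotient C).map (ObjectProperty.homMk (L.obj.ιTruncLE n)),
      ⟨L.obj.truncLE n, ⟨m, n, (inferInstance : (L.obj.truncLE n).IsStrictlyGE m), inferInstance⟩, ⟨Iso.refl _⟩⟩, ?_, ?_⟩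
    · change HomotopyCategory.subcategoryAcyclic C ((HomotopyCategory.quotient _ _).obj (L.obj.truncLE n))
      rw [HomotopyCategory.quotient_obj_mem_subcategoryAcyclic_iff_acyclic]
      exact hL.truncLE _
    · ext : 1
      change (e.hom ≫ (HomotopyCategory.quotient _ _).map
        (inv (K'.ιTruncLE n) ≫ CochainComplex.truncLEMap ψ n)) ≫
        (HomotopyCategory.quotient _ _).map (L.obj.ιTruncLE n) = φ.hom
      rw [Category.assoc, ← Functor.map_comp]
      simp [hψ]
      rfl


/-- The passage from bounded complexes to the bounded homotopy category. -/
def quotb : Chb C ⥤ Kb C :=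
  (bddPlus C).lift ((HomotopyCategory.plus C).lift
      ((bddCochain C).ι ⋙ HomotopyCategory.quotient C (.up ℤ)) (by
        rintro ⟨K, a, b, ha, hb⟩
        exact (HomotopyCategory.plus_quotient_obj_iff K).2 ⟨a, ha⟩))
    (fun K => ⟨K.obj, K.property, ⟨Iso.refl _⟩⟩)

instance : (quotb C).Full where
  map_surjective f := by
    obtain ⟨g, hg⟩ := (HomotopyCategory.quotient C (.up ℤ)).map_surjective f.hom.hom
    exact ⟨ObjectProperty.homMk g, by ext; exact hg⟩

instance : (quotb C).EssSurj where
  mem_essImage K := by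
    obtain ⟨L, hL, ⟨e⟩⟩ := K.property
    exact ⟨⟨L, hL⟩, ⟨(bddPlus C).isoMk ((HomotopyCategory.plus C).isoMk e.symm)⟩⟩

lemma bdd_cylinder (K : CochainComplex C ℤ) (hK : bddCochain C K) :
    bddCochain C (cylinder K) := by
  obtain ⟨a, b, ha, hb⟩ := hK
  refine ⟨a - 1, b, ?_, ?_⟩
  · rw [CochainComplex.isStrictlyGE_iff]
    intro i hi
    refine homotopyCofiber.isZero_X (φ := biprod.lift (𝟙 K) (-𝟙 K)) _ ?_ (fun j hj ↦ ?_)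
    · refine IsZero.of_iso ?_ ((HomologicalComplex.eval C (.up ℤ) i).mapBiprod _ _)
      have := K.isZero_of_isStrictlyGE a i
      simpa using this
    · simp only [ComplexShape.up_Rel] at hj
      exact K.isZero_of_isStrictlyGE a _ (by lia)
  · rw [CochainComplex.isStrictlyLE_iff]
    intro i hi
    refine homotopyCofiber.isZero_X (φ := biprod.lift (𝟙 K) (-𝟙 K)) _ ?_ (fun j hj ↦ ?_)
    · refine IsZero.of_iso ?_ ((HomologicalComplex.eval C (.up ℤ) i).mapBiprod _ _)
      have := K.isZero_of_isStrictlyLE b i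
      simpa using this
    · simp only [ComplexShape.up_Rel] at hj
      exact K.isZero_of_isStrictlyLE b _ (by lia)

instance : (quotb C).IsLocalization
      ((homotopyEquivalences C (.up ℤ)).inverseImage (bddCochain C).ι) :=
  Functor.isLocalization_of_essSurj_of_full_of_exists_cylinders _ _
    (fun _ _ f hf ↦ by
      rw [← isIso_iff_of_reflects_iso _ ((bddPlus C).ι ⋙ HomotopyCategory.Plus.ι C)]
      rw [← HomotopyCategory.inverseImage_quotient_isomorphisms] at hf
      exact hf) (by
    rintro K L f₀ f₁ hf
    obtain ⟨f₀, rfl⟩ := ObjectProperty.homMk_surjective f₀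
    obtain ⟨f₁, rfl⟩ := ObjectProperty.homMk_surjective f₁
    replace hf := HomotopyCategory.homotopyOfEq f₀ f₁
      (((bddPlus C).ι ⋙ HomotopyCategory.Plus.ι C).congr_map hf)
    exact ⟨K.obj.precylinder.toFullSubcategory (bdd_cylinder C K.obj K.property),
      Precylinder.LeftHomotopy.fullSubcategoryEquiv.symm
      { h := cylinder.desc _ _ hf, h₀ := cylinder.ι₀_desc _ _ _, h₁ := cylinder.ι₁_desc _ _ _ }, ⟨cylinder.homotopyEquiv _ (fun n ↦ ⟨n - 1, by simp⟩), rfl⟩⟩)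

variable [HasDerivedCategory C]
open DerivedCategory DerivedCategory.TStructure

/-- The passage from the bounded homotopy category to the bounded derived category. -/
noncomputable def Qhb : Kb C ⥤ Bounded C :=
  t.bounded.lift ((bddPlus C).ι ⋙ HomotopyCategory.Plus.ι C ⋙ DerivedCategory.Qh) (by
    rintro ⟨K, L, ⟨a, b, ha, hb⟩, ⟨e⟩⟩
    have i : DerivedCategory.Qh.obj ((HomotopyCategory.Plus.ι C).obj K) ≅ Q.obj L :=
      DerivedCategory.Qh.mapIso e ≪≫ (quotientCompQhIso C).app L
    exact t.bounded.prop_of_iso i.symm ⟨⟨a, inferInstanceAs (t.IsGE (Q.obj L) a)⟩,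
      ⟨b, inferInstanceAs (t.IsLE (Q.obj L) b)⟩⟩)

instance : (Qhb C).EssSurj where
  mem_essImage X := by
    obtain ⟨⟨a, ha⟩, ⟨b, hb⟩⟩ := X.property
    have : X.obj.IsGE a := ha
    have : X.obj.IsLE b := hb
    obtain ⟨K, _, _, ⟨e⟩⟩ := exists_iso_Q_obj_of_isGE_of_isLE X.obj a b
    exact ⟨(quotb C).obj ⟨K, a, b, ‹_›, ‹_›⟩,
      ⟨t.bounded.isoMk ((quotientCompQhIso C).app K ≪≫ e.symm)⟩⟩

/-- The inclusion of bounded objects in bounded below objects. -/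
noncomputable def bToPlus : Bounded C ⥤ DerivedCategory.Plus C :=
  t.plus.lift t.bounded.ι (fun X => X.property.1)

instance : (bToPlus C).Full where
  map_surjective f := ⟨ObjectProperty.homMk f.hom, rfl⟩

instance : (bToPlus C).Faithful where
  map_injective h := by
    ext
    exact t.plus.ι.congr_map h

/-- Acyclic objects of the bounded homotopy category. -/
abbrev acyclb : ObjectProperty (Kb C) :=
  (HomotopyCategory.Plus.subcategoryAcyclic C).inverseImage (bddPlus C).ι

instance : (Qhb C).IsLocalization (acyclb C).trW :=
  ((bddPlus C).triangulatedLocalizerMorphism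
    (HomotopyCategory.Plus.subcategoryAcyclic C)).isLocalization_of_isLocalizedFullyFaithful
      (L₁ := Qhb C) (F := bToPlus C) (L₂ := DerivedCategory.Plus.Qh)
      (Iso.refl ((bddPlus C).ι ⋙ DerivedCategory.Plus.Qh))


/-- Quasi-isomorphisms between bounded complexes. -/
def qisb : MorphismProperty (Chb C) :=
  (HomologicalComplex.quasiIso C (.up ℤ)).inverseImage (bddCochain C).ι

lemma trW_acyclb_iff {K L : Kb C} (f : K ⟶ L) :
    (acyclb C).trW f ↔ HomotopyCategory.quasiIso C (.up ℤ) f.hom.hom := by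
  obtain ⟨M, g, h, mem⟩ := Pretriangulated.distinguished_cocone_triangle f
  have := (HomotopyCategory.subcategoryAcyclic C).trW_iff_of_distinguished _
    (((bddPlus C).ι ⋙ HomotopyCategory.Plus.ι C).map_distinguished _ mem)
  rw [← HomotopyCategory.quasiIso_eq_trW_subcategoryAcyclic] at this
  exact ((acyclb C).trW_iff_of_distinguished _ mem).trans this.symm

/-- The localization functor from bounded complexes to the bounded derived category. -/
noncomputable def Qb : Chb C ⥤ Bounded C := quotb C ⋙ Qhb C

lemma trW_acyclb_quotb_iff {K L : Chb C} (f : K ⟶ L) :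
    (acyclb C).trW ((quotb C).map f) ↔ qisb C f := by
  rw [trW_acyclb_iff]
  exact HomotopyCategory.quotient_map_mem_quasiIso_iff f.hom

instance : (Qb C).IsLocalization (qisb C) := by
  refine Functor.IsLocalization.comp _ _
    ((homotopyEquivalences C (.up ℤ)).inverseImage (bddCochain C).ι) (acyclb C).trW _ ?_ ?_ ?_
  · intro K L f hf
    exact Localization.inverts (Qhb C) (acyclb C).trW _ ((trW_acyclb_quotb_iff C f).2 hf)
  · intro K L f hf
    exact homotopyEquivalences_le_quasiIso C (.up ℤ) _ hf
  · intro K L g hg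
    let i := (quotb C).objObjPreimageIso K
    let j := (quotb C).objObjPreimageIso L
    obtain ⟨f, hf⟩ := (quotb C).map_surjective (i.hom ≫ g ≫ j.inv)
    have e : Arrow.mk ((quotb C).map f) ≅ Arrow.mk g :=
      Arrow.isoMk i j (by simp [hf])
    exact ⟨_, _, f, (trW_acyclb_quotb_iff C f).1
      (((acyclb C).trW.arrow_mk_iso_iff e).2 hg), ⟨e⟩⟩
end Bdd

end BddDer

/-! ## Total tensor products and functors that are retracts of monoidal functors -/

section TotRetract

open Limits HomologicalComplex

section Retract
variable {C D : Type*} [Category* C] [Category* D] [Preadditive C] [Preadditive D]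
  [MonoidalCategory C] [MonoidalCategory D] [MonoidalPreadditive C] [MonoidalPreadditive D]

/-- A natural presentation of `F (X ⊗ Y)` as a retract of `F X ⊗ F Y`. -/
structure TensorRetract (F : C ⥤ D) where
  j (X Y : C) : F.obj (X ⊗ Y) ⟶ F.obj X ⊗ F.obj Y
  p (X Y : C) : F.obj X ⊗ F.obj Y ⟶ F.obj (X ⊗ Y)
  jp (X Y : C) : j X Y ≫ p X Y = 𝟙 _
  j_left {X X' : C} (f : X ⟶ X') (Y : C) :
    F.map (f ▷ Y) ≫ j X' Y = j X Y ≫ F.map f ▷ F.obj Y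
  j_right (X : C) {Y Y' : C} (g : Y ⟶ Y') :
    F.map (X ◁ g) ≫ j X Y' = j X Y ≫ F.obj X ◁ F.map g
  p_left {X X' : C} (f : X ⟶ X') (Y : C) :
    F.map f ▷ F.obj Y ≫ p X' Y = p X Y ≫ F.map (f ▷ Y)
  p_right (X : C) {Y Y' : C} (g : Y ⟶ Y') :
    F.obj X ◁ F.map g ≫ p X Y' = p X Y ≫ F.map (X ◁ g)

variable {F : C ⥤ D} [F.Additive] (r : TensorRetract F)
  [∀ J : Type, PreservesColimitsOfShape (Discrete J) F]
  (K L : CochainComplex C ℤ)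
  [HasTensor K L]

/-- The summands of `F ((K ⊗ L)ⁿ)`. -/
noncomputable def fIsColimit (n : ℤ) :
    IsColimit (Cofan.mk (F.obj ((tensorObj K L).X n))
      (fun i : (ComplexShape.π (.up ℤ) (.up ℤ) (.up ℤ)) ⁻¹' {n} =>
        F.map (ιTensorObj K L i.1.1 i.1.2 n i.2))) :=
  isColimitCofanMkObjOfIsColimit F _ _
    (GradedObject.isColimitCofanMapObj (((((curriedTensor C).mapBifunctorHomologicalComplex
      (.up ℤ) (.up ℤ)).obj K).obj L).toGradedObject) _ n)

/-- A morphism from `F ((K ⊗ L)ⁿ)` given on the summands. -/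
noncomputable def fDesc {n : ℤ} {Z : D}
    (f : ∀ a b : ℤ, a + b = n → (F.obj (K.X a ⊗ L.X b) ⟶ Z)) :
    F.obj ((tensorObj K L).X n) ⟶ Z :=
  Cofan.IsColimit.desc (fIsColimit K L n) (fun i => f i.1.1 i.1.2 i.2)

lemma ι_fDesc {n : ℤ} {Z : D}
    (f : ∀ a b : ℤ, a + b = n → (F.obj (K.X a ⊗ L.X b) ⟶ Z)) (a b : ℤ) (h : a + b = n) :
    F.map (ιTensorObj K L a b n h) ≫ fDesc K L f = f a b h :=
  Cofan.IsColimit.fac (fIsColimit K L n) (fun i => f i.1.1 i.1.2 i.2) ⟨(a, b), h⟩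

variable {K L} in
lemma fHomExt {n : ℤ} {Z : D} {f g : F.obj ((tensorObj K L).X n) ⟶ Z}
    (h : ∀ (a b : ℤ) (hab : a + b = n), F.map (ιTensorObj K L a b n hab) ≫ f =
      F.map (ιTensorObj K L a b n hab) ≫ g) : f = g :=
  Cofan.IsColimit.hom_ext (fIsColimit K L n) _ _ (fun i => h i.1.1 i.1.2 i.2)

variable (F) in
/-- The functor on complexes. -/
abbrev fc : CochainComplex C ℤ ⥤ CochainComplex D ℤ := F.mapHomologicalComplex (.up ℤ)

variable [HasTensor ((fc F).obj K) ((fc F).obj L)]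

lemma ι_d (K L : CochainComplex C ℤ) [HasTensor K L] (a b n m : ℤ) (h : a + b = n) (hm : n + 1 = m) :
    ιTensorObj K L a b n h ≫ (tensorObj K L).d n m =
      K.d a (a + 1) ▷ L.X b ≫ ιTensorObj K L (a + 1) b m (by lia) +
      a.negOnePow • K.X a ◁ L.d b (b + 1) ≫ ιTensorObj K L a (b + 1) m (by lia) := by
  rw [mapBifunctor.d_eq, Preadditive.comp_add, mapBifunctor.ι_D₁, mapBifunctor.ι_D₂,
    mapBifunctor.d₁_eq _ _ _ _ (i₁' := a + 1) (by simp) _ _ (by dsimp; lia),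
    mapBifunctor.d₂_eq _ _ _ _ _ (i₂' := b + 1) (by simp) _ (by dsimp; lia)]
  simp

/-- The inclusion of a summand of `F K ⊗ F L`. -/
noncomputable def ιt (a b n : ℤ) (h : a + b = n) :
    F.obj (K.X a) ⊗ F.obj (L.X b) ⟶ (tensorObj ((fc F).obj K) ((fc F).obj L)).X n :=
  ιTensorObj ((fc F).obj K) ((fc F).obj L) a b n h

lemma ιt_d (a b n m : ℤ) (h : a + b = n) (hm : n + 1 = m) :
    ιt (F := F) K L a b n h ≫ (tensorObj ((fc F).obj K) ((fc F).obj L)).d n m =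
      F.map (K.d a (a + 1)) ▷ F.obj (L.X b) ≫ ιt K L (a + 1) b m (by lia) +
      a.negOnePow • F.obj (K.X a) ◁ F.map (L.d b (b + 1)) ≫ ιt K L a (b + 1) m (by lia) :=
  ι_d ((fc F).obj K) ((fc F).obj L) a b n m h hm

variable {K L} in
lemma tHomExt {n : ℤ} {Z : D} {f g : (tensorObj ((fc F).obj K) ((fc F).obj L)).X n ⟶ Z}
    (h : ∀ (a b : ℤ) (hab : a + b = n), ιt K L a b n hab ≫ f = ιt K L a b n hab ≫ g) : f = g :=
  mapBifunctor.hom_ext h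

/-- A morphism from `(F K ⊗ F L)ⁿ` given on the summands. -/
noncomputable def tDesc {n : ℤ} {Z : D}
    (f : ∀ a b : ℤ, a + b = n → (F.obj (K.X a) ⊗ F.obj (L.X b) ⟶ Z)) :
    (tensorObj ((fc F).obj K) ((fc F).obj L)).X n ⟶ Z :=
  mapBifunctorDesc f

lemma ιt_tDesc {n : ℤ} {Z : D}
    (f : ∀ a b : ℤ, a + b = n → (F.obj (K.X a) ⊗ F.obj (L.X b) ⟶ Z)) (a b : ℤ) (h : a + b = n) :
    ιt K L a b n h ≫ tDesc K L f = f a b h :=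
  ι_mapBifunctorDesc _ _ _ _

/-- The embedding of `F (K ⊗ L)` in `F K ⊗ F L`, in degree `n`. -/
noncomputable def TensorRetract.jn (n : ℤ) : F.obj ((tensorObj K L).X n) ⟶
    (tensorObj ((fc F).obj K) ((fc F).obj L)).X n :=
  fDesc K L fun a b h => r.j _ _ ≫ ιt K L a b n h

/-- The projection of `F K ⊗ F L` to `F (K ⊗ L)`, in degree `n`. -/
noncomputable def TensorRetract.pn (n : ℤ) :
    (tensorObj ((fc F).obj K) ((fc F).obj L)).X n ⟶ F.obj ((tensorObj K L).X n) :=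
  tDesc K L fun a b h => r.p _ _ ≫ F.map (ιTensorObj K L a b n h)

lemma TensorRetract.ι_jn (a b n : ℤ) (h : a + b = n) :
    F.map (ιTensorObj K L a b n h) ≫ r.jn K L n = r.j _ _ ≫ ιt K L a b n h := ι_fDesc K L _ _ _ _

lemma TensorRetract.ι_pn (a b n : ℤ) (h : a + b = n) :
    ιt K L a b n h ≫ r.pn K L n = r.p _ _ ≫ F.map (ιTensorObj K L a b n h) := ιt_tDesc K L _ _ _ _

lemma TensorRetract.jn_pn (n : ℤ) : r.jn K L n ≫ r.pn K L n = 𝟙 _ := by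
  apply fHomExt
  intro a b h
  rw [reassoc_of% (r.ι_jn K L), r.ι_pn, reassoc_of% (r.jp), Category.comp_id]

lemma TensorRetract.jn_comm (n m : ℤ) (hm : n + 1 = m) :
    r.jn K L n ≫ (tensorObj ((fc F).obj K) ((fc F).obj L)).d n m =
      F.map ((tensorObj K L).d n m) ≫ r.jn K L m := by
  apply fHomExt
  intro a b h
  rw [reassoc_of% (r.ι_jn K L), ιt_d _ _ _ _ _ _ h hm, ← F.map_comp_assoc, ι_d _ _ _ _ _ _ h hm]
  simp only [F.map_add, Functor.map_units_smul, F.map_comp, Preadditive.add_comp, Category.assoc,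
    r.ι_jn, Linear.units_smul_comp, Preadditive.comp_add, Linear.comp_units_smul]
  rw [reassoc_of% (r.j_left), reassoc_of% (r.j_right)]

lemma TensorRetract.pn_comm (n m : ℤ) (hm : n + 1 = m) :
    r.pn K L n ≫ F.map ((tensorObj K L).d n m) =
      (tensorObj ((fc F).obj K) ((fc F).obj L)).d n m ≫ r.pn K L m := by
  apply tHomExt
  intro a b h
  rw [reassoc_of% (r.ι_pn K L), reassoc_of% (ιt_d (F := F) K L a b n m h hm), ← F.map_comp, ι_d _ _ _ _ _ _ h hm]
  simp only [F.map_add, Functor.map_units_smul, F.map_comp, Preadditive.add_comp, Category.assoc,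
    r.ι_pn, Linear.units_smul_comp, Preadditive.comp_add, Linear.comp_units_smul]
  rw [reassoc_of% (r.p_left), reassoc_of% (r.p_right)]

/-- The embedding of `F (K ⊗ L)` in `F K ⊗ F L`. -/
noncomputable def TensorRetract.jc :
    (fc F).obj (tensorObj K L) ⟶ tensorObj ((fc F).obj K) ((fc F).obj L) where
  f n := r.jn K L n
  comm' n m hm := r.jn_comm K L n m hm

/-- The projection of `F K ⊗ F L` to `F (K ⊗ L)`. -/
noncomputable def TensorRetract.pc :
    tensorObj ((fc F).obj K) ((fc F).obj L) ⟶ (fc F).obj (tensorObj K L) where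
  f n := r.pn K L n
  comm' n m hm := r.pn_comm K L n m hm

variable {K L} {K' L' : CochainComplex C ℤ} (f : K ⟶ K') (g : L ⟶ L') [HasTensor K' L']
  [HasTensor ((fc F).obj K') ((fc F).obj L')]

lemma ιt_map (a b n : ℤ) (h : a + b = n) :
    ιt (F := F) K L a b n h ≫ (tensorHom ((fc F).map f) ((fc F).map g)).f n =
      F.map (f.f a) ▷ F.obj (L.X b) ≫ F.obj (K'.X a) ◁ F.map (g.f b) ≫ ιt K' L' a b n h :=
  ι_mapBifunctorMap _ _ _ _ _ _ _ _

lemma ι_map (a b n : ℤ) (h : a + b = n) :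
    ιTensorObj K L a b n h ≫ (tensorHom f g).f n =
      f.f a ▷ L.X b ≫ K'.X a ◁ g.f b ≫ ιTensorObj K' L' a b n h :=
  ι_mapBifunctorMap _ _ _ _ _ _ _ _

/-- `F (f ⊗ g)` is a retract of `F f ⊗ F g`. -/
noncomputable def TensorRetract.retract :
    RetractArrow ((fc F).map (tensorHom f g)) (tensorHom ((fc F).map f) ((fc F).map g)) where
  i := Arrow.homMk (r.jc K L) (r.jc K' L') (by
    ext n : 1
    change r.jn K L n ≫ (tensorHom ((fc F).map f) ((fc F).map g)).f n =
      F.map ((tensorHom f g).f n) ≫ r.jn K' L' n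
    apply fHomExt
    intro a b h
    rw [reassoc_of% (r.ι_jn K L), ιt_map, ← F.map_comp_assoc, ι_map]
    simp only [F.map_comp, Category.assoc, r.ι_jn]
    rw [reassoc_of% (r.j_right), reassoc_of% (r.j_left)])
  r := Arrow.homMk (r.pc K L) (r.pc K' L') (by
    ext n : 1
    change r.pn K L n ≫ F.map ((tensorHom f g).f n) =
      (tensorHom ((fc F).map f) ((fc F).map g)).f n ≫ r.pn K' L' n
    apply tHomExt
    intro a b h
    rw [reassoc_of% (r.ι_pn K L), reassoc_of% (ιt_map (F := F) f g a b n h), ← F.map_comp, ι_map, r.ι_pn]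
    simp only [F.map_comp]
    rw [reassoc_of% (r.p_right), reassoc_of% (r.p_left)])
  retract := by
    ext n
    · exact r.jn_pn K L n
    · exact r.jn_pn K' L' n

end Retract

end TotRetract

/-! ## Tensor products of complexes of modules preserve quasi-isomorphisms -/

section Qis

open Limits HomologicalComplex

section
variable (k A : Type u) [Field k] [Ring A] [Algebra k A] [Coalgebra k A] [IsWeakBialgebra k A]

/-- The tensor product of modules is a retract of the tensor product over `k`. -/
noncomputable def tensorRetract : TensorRetract (resk k A) where
  j := jj
  p := pp
  jp _ _ := Corner.incl_proj _
  j_left f Y := map_whiskerRight_jj f Y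
  j_right X _ _ g := map_whiskerLeft_jj X g
  p_left f Y := ((tensorRightProj (k := k) Y).naturality f)
  p_right X _ _ g := ((tensorLeftProj (k := k) X).naturality g)

instance : (resk k A).PreservesHomology := by
  have : PreservesFiniteLimits (resk k A) := ⟨fun J _ _ => ⟨inferInstance⟩⟩
  have : PreservesFiniteColimits (resk k A) := inferInstance
  infer_instance

variable {k} in
lemma htpy_whiskerLeft (K : CochainComplex (ModuleCat.{u} k) ℤ) {L L' : CochainComplex (ModuleCat.{u} k) ℤ}
    (f : L ⟶ L') (hf : homotopyEquivalences _ (.up ℤ) f) :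
    homotopyEquivalences _ (.up ℤ) (K ◁ f) := by
  obtain ⟨e, rfl⟩ := hf
  exact ⟨{  hom := K ◁ e.hom
            inv := K ◁ e.inv
            homotopyHomInvId := (Homotopy.ofEq (whiskerLeft_comp ..).symm).trans
              ((mapBifunctorMapHomotopy₂ (𝟙 K) e.homotopyHomInvId (curriedTensor _) (.up ℤ)).trans
                (Homotopy.ofEq (whiskerLeft_id K L)))
            homotopyInvHomId := (Homotopy.ofEq (whiskerLeft_comp ..).symm).trans
              ((mapBifunctorMapHomotopy₂ (𝟙 K) e.homotopyInvHomId (curriedTensor _) (.up ℤ)).trans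
                (Homotopy.ofEq (whiskerLeft_id K L'))) }, rfl⟩

variable {k} in
lemma htpy_whiskerRight (K : CochainComplex (ModuleCat.{u} k) ℤ) {L L' : CochainComplex (ModuleCat.{u} k) ℤ}
    (f : L ⟶ L') (hf : homotopyEquivalences _ (.up ℤ) f) :
    homotopyEquivalences _ (.up ℤ) (f ▷ K) := by
  obtain ⟨e, rfl⟩ := hf
  exact ⟨{  hom := e.hom ▷ K
            inv := e.inv ▷ K
            homotopyHomInvId := (Homotopy.ofEq (comp_whiskerRight ..).symm).trans
              ((mapBifunctorMapHomotopy₁ e.homotopyHomInvId (𝟙 K) (curriedTensor _) (.up ℤ)).trans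
                (Homotopy.ofEq (id_whiskerRight L K)))
            homotopyInvHomId := (Homotopy.ofEq (comp_whiskerRight ..).symm).trans
              ((mapBifunctorMapHomotopy₁ e.homotopyInvHomId (𝟙 K) (curriedTensor _) (.up ℤ)).trans
                (Homotopy.ofEq (id_whiskerRight L' K))) }, rfl⟩

variable {A}

lemma quasiIso_of_htpy_tensor {K K' L L' : CochainComplex (ModuleCat.{u} A) ℤ} (f : K ⟶ K') (g : L ⟶ L')
    (h : homotopyEquivalences _ (.up ℤ) (HomologicalComplex.tensorHom ((fc (resk k A)).map f) ((fc (resk k A)).map g))) :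
    HomologicalComplex.quasiIso _ (.up ℤ) (f ⊗ₘ g) := by
  have h1 := (HomologicalComplex.quasiIso _ (.up ℤ)).of_retract
    ((tensorRetract k A).retract f g) (homotopyEquivalences_le_quasiIso _ _ _ h)
  exact (quasiIso_map_iff_of_preservesHomology (HomologicalComplex.tensorHom f g) (resk k A)).1 h1

lemma htpy_of_quasiIso {K L : CochainComplex (ModuleCat.{u} A) ℤ} (f : K ⟶ L)
    (hK : bddCochain _ K) (hL : bddCochain _ L) (hf : HomologicalComplex.quasiIso _ (.up ℤ) f) :
    homotopyEquivalences _ (.up ℤ) ((fc (resk k A)).map f) := by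
  obtain ⟨_, b, _, _⟩ := hK
  obtain ⟨_, c, _, _⟩ := hL
  have : QuasiIso f := hf
  have pr (V : ModuleCat.{u} k) : Projective V := inferInstance
  have : ((fc (resk k A)).obj K).IsStrictlyLE b := inferInstance
  have : ((fc (resk k A)).obj L).IsStrictlyLE c := inferInstance
  have := CochainComplex.isKProjective_of_projective ((fc (resk k A)).obj K) b
  have := CochainComplex.isKProjective_of_projective ((fc (resk k A)).obj L) c
  exact (CochainComplex.IsKProjective.quasiIso_iff ((fc (resk k A)).map f)).1 inferInstance

/-- Tensoring with a complex preserves quasi-isomorphisms of bounded complexes. -/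
lemma quasiIso_whiskerLeft (X : CochainComplex (ModuleCat.{u} A) ℤ) {K L : CochainComplex (ModuleCat.{u} A) ℤ} (f : K ⟶ L)
    (hK : bddCochain _ K) (hL : bddCochain _ L) (hf : HomologicalComplex.quasiIso _ (.up ℤ) f) :
    HomologicalComplex.quasiIso _ (.up ℤ) (X ◁ f) := by
  rw [← id_tensorHom]
  apply quasiIso_of_htpy_tensor k
  have := htpy_whiskerLeft ((fc (resk k A)).obj X) _ (htpy_of_quasiIso k f hK hL hf)
  rw [← id_tensorHom] at this
  rw [CategoryTheory.Functor.map_id]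
  exact this

lemma quasiIso_whiskerRight (X : CochainComplex (ModuleCat.{u} A) ℤ) {K L : CochainComplex (ModuleCat.{u} A) ℤ} (f : K ⟶ L)
    (hK : bddCochain _ K) (hL : bddCochain _ L) (hf : HomologicalComplex.quasiIso _ (.up ℤ) f) :
    HomologicalComplex.quasiIso _ (.up ℤ) (f ▷ X) := by
  rw [← tensorHom_id]
  apply quasiIso_of_htpy_tensor k
  have := htpy_whiskerRight ((fc (resk k A)).obj X) _ (htpy_of_quasiIso k f hK hL hf)
  rw [← tensorHom_id] at this
  rw [CategoryTheory.Functor.map_id]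
  exact this

end

end Qis

/-! ## The monoidal structure on the bounded derived category of finite-dimensional modules -/

section MonDer

open Limits HomologicalComplex

section
variable (k A : Type u) [Field k] [Ring A] [Algebra k A]

/-- Bounded complexes of finite-dimensional modules. -/
def bddfd : ObjectProperty (CochainComplex (ModuleCat.{u} A) ℤ) := fun K =>
  bddCochain _ K ∧ ∀ i, isFD k A (K.X i)

/-- The category of bounded complexes of finite-dimensional modules. -/
abbrev Cb := (bddfd k A).FullSubcategory

section
variable [Coalgebra k A] [IsWeakBialgebra k A]

lemma isZero_tensor {K L : CochainComplex (ModuleCat.{u} A) ℤ} (n : ℤ)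
    (h : ∀ a b : ℤ, a + b = n → IsZero (K.X a) ∨ IsZero (L.X b)) :
    IsZero ((HomologicalComplex.tensorObj K L).X n) := by
  rw [IsZero.iff_id_eq_zero]
  apply mapBifunctor.hom_ext
  intro a b hab
  rcases h a b hab with h | h
  · exact ((tensorRight (L.X b)).map_isZero h).eq_of_src _ _
  · exact ((tensorLeft (K.X a)).map_isZero h).eq_of_src _ _

lemma isFD_tensor_X [FiniteDimensional k A] {K L : CochainComplex (ModuleCat.{u} A) ℤ}
    (hK : bddfd k A K) (hL : bddfd k A L) (n : ℤ) :
    isFD k A ((HomologicalComplex.tensorObj K L).X n) := by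
  obtain ⟨⟨a, b, _, _⟩, hK⟩ := hK
  let φ : (⨁ fun p : Finset.Icc a b => K.X p.1 ⊗ L.X (n - p.1)) ⟶ (HomologicalComplex.tensorObj K L).X n :=
    biproduct.desc fun p => ιTensorObj K L p.1 (n - p.1) n (by lia)
  have : Epi φ := ⟨fun {Z} f g h => by
    apply mapBifunctor.hom_ext
    intro p q hpq
    by_cases hp : p ∈ Finset.Icc a b
    · obtain rfl : q = n - p := by dsimp at hpq; lia
      have := biproduct.ι (fun p : Finset.Icc a b => K.X p.1 ⊗ L.X (n - p.1)) ⟨p, hp⟩ ≫= h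
      simp only [φ, biproduct.ι_desc_assoc] at this
      exact this
    · have : IsZero (K.X p) := by
        rw [Finset.mem_Icc, not_and_or, not_le, not_le] at hp
        rcases hp with hp | hp
        · exact K.isZero_of_isStrictlyGE a p
        · exact K.isZero_of_isStrictlyLE b p
      exact ((tensorRight (L.X q)).map_isZero this).eq_of_src _ _⟩
  refine isFD_of_epi φ ?_
  refine (isFD k A).prop_of_iso (biproduct.isoProduct _).symm ((isFD k A).prop_product fun p => ?_)
  exact (isFD k A).prop_tensor (hK _) (hL.2 _)

instance [FiniteDimensional k A] : (bddfd k A).IsMonoidal where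
  prop_unit := ⟨⟨0, 0, inferInstanceAs (CochainComplex.IsStrictlyGE
        ((HomologicalComplex.single _ (.up ℤ) 0).obj (𝟙_ (ModuleCat.{u} A))) 0),
      inferInstanceAs (CochainComplex.IsStrictlyLE
        ((HomologicalComplex.single _ (.up ℤ) 0).obj (𝟙_ (ModuleCat.{u} A))) 0)⟩, fun i => by
      change isFD k A (((HomologicalComplex.single _ (.up ℤ) 0).obj (𝟙_ (ModuleCat.{u} A))).X i)
      by_cases h : i = 0
      · exact (isFD k A).prop_of_iso (singleObjXIsoOfEq (.up ℤ) 0 _ i h).symm (isFD k A).prop_unit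
      · exact (isFD k A).prop_of_isZero (isZero_single_obj_X (.up ℤ) 0 _ i h)⟩
  prop_tensor K L hK hL := ⟨by
    obtain ⟨⟨a, b, _, _⟩, -⟩ := hK
    obtain ⟨⟨c, d, _, _⟩, -⟩ := hL
    refine ⟨a + c, b + d, ?_, ?_⟩
    · rw [CochainComplex.isStrictlyGE_iff]
      intro n hn
      refine isZero_tensor k A n fun p q h => ?_
      by_cases hp : p < a
      · exact .inl (K.isZero_of_isStrictlyGE a p)
      · exact .inr (L.isZero_of_isStrictlyGE c q)
    · rw [CochainComplex.isStrictlyLE_iff]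
      intro n hn
      refine isZero_tensor k A n fun p q h => ?_
      by_cases hp : b < p
      · exact .inl (K.isZero_of_isStrictlyLE b p)
      · exact .inr (L.isZero_of_isStrictlyLE d q), fun n => isFD_tensor_X k A hK hL n⟩

/-- Quasi-isomorphisms between bounded complexes of finite-dimensional modules. -/
def qis : MorphismProperty (Cb k A) :=
  (HomologicalComplex.quasiIso (ModuleCat.{u} A) (.up ℤ)).inverseImage (bddfd k A).ι

instance : (qis k A).IsMultiplicative := by dsimp only [qis]; infer_instance

instance [FiniteDimensional k A] : (qis k A).IsMonoidal where
  whiskerLeft X K L f hf := quasiIso_whiskerLeft k X.obj f.hom K.property.1 L.property.1 hf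
  whiskerRight {K L} f hf X := quasiIso_whiskerRight k X.obj f.hom K.property.1 L.property.1 hf

end

variable {k A} in
lemma isZero_fd {X : FDMod k A} (h : IsZero X.obj) : IsZero X := by
  rw [IsZero.iff_id_eq_zero]
  ext : 1
  exact h.eq_of_src _ _

/-- Bounded complexes of finite-dimensional modules, as complexes in `FDMod`. -/
def toChb : Cb k A ⥤ Chb (FDMod k A) :=
  (bddCochain _).lift (HomologicalComplex.liftFunctorObjectProperty (isFD k A) (bddfd k A).ι
    (fun K => K.property.2)) (fun K => by
      obtain ⟨a, b, ha, hb⟩ := K.property.1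
      refine ⟨a, b, ?_, ?_⟩
      · rw [CochainComplex.isStrictlyGE_iff]
        intro n hn
        exact isZero_fd (K.obj.isZero_of_isStrictlyGE a n)
      · rw [CochainComplex.isStrictlyLE_iff]
        intro n hn
        exact isZero_fd (K.obj.isZero_of_isStrictlyLE b n))

/-- The inclusion of complexes in `FDMod` in all complexes of modules. -/
abbrev ιc : CochainComplex (FDMod k A) ℤ ⥤ CochainComplex (ModuleCat.{u} A) ℤ :=
  (isFD k A).ι.mapHomologicalComplex (.up ℤ)

instance : (toChb k A).Full where
  map_surjective f := ⟨ObjectProperty.homMk ((ιc k A).map f.hom), rfl⟩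

instance : (toChb k A).Faithful where
  map_injective {K L f g} h := by
    ext n : 2
    exact congr_arg (fun h => (h.hom.f n).hom) h

instance : (toChb k A).EssSurj where
  mem_essImage K := by
    have hK : bddCochain _ ((ιc k A).obj K.obj) := by
      obtain ⟨a, b, ha, hb⟩ := K.property
      exact ⟨a, b, inferInstance, inferInstance⟩
    exact ⟨⟨(ιc k A).obj K.obj, hK, fun i => (K.obj.X i).property⟩,
      ⟨(bddCochain _).isoMk (HomologicalComplex.Hom.isoOfComponents (fun i => Iso.refl _)
        (fun i j _ => (Category.id_comp _).trans (Category.comp_id _).symm))⟩⟩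

instance : (toChb k A).IsEquivalence where

instance : (isFD k A).ι.PreservesHomology where
  preservesKernels _ _ f := (isFD k A).preservesKernels_ι f
  preservesCokernels _ _ f := (isFD k A).preservesCokernels_ι f

lemma qisb_toChb_iff {K L : Cb k A} (f : K ⟶ L) :
    qisb _ ((toChb k A).map f) ↔ qis k A f :=
  (quasiIso_map_iff_of_preservesHomology ((toChb k A).map f).hom (isFD k A).ι).symm

noncomputable instance : HasDerivedCategory.{u + 1} (FDMod k A) := HasDerivedCategory.standard _

/-- `D^b(A-mod)`. -/
abbrev Db := DerivedCategory.Bounded (FDMod k A)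

instance : (qisb (FDMod k A)).RespectsIso := by dsimp only [qisb]; infer_instance

/-- The localization functor from bounded complexes of finite-dimensional modules. -/
noncomputable def Qfd : Cb k A ⥤ Db k A := toChb k A ⋙ Qb (FDMod k A)

variable [Coalgebra k A] [IsWeakBialgebra k A]

instance : (Qfd k A).IsLocalization (qis k A) := by
  refine Functor.IsLocalization.of_equivalence_source (Qb (FDMod k A)) (qisb (FDMod k A)) _ _
    (toChb k A).asEquivalence.symm ?_ ?_ ?_
  · intro K L f hf
    apply MorphismProperty.le_isoClosure
    change qis k A ((toChb k A).inv.map f)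
    rw [← qisb_toChb_iff]
    exact ((qisb _).arrow_mk_iso_iff (Arrow.isoOfNatIso
      (toChb k A).asEquivalence.counitIso (Arrow.mk f))).2 hf
  · intro K L f hf
    exact Localization.inverts (Qb _) (qisb _) _ ((qisb_toChb_iff k A f).2 hf)
  · exact (Functor.associator _ _ _).symm ≪≫
      Functor.isoWhiskerRight (toChb k A).asEquivalence.counitIso _ ≪≫ Functor.leftUnitor _

variable [FiniteDimensional k A]

/-- The tensor product of `D^b(A-mod)` induced by the tensor product of bounded complexes. -/
noncomputable instance : MonoidalCategory (Db k A) :=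
  inferInstanceAs (MonoidalCategory
    (LocalizedMonoidal (Qfd k A) (qis k A) (Iso.refl ((Qfd k A).obj (𝟙_ (Cb k A))))))

end

end MonDer

/-! ## The notions in the statement -/

section Notions

/-- A ring is hereditary if all its left ideals are projective. -/
def IsHereditary (A : Type*) [Ring A] : Prop := ∀ I : Submodule A A, Module.Projective A I

/-- The given algebra and coalgebra structures on `A` form a bialgebra: the comultiplication and
the counit are unital and multiplicative. -/
structure IsBialgebra (k A : Type*) [Field k] [Ring A] [Algebra k A] [Coalgebra k A] : Prop where
  comul_one : Coalgebra.comul (R := k) (1 : A) = 1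
  comul_mul (a b : A) :
    Coalgebra.comul (R := k) (a * b) = Coalgebra.comul (R := k) a * Coalgebra.comul (R := k) b
  counit_one : Coalgebra.counit (R := k) (1 : A) = 1
  counit_mul (a b : A) :
    Coalgebra.counit (R := k) (a * b) = Coalgebra.counit (R := k) a * Coalgebra.counit (R := k) b

section
variable (k : Type*) [Field k] (C : Type*) [Category* C] [Preadditive C] [Linear k C]
  [MonoidalCategory C] (D : Type*) [Category* D] [Preadditive D] [Linear k D] [MonoidalCategory D]

/-- Discrete monoidal abelian categories: morphism spaces are finite-dimensional, objects have
finite length, there are finitely many simple objects `S 0, …, S (n - 1)` up to isomorphism, and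
`S i ⊗ S j` is isomorphic to `S i` for `i = j` and is zero otherwise. -/
structure IsDiscrete : Prop where
  finite_hom (X Y : C) : Module.Finite k (X ⟶ Y)
  finite_length (X : C) : IsArtinianObject X ∧ IsNoetherianObject X
  simples : ∃ (n : ℕ) (S : Fin n → C), (∀ i, Simple (S i)) ∧
    (∀ i j, Nonempty (S i ≅ S j) → i = j) ∧
    (∀ X : C, Simple X → ∃ i, Nonempty (X ≅ S i)) ∧
    (∀ i, Nonempty (S i ⊗ S i ≅ S i)) ∧ ∀ i j, i ≠ j → Limits.IsZero (S i ⊗ S j)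

/-- Two monoidal abelian categories over `k` are equivalent: there is a `k`-linear strong
monoidal equivalence. -/
def MonoidalAbelianEquivalent : Prop :=
  ∃ e : C ≌ D, e.functor.Additive ∧ e.functor.Linear k ∧ Nonempty e.functor.Monoidal

open Limits Pretriangulated in
/-- Two monoidal triangulated categories over `k` are equivalent: there is a `k`-linear strong
monoidal equivalence which commutes with the shifts and preserves distinguished triangles. -/
def MonoidalTriangulatedEquivalent
    [HasZeroObject C] [HasShift C ℤ] [∀ n : ℤ, (shiftFunctor C n).Additive] [Pretriangulated C]
    [HasZeroObject D] [HasShift D ℤ] [∀ n : ℤ, (shiftFunctor D n).Additive]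
    [Pretriangulated D] : Prop :=
  ∃ e : C ≌ D, e.functor.Additive ∧ e.functor.Linear k ∧ Nonempty e.functor.Monoidal ∧
    ∃ _ : e.functor.CommShift ℤ, e.functor.IsTriangulated

end

end Notions

end WeakBialg

/-! ## Hereditary t-structures -/

/-! The modules can be recovered inside the derived category as the objects concentrated in degree
zero, so the point is that a monoidal triangulated equivalence `e` must identify the two hearts. It
has no reason to do so on triangulated grounds alone; the tensor product forces it.

Heredity enters through `IsHereditaryTStructure`: extensions of length at least two vanish, so every
object of the bounded derived category is a finite direct sum of objects concentrated in single
degrees (`IsHereditaryTStructure.induction`). Take a nonzero `X` in the heart for `A` and suppose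
that `e X` is concentrated in degree `n`. Tensor products add degrees (`conc_tensor`), so the tensor
power of `X` with `2 ^ m` factors, which still lies in the heart for `A`, is sent to degree `2 ^ m *
n`. Nonzero objects of the heart for `A` have nonzero tensor squares
(`isZero_of_isZero_tensor_conc`), so none of these powers vanishes. The degrees in which `e` can
place nonzero objects of the heart are bounded (`IsHereditaryTStructure.exists_bounds` applied to
the preimage of the free module of rank one, which detects nonzero objects by `exists_generator`).
Hence `n = 0`; this is `eq_zero_of_conc`.

For a general object of the heart for `A`, its image splits into pieces of single degrees; the
preimages of the pieces are summands of an object of the heart, so each nonzero piece has degree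
zero. The converse splits an object on the side of `A` and uses compatibility with shifts. Together
these give `conc_zero_iff_of_equivalence`, in which tensor nilpotents are excluded for `A` only.

It remains to see that the heart, with the tensor product of the localized category, is the monoidal
category of modules. Complexes concentrated in degree zero serve as an intermediary: evaluation
`ev₀` makes them monoidally equivalent to modules, and localization `Q₀` embeds them monoidally and
fully faithfully, with the heart as essential image. -/

namespace WeakBialg

section Hereditary

open Limits Pretriangulated Triangulated

variable {C : Type*} [Category* C] [Preadditive C] [HasZeroObject C] [HasShift C ℤ]
  [∀ n : ℤ, (shiftFunctor C n).Additive] [Pretriangulated C]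

/-- Objects concentrated in degree `n` with respect to a t-structure. -/
def conc (t : TStructure C) (n : ℤ) : ObjectProperty C := fun X => t.IsGE X n ∧ t.IsLE X n

instance (t : TStructure C) (n : ℤ) : (conc t n).IsClosedUnderIsomorphisms where
  of_iso e h := by
    have := h.1
    have := h.2
    exact ⟨t.isGE_of_iso e n, t.isLE_of_iso e n⟩

/-- Degrees are cohomological, so shifting by `a` lowers the degree by `a`. -/
lemma conc_shift {t : TStructure C} {n : ℤ} {X : C} (h : conc t n X) (a m : ℤ) (hm : a + m = n) :
    conc t m (X⟦a⟧) := by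
  have := h.1
  have := h.2
  exact ⟨t.isGE_shift X n a m hm, t.isLE_shift X n a m hm⟩

lemma isZero_of_conc {t : TStructure C} {n m : ℤ} {X : C} (hn : conc t n X) (hm : conc t m X)
    (h : n ≠ m) : IsZero X := by
  have := hn.1
  have := hn.2
  have := hm.1
  have := hm.2
  rcases lt_or_gt_of_ne h with h | h
  · exact t.isZero X n m h
  · exact t.isZero X m n h

lemma conc_of_isZero (t : TStructure C) [IsTriangulated C] (n : ℤ) {X : C} (h : IsZero X) :
    conc t n X := ⟨t.isGE_of_isZero h n, t.isLE_of_isZero h n⟩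

/-- Both halves of a t-structure are orthogonals of one another, and a vanishing condition on
morphisms passes to retracts. This form suits summands that are transported along a functor, where
only the retraction is at hand. -/
lemma conc_of_retract {t : TStructure C} [IsTriangulated C] {n : ℤ} {X Y : C} (r : Retract X Y)
    (h : conc t n Y) : conc t n X := by
  have := h.1
  have := h.2
  constructor
  · rw [t.isGE_iff_orthogonal (n - 1) n (by lia)]
    intro Z f _
    rw [← Category.comp_id f, ← r.retract, ← Category.assoc, t.zero (f ≫ r.i) (n - 1) n, zero_comp]
  · rw [t.isLE_iff_orthogonal n (n + 1) rfl]
    intro Z f _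
    rw [← Category.id_comp f, ← r.retract, Category.assoc, t.zero (r.r ≫ f) n (n + 1), comp_zero]

lemma conc_biprod {t : TStructure C} [IsTriangulated C] {n : ℤ} {X Y : C} (hX : conc t n X)
    (hY : conc t n Y) : conc t n (X ⊞ Y) :=
  ⟨t.isGE₂ _ (binaryBiproductTriangle_distinguished X Y) n hX.1 hY.1,
    t.isLE₂ _ (binaryBiproductTriangle_distinguished X Y) n hX.2 hY.2⟩

/-- A bounded t-structure is hereditary if there are no extensions of length at least two
between objects of its heart. -/
structure IsHereditaryTStructure (t : TStructure C) : Prop where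
  bounded (X : C) : ∃ a b, t.IsGE X a ∧ t.IsLE X b
  -- With `X = M⟦-n⟧` and `Y = N⟦-m⟧` for `M`, `N` in the heart, these morphisms play the role of
  -- Ext of degree `n - m ≥ 2`.
  hom_eq_zero {n m : ℤ} {X Y : C} (hX : conc t n X) (hY : conc t m Y) (h : m + 2 ≤ n)
    (f : X ⟶ Y) : f = 0

variable [IsTriangulated C] {t : TStructure C}

/-- In the rotated triangle the upper truncation lies between `X`, in degrees at most `b`, and the
shift by one of the lower truncation, in degrees at most `a - 1`; so truncating does not create
anything above `b`. -/
lemma conc_triangleLEGE {X : C} (a b : ℤ) [t.IsLE X b] (h : a + 1 = b) :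
    conc t b ((t.triangleLEGE a b h).obj X).obj₃ := by
  refine ⟨inferInstanceAs (t.IsGE ((t.truncGE b).obj X) b), ?_⟩
  have := t.isLE_shift ((t.truncLE a).obj X) a 1 (a - 1) (by lia)
  exact t.isLE₂ _ (rot_of_distTriang _ (t.triangleLEGE_distinguished a b h X)) b
    (inferInstanceAs (t.IsLE X b)) (t.isLE_of_le (((t.truncLE a).obj X)⟦(1 : ℤ)⟧) (a - 1) b)

/-- In the inversely rotated triangle the lower truncation lies between the upper truncation shifted
by `-1`, in degrees at least `b + 1`, and `X`. This keeps the lower bound when the top degree is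
peeled off in the inductions below. -/
lemma isGE_triangleLEGE {X : C} (a b c : ℤ) [t.IsGE X c] (h : a + 1 = b) (hc : c ≤ b) :
    t.IsGE ((t.triangleLEGE a b h).obj X).obj₁ c := by
  have := t.isGE_shift ((t.truncGE b).obj X) b (-1) (b + 1) (by lia)
  exact t.isGE₂ _ (inv_rot_of_distTriang _ (t.triangleLEGE_distinguished a b h X)) c
    (t.isGE_of_ge (((t.truncGE b).obj X)⟦(-1 : ℤ)⟧) c (b + 1)) (inferInstanceAs (t.IsGE X c))

/-- There are no morphisms from an object concentrated in degree `n` to a bounded object in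
degrees at most `n - 2`. -/
lemma IsHereditaryTStructure.hom_eq_zero_of_isLE (ht : IsHereditaryTStructure t) {n : ℤ} {X : C}
    (hX : conc t n X) (d : ℕ) : ∀ (b : ℤ) (_ : b + 2 ≤ n) (Y : C) (_ : t.IsGE Y (b - d))
      (_ : t.IsLE Y b) (f : X ⟶ Y), f = 0 := by
  induction d with
  | zero =>
    intro b hb Y h₁ h₂ f
    exact ht.hom_eq_zero hX ⟨by simpa using h₁, h₂⟩ hb f
  | succ d ih =>
    intro b hb Y h₁ h₂ f
    have dist := t.triangleLEGE_distinguished (b - 1) b (by lia) Y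
    -- The composite of `f` with the truncation of `Y` to its top degree `b` joins objects in single
    -- degrees at distance at least two, so it vanishes and `f` lifts to the truncation in degrees
    -- at most `b - 1`, whose amplitude is smaller.
    obtain ⟨g, hg⟩ := Triangle.coyoneda_exact₂ _ dist f
      (ht.hom_eq_zero hX (conc_triangleLEGE (b - 1) b (by lia)) hb _)
    have hge : t.IsGE ((t.triangleLEGE (b - 1) b (by lia)).obj Y).obj₁ (b - 1 - d) := by
      rw [show b - 1 - d = b - (d + 1 : ℕ) by lia]
      exact isGE_triangleLEGE (X := Y) (t := t) (b - 1) b (b - (d + 1 : ℕ)) (by lia) (by lia)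
    rw [hg, ih (b - 1) (by lia) _ hge (inferInstanceAs (t.IsLE ((t.truncLE (b - 1)).obj Y) _)) g]
    exact zero_comp

/-- Every object is a finite direct sum of objects concentrated in one degree. -/
lemma IsHereditaryTStructure.induction (ht : IsHereditaryTStructure t) (P : ObjectProperty C)
    [P.IsClosedUnderIsomorphisms] (h₁ : ∀ n X, conc t n X → P X)
    (h₂ : ∀ X Y, P X → P Y → P (X ⊞ Y)) (X : C) : P X := by
  -- Induction on the amplitude `d`. For bounds with `b < a` the truncated difference is `0`, and `b
  -- - 0` is still a valid lower bound because it is below `a`.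
  suffices ∀ (d : ℕ) (b : ℤ) (Y : C) (_ : t.IsGE Y (b - d)) (_ : t.IsLE Y b), P Y by
    obtain ⟨a, b, ha, hb⟩ := ht.bounded X
    exact this (b - a).toNat b X (t.isGE_of_ge X _ a (by lia)) hb
  intro d
  induction d with
  | zero =>
    intro b Y hY hY'
    exact h₁ b Y ⟨by simpa using hY, hY'⟩
  | succ d ih =>
    intro b Y hY hY'
    have dist := t.triangleLEGE_distinguished (b - 1) b (by lia) Y
    have hc := conc_triangleLEGE (X := Y) (t := t) (b - 1) b (by lia)
    have hle : t.IsLE ((t.triangleLEGE (b - 1) b (by lia)).obj Y).obj₁ (b - 1) :=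
      inferInstanceAs (t.IsLE ((t.truncLE (b - 1)).obj Y) _)
    have hge : t.IsGE ((t.triangleLEGE (b - 1) b (by lia)).obj Y).obj₁ (b - 1 - d) := by
      rw [show b - 1 - d = b - (d + 1 : ℕ) by lia]
      exact isGE_triangleLEGE (X := Y) (t := t) (b - 1) b (b - (d + 1 : ℕ)) (by lia) (by lia)
    -- The connecting morphism goes from degree `b` to the shift by one of an object in degrees at
    -- most `b - 1`, that is, to degrees at most `b - 2`. Heredity kills it, so the truncation
    -- triangle splits.
    obtain ⟨e, -⟩ := exists_iso_binaryBiproduct_of_distTriang _ dist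
      (ht.hom_eq_zero_of_isLE hc d (b - 2) (by lia) _
        (t.isGE_shift _ (b - 1 - d) 1 _ (by lia)) (t.isLE_shift _ (b - 1) 1 _ (by lia)) _)
    exact P.prop_of_iso e.symm (h₂ _ _ (ih _ _ hge hle) (h₁ _ _ hc))

/-- The degrees of objects of the shifts of the heart which receive a nonzero morphism from a
given object are bounded. -/
lemma IsHereditaryTStructure.exists_bounds (ht : IsHereditaryTStructure t) (X : C) :
    ∃ c d : ℤ, ∀ (n : ℤ) (Y : C) (_ : conc t n Y) (f : X ⟶ Y), f ≠ 0 → c ≤ n ∧ n ≤ d := by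
  let P : ObjectProperty C := fun X => ∃ c d : ℤ, ∀ (n : ℤ) (Y : C) (_ : conc t n Y) (f : X ⟶ Y),
    f ≠ 0 → c ≤ n ∧ n ≤ d
  have : P.IsClosedUnderIsomorphisms := ⟨by
    rintro X X' e ⟨c, d, h⟩
    exact ⟨c, d, fun n Y hY f hf => h n Y hY (e.hom ≫ f) (by simpa using hf)⟩⟩
  refine ht.induction P ?_ ?_ X
  · intro m X hX
    -- From degree `m` a nonzero morphism cannot reach a degree above `m` by orthogonality, nor one
    -- below `m - 1` by heredity: only Hom and Ext of degree one survive.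
    refine ⟨m - 1, m, fun n Y hY f hf => ?_⟩
    have := hX.2
    have := hY.1
    by_contra hn
    apply hf
    by_cases h : m < n
    · exact t.zero f m n h
    · exact ht.hom_eq_zero hX hY (by lia) f
  · rintro X X' ⟨c, d, h⟩ ⟨c', d', h'⟩
    refine ⟨min c c', max d d', fun n Y hY f hf => ?_⟩
    by_cases h₁ : biprod.inl ≫ f = 0
    · have h₂ : biprod.inr ≫ f ≠ 0 := fun h₂ => hf (biprod.hom_ext' _ _ (by simpa) (by simpa))
      have := h' n Y hY _ h₂
      lia
    · have := h n Y hY _ h₁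
      lia

/-! ### Comparison of hearts under a monoidal equivalence -/

variable {D : Type*} [Category* D] [Preadditive D] [HasZeroObject D] [HasShift D ℤ]
  [∀ n : ℤ, (shiftFunctor D n).Additive] [Pretriangulated D] [IsTriangulated D]
  {s : TStructure D}

section

variable [MonoidalCategory C] [MonoidalCategory D] (F : C ⥤ D) [F.Monoidal]

/-- The degree of a tensor square is doubled, so that an object of the heart which is not
tensor nilpotent cannot be shifted by a functor of bounded amplitude. -/
lemma eq_zero_of_conc
    (hC : ∀ X Y, conc t 0 X → conc t 0 Y → conc t 0 (X ⊗ Y))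
    (hD : ∀ p X Y, conc s p X → conc s p Y → conc s (p + p) (X ⊗ Y))
    (hsq : ∀ X, conc t 0 X → ¬ IsZero X → ¬ IsZero (X ⊗ X))
    (c d : ℤ) (hF : ∀ n X, conc t 0 X → conc s n (F.obj X) → ¬ IsZero X → c ≤ n ∧ n ≤ d)
    (n : ℤ) (X : C) (hX : conc t 0 X) (hn : conc s n (F.obj X)) (h0 : ¬ IsZero X) : n = 0 := by
  -- Repeated squaring of `X` stays in the first heart and stays nonzero, while the degree of the
  -- image doubles each time.
  have key (m : ℕ) : ∃ Y, conc t 0 Y ∧ conc s (2 ^ m * n) (F.obj Y) ∧ ¬ IsZero Y := by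
    induction m with
    | zero => exact ⟨X, hX, by simpa using hn, h0⟩
    | succ m ih =>
      obtain ⟨Y, h₁, h₂, h₃⟩ := ih
      refine ⟨Y ⊗ Y, hC _ _ h₁ h₁, ?_, hsq _ h₁ h₃⟩
      have := (conc s _).prop_of_iso (Functor.Monoidal.μIso F Y Y) (hD _ _ _ h₂ h₂)
      convert this using 1
      ring
  have bound (m : ℕ) : c ≤ 2 ^ m * n ∧ 2 ^ m * n ≤ d := by
    obtain ⟨Y, h₁, h₂, h₃⟩ := key m
    exact hF _ Y h₁ h₂ h₃
  -- For `n ≠ 0` the absolute value of `2 ^ m * n` is at least `2 ^ m`, so a power of two beyond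
  -- `|c| + |d|` contradicts the bounds.
  obtain ⟨m, hm⟩ : ∃ m : ℕ, |c| + |d| < 2 ^ m := by
    obtain ⟨m, hm⟩ := pow_unbounded_of_one_lt (|c| + |d|) (one_lt_two (α := ℤ))
    exact ⟨m, hm⟩
  obtain ⟨h₁, h₂⟩ := bound m
  by_contra hn0
  have hc := neg_abs_le c
  have hd := le_abs_self d
  have := abs_nonneg c
  have := abs_nonneg d
  rcases lt_or_gt_of_ne hn0 with h | h
  · nlinarith
  · nlinarith

end

variable [MonoidalCategory C] [MonoidalCategory D] (e : C ≌ D) [e.functor.Monoidal]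
  [e.functor.Additive] [e.functor.CommShift ℤ]

/-- A monoidal triangulated equivalence identifies the hearts of two hereditary t-structures if
the first heart does not have tensor nilpotent objects. -/
theorem conc_zero_iff_of_equivalence (ht : IsHereditaryTStructure t) (hs : IsHereditaryTStructure s)
    (hC : ∀ X Y, conc t 0 X → conc t 0 Y → conc t 0 (X ⊗ Y))
    (hD : ∀ p X Y, conc s p X → conc s p Y → conc s (p + p) (X ⊗ Y))
    (hsq : ∀ X, conc t 0 X → ¬ IsZero X → ¬ IsZero (X ⊗ X))
    (hgen : ∃ G : D, ∀ (n : ℤ) (Z : D), conc s n Z → ¬ IsZero Z → ∃ f : G ⟶ Z⟦n⟧, f ≠ 0)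
    (X : C) : conc t 0 X ↔ conc s 0 (e.functor.obj X) := by
  obtain ⟨G, hG⟩ := hgen
  obtain ⟨c, d, hcd⟩ := ht.exists_bounds (e.inverse.obj G)
  have hz (Y : C) : IsZero (e.functor.obj Y) ↔ IsZero Y := by
    constructor
    · exact fun h => (e.inverse.map_isZero h).of_iso (e.unitIso.app Y)
    · exact fun h => e.functor.map_isZero h
  have key (n : ℤ) (Y : C) (hY : conc t 0 Y) (hn : conc s n (e.functor.obj Y)) (h0 : ¬ IsZero Y) :
      n = 0 := by
    -- A nonzero morphism from `G` to the image of `Y` shifted by `n` comes from a nonzero morphism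
    -- from the preimage of `G` to `Y⟦n⟧`. The latter target sits in degree `-n`, so the bounds `c`,
    -- `d` on `-n` turn into `-d`, `-c` on `n`.
    refine eq_zero_of_conc e.functor hC hD hsq (-d) (-c) ?_ n Y hY hn h0
    intro n Y hY hn h0
    obtain ⟨f, hf⟩ := hG n _ hn (by rwa [hz])
    let g : e.functor.obj (e.inverse.obj G) ⟶ e.functor.obj (Y⟦n⟧) :=
      e.counit.app G ≫ f ≫ (e.functor.commShiftIso n).inv.app Y
    obtain ⟨g', hg'⟩ := e.functor.map_surjective g
    have := hcd (-n) _ (conc_shift hY n (-n) (by lia)) g' (by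
      rintro rfl
      rw [Functor.map_zero] at hg'
      apply hf
      have h1 : g = 0 := hg'.symm
      simpa [g, Preadditive.IsIso.comp_left_eq_zero, Preadditive.IsIso.comp_right_eq_zero] using h1)
    lia
  -- The statement is phrased on the side of `D` because it is the image, not the original object,
  -- that has to be decomposed. As an implication it is stable under direct sums: its hypothesis
  -- passes to the summands, whose preimages are retracts.
  have hfwd (Z : D) : conc t 0 (e.inverse.obj Z) → conc s 0 Z := by
    let P : ObjectProperty D := fun Z => conc t 0 (e.inverse.obj Z) → conc s 0 Z
    have : P.IsClosedUnderIsomorphisms := ⟨fun i h h' => (conc s 0).prop_of_iso i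
      (h ((conc t 0).prop_of_iso (e.inverse.mapIso i.symm) h'))⟩
    refine hs.induction P ?_ ?_ Z
    · intro n Z hn hZ
      by_cases h0 : IsZero (e.inverse.obj Z)
      · exact conc_of_isZero s 0 ((e.functor.map_isZero h0).of_iso (e.counitIso.symm.app Z))
      · obtain rfl := key n _ hZ ((conc s n).prop_of_iso (e.counitIso.symm.app Z) hn) h0
        exact hn
    · intro Z Z' h h' hZ
      refine conc_biprod (h ?_) (h' ?_)
      · exact conc_of_retract (Retract.map ⟨biprod.inl, biprod.fst, by simp⟩ e.inverse) hZ
      · exact conc_of_retract (Retract.map ⟨biprod.inr, biprod.snd, by simp⟩ e.inverse) hZ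
  have hfwd' (Y : C) (hY : conc t 0 Y) : conc s 0 (e.functor.obj Y) :=
    hfwd _ ((conc t 0).prop_of_iso (e.unitIso.app Y) hY)
  refine ⟨hfwd' X, ?_⟩
  -- For the converse the decomposition takes place in `C`, again with an implication whose
  -- hypothesis passes to summands.
  let P : ObjectProperty C := fun Y => conc s 0 (e.functor.obj Y) → conc t 0 Y
  have : P.IsClosedUnderIsomorphisms := ⟨fun i h h' => (conc t 0).prop_of_iso i
    (h ((conc s 0).prop_of_iso (e.functor.mapIso i.symm) h'))⟩
  refine ht.induction P ?_ ?_ X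
  · intro n Y hn hY
    by_cases h : n = 0
    · rwa [h] at hn
    · refine conc_of_isZero t 0 ?_
      rw [← hz]
      -- `Y⟦n⟧` is in the heart, so by the forward direction its image is too; shifting back places
      -- the image of `Y` in degree `n`. It is also in degree `0` by assumption, so it is zero when
      -- `n ≠ 0`.
      refine isZero_of_conc hY (m := n) ?_ (Ne.symm h)
      have h₁ := hfwd' _ (conc_shift hn n 0 (by lia))
      have h₂ := (conc s 0).prop_of_iso ((e.functor.commShiftIso n).app Y) h₁
      have h₃ := conc_shift h₂ (-n) n (by lia)
      exact (conc s n).prop_of_iso ((shiftEquiv D n).unitIso.symm.app _) h₃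
  · intro Y Y' h h' hY
    refine conc_biprod (h ?_) (h' ?_)
    · exact conc_of_retract (Retract.map ⟨biprod.inl, biprod.fst, by simp⟩ e.functor) hY
    · exact conc_of_retract (Retract.map ⟨biprod.inr, biprod.snd, by simp⟩ e.functor) hY

end Hereditary

/-! ### Global dimension at most one and the canonical t-structure -/

section Dimension

open Limits Triangulated DerivedCategory

section

variable {C : Type*} [Category* C] [Abelian C] [HasDerivedCategory C]

/-- Morphisms between shifts of objects are extensions. -/
lemma shiftedHom_eq_zero (hC : ∀ X : C, HasProjectiveDimensionLT X 2) (X Y : C) (n : ℤ)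
    (hn : 2 ≤ n) (f : (singleFunctor C 0).obj X ⟶ ((singleFunctor C 0).obj Y)⟦n⟧) : f = 0 := by
  lift n to ℕ using by lia
  have := HasExt.standard C
  have := HasProjectiveDimensionLT.subsingleton X 2 n (by lia) Y
  have : Subsingleton (ShiftedHom ((singleFunctor C 0).obj X) ((singleFunctor C 0).obj Y) (n : ℤ)) :=
    Abelian.Ext.homEquiv.symm.subsingleton
  exact Subsingleton.elim (α := ShiftedHom ((singleFunctor C 0).obj X)
    ((singleFunctor C 0).obj Y) (n : ℤ)) _ _

/-- An object concentrated in one degree is a shift of an object of the abelian category. After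
shifting by `n`, the morphism becomes an extension class of degree `n - m ≥ 2`. -/
lemma derived_hom_eq_zero (hC : ∀ X : C, HasProjectiveDimensionLT X 2) {n m : ℤ}
    {X Y : DerivedCategory C} [X.IsGE n] [X.IsLE n] [Y.IsGE m] [Y.IsLE m] (h : m + 2 ≤ n)
    (f : X ⟶ Y) : f = 0 := by
  have := TStructure.t.isGE_shift X n n 0
  have := TStructure.t.isLE_shift X n n 0
  have := TStructure.t.isGE_shift Y m m 0
  have := TStructure.t.isLE_shift Y m m 0
  obtain ⟨M, ⟨i⟩⟩ := exists_iso_singleFunctor_obj_of_isGE_of_isLE (X⟦n⟧) 0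
  obtain ⟨N, ⟨j⟩⟩ := exists_iso_singleFunctor_obj_of_isGE_of_isLE (Y⟦m⟧) 0
  -- Only `Y⟦m⟧` is known to come from degree zero, so the shift by `n` is split as `m + (n - m)`.
  let j' : Y⟦n⟧ ≅ ((singleFunctor C 0).obj N)⟦n - m⟧ :=
    (shiftFunctorAdd' _ m (n - m) n (by lia)).app Y ≪≫ (shiftFunctor _ (n - m)).mapIso j
  have := shiftedHom_eq_zero hC M N (n - m) (by lia) (i.inv ≫ f⟦n⟧' ≫ j'.hom)
  apply (shiftFunctor (DerivedCategory C) n).map_injective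
  simpa [Preadditive.IsIso.comp_left_eq_zero, Preadditive.IsIso.comp_right_eq_zero] using this

variable (C) in
/-- The canonical t-structure of the bounded derived category. -/
noncomputable abbrev tb : TStructure (DerivedCategory.Bounded C) :=
  (TStructure.t (C := C)).onBounded

lemma conc_tb_iff (n : ℤ) (X : DerivedCategory.Bounded C) :
    conc (tb C) n X ↔ X.obj.IsGE n ∧ X.obj.IsLE n := by
  rw [conc, ObjectProperty.tStructure_isGE_iff, ObjectProperty.tStructure_isLE_iff]

/-- The bounded derived category of a hereditary abelian category has a hereditary t-structure. -/
lemma isHereditaryTStructure_tb (hC : ∀ X : C, HasProjectiveDimensionLT X 2) :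
    IsHereditaryTStructure (tb C) where
  bounded X := by
    obtain ⟨⟨a, ha⟩, ⟨b, hb⟩⟩ := X.property
    exact ⟨a, b, (ObjectProperty.tStructure_isGE_iff _ _ _ _).2 ha,
      (ObjectProperty.tStructure_isLE_iff _ _ _ _).2 hb⟩
  hom_eq_zero {n m X Y} hX hY h f := by
    obtain ⟨_, _⟩ := (conc_tb_iff n X).1 hX
    obtain ⟨_, _⟩ := (conc_tb_iff m Y).1 hY
    ext : 1
    exact derived_hom_eq_zero hC h f.hom

end

/-! ### Finite-dimensional modules over a hereditary algebra -/

section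

variable {k A : Type u} [Field k] [Ring A] [Algebra k A]

/-- The finite-rank case of Kaplansky's argument: the image of `N` under the first coordinate is a
left ideal, hence projective, so `N` is the direct sum of this ideal and the kernel, and the kernel
embeds in a free module of smaller rank. -/
lemma IsHereditary.projective_submodule_pi (hA : IsHereditary A) (n : ℕ)
    (N : Submodule A (Fin n → A)) : Module.Projective A N := by
  induction n with
  | zero => infer_instance
  | succ n ih =>
    let p : N →ₗ[A] A := LinearMap.proj 0 ∘ₗ N.subtype
    have : Module.Projective A (LinearMap.range p) := hA _
    let q : N →ₗ[A] (Fin n → A) := LinearMap.funLeft A A Fin.succ ∘ₗ N.subtype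
    obtain ⟨s, hs⟩ := Module.projective_lifting_property p.rangeRestrict LinearMap.id
      p.surjective_rangeRestrict
    let K := LinearMap.ker p
    -- On the kernel of the first coordinate nothing is lost by dropping that coordinate.
    have hK : Function.Injective (q ∘ₗ K.subtype) := by
      refine (injective_iff_map_eq_zero _).2 ?_
      rintro ⟨⟨x, hx⟩, hx'⟩ h
      ext i
      refine Fin.cases ?_ (fun i => ?_) i
      · exact hx'
      · exact congrFun h i
    have : Module.Projective A K :=
      have := ih (LinearMap.range (q ∘ₗ K.subtype))
      Module.Projective.of_equiv (LinearEquiv.ofInjective _ hK).symm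
    have hs' (y) : p.rangeRestrict (s y) = y := LinearMap.congr_fun hs y
    -- The section `s`, which exists because the ideal is projective, splits `N` as kernel plus
    -- image.
    let e : (K × LinearMap.range p) →ₗ[A] N := K.subtype.coprod s
    have he : Function.Bijective e := by
      constructor
      · refine (injective_iff_map_eq_zero _).2 ?_
        rintro ⟨x, y⟩ h
        have h1 : (x : N) + s y = 0 := h
        have h2 : y = 0 := by
          have := congrArg p.rangeRestrict h1
          rw [map_add, hs', map_zero] at this
          rw [← this, right_eq_add]
          exact Subtype.ext x.2
        subst h2
        rw [map_zero, add_zero] at h1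
        exact Prod.ext (Subtype.ext h1) rfl
      · intro x
        refine ⟨⟨⟨x - s (p.rangeRestrict x), ?_⟩, p.rangeRestrict x⟩, ?_⟩
        · have := congrArg Subtype.val (hs' (p.rangeRestrict x))
          rw [LinearMap.mem_ker, map_sub, sub_eq_zero]
          exact this.symm
        · exact sub_add_cancel _ _
    exact Module.Projective.of_equiv (LinearEquiv.ofBijective e he)

/-- A finite-dimensional module is projective in `FDMod` if it is projective as a module. -/
lemma projective_fd (X : FDMod k A) (h : Projective X.obj) : Projective X where
  factors {E Y} f e _ := by
    have : Epi e.hom := inferInstanceAs (Epi ((isFD k A).ι.map e))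
    exact ⟨ObjectProperty.homMk (Projective.factorThru f.hom e.hom), by ext : 1; simp⟩

variable [FiniteDimensional k A]

/-- The free module of rank `n`. -/
noncomputable def freeFD (k A : Type u) [Field k] [Ring A] [Algebra k A] [FiniteDimensional k A]
    (n : ℕ) : FDMod k A :=
  ⟨ModuleCat.of A (Fin n → A), by
    -- The identity map, comparing the pointwise scalar action of `k` with the one restricted along
    -- `algebraMap`; finiteness is known for the former.
    let f : (Fin n → A) →ₗ[k] (resk k A).obj (ModuleCat.of A (Fin n → A)) :=
      { toFun := fun x => x
        map_add' := fun _ _ => rfl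
        map_smul' := fun c x => funext fun i => Algebra.smul_def c (x i) }
    exact Module.Finite.of_surjective f fun x => ⟨x, rfl⟩⟩

lemma exists_epi_freeFD (M : FDMod k A) : ∃ (n : ℕ) (f : freeFD k A n ⟶ M), Epi f := by
  let : Module k M.obj := ((resk k A).obj M.obj).isModule
  have : IsScalarTower k A M.obj := ⟨fun c a x => by
    rw [Algebra.smul_def, mul_smul]
    rfl⟩
  have : Module.Finite k M.obj := M.property
  have : Module.Finite A M.obj := Module.Finite.of_restrictScalars_finite k A M.obj
  obtain ⟨n, f, hf⟩ := Module.Finite.exists_fin' A M.obj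
  refine ⟨n, ObjectProperty.homMk (ModuleCat.ofHom f), (isFD k A).ι.epi_of_epi_map ?_⟩
  exact (ModuleCat.epi_iff_surjective _).2 hf

/-- A finite-dimensional module is a quotient of a free module of finite rank, and the kernel is
projective by heredity. This resolution of length one stays within finite-dimensional modules, so
the bound holds in `FDMod`, the category whose derived category is used. -/
lemma hasProjectiveDimensionLT_fd (hA : IsHereditary A) (M : FDMod k A) :
    HasProjectiveDimensionLT M 2 := by
  obtain ⟨n, f, _⟩ := exists_epi_freeFD M
  have : Projective (freeFD k A n) := projective_fd _
    ((IsProjective.iff_projective (R := A) (Fin n → A)).1 inferInstance)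
  have : Projective (kernel f) := by
    apply projective_fd
    let i := (kernel.ι f).hom
    have : Mono i := inferInstanceAs (Mono ((isFD k A).ι.map (kernel.ι f)))
    have hi : Function.Injective i.hom := (ModuleCat.mono_iff_injective _).1 this
    have : Module.Projective A (LinearMap.range i.hom) := hA.projective_submodule_pi n (LinearMap.range i.hom)
    have : Module.Projective A (kernel f).obj :=
      Module.Projective.of_equiv (LinearEquiv.ofInjective i.hom hi).symm
    exact (IsProjective.iff_projective (R := A) (kernel f).obj).1 this
  let S := ShortComplex.mk (kernel.ι f) f (by simp)
  have hS : S.ShortExact :=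
    { exact := ShortComplex.exact_of_f_is_kernel S (kernelIsKernel f)
      mono_f := inferInstanceAs (Mono (kernel.ι f))
      epi_g := inferInstanceAs (Epi f) }
  exact hS.hasProjectiveDimensionLT_X₃ 1 (inferInstanceAs (HasProjectiveDimensionLT (kernel f) 1))
    (inferInstanceAs (HasProjectiveDimensionLT (freeFD k A n) 2))

/-- Morphisms from the free module of rank one are the elements of `M`. -/
lemma exists_ne_zero_of_not_isZero {M : FDMod k A} (hM : ¬ IsZero M) :
    ∃ f : freeFD k A 1 ⟶ M, f ≠ 0 := by
  by_contra! h
  apply hM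
  have : ∀ x : M.obj, x = 0 := fun x => by
    have := h (ObjectProperty.homMk (ModuleCat.ofHom
      ((LinearMap.toSpanSingleton A M.obj x) ∘ₗ (LinearMap.proj 0 : (Fin 1 → A) →ₗ[A] A))))
    have : (1 : A) • x = 0 := congrArg (fun g => g.hom.hom (fun _ => (1 : A))) this
    rwa [one_smul] at this
  exact isZero_fd (@ModuleCat.isZero_of_subsingleton _ _ M.obj
    ⟨fun x y => (this x).trans (this y).symm⟩)

/-- The free module of rank one in degree zero detects the nonzero objects concentrated in one
degree. -/
lemma exists_generator : ∃ G : Db k A, ∀ (n : ℤ) (Z : Db k A), conc (tb (FDMod k A)) n Z →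
    ¬ IsZero Z → ∃ f : G ⟶ Z⟦n⟧, f ≠ 0 := by
  have hG : (TStructure.t (C := FDMod k A)).bounded
    ((singleFunctor (FDMod k A) 0).obj (freeFD k A 1)) :=
      ⟨⟨0, inferInstance⟩, ⟨0, inferInstance⟩⟩
  refine ⟨⟨_, hG⟩, fun n Z hZ hZ0 => ?_⟩
  obtain ⟨_, _⟩ := (conc_tb_iff 0 _).1 (conc_shift hZ n 0 (by lia))
  -- Since `Z` sits in degree `n`, its shift by `n` is a module `M`, nonzero because `Z` is. A
  -- nonzero morphism from the free module stays nonzero in the derived category because the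
  -- embedding of modules is faithful.
  obtain ⟨M, ⟨i⟩⟩ := exists_iso_singleFunctor_obj_of_isGE_of_isLE (Z⟦n⟧).obj 0
  have hM : ¬ IsZero M := fun h => hZ0 (by
    have h1 : IsZero (Z⟦n⟧).obj := ((singleFunctor _ 0).map_isZero h).of_iso i
    have h2 : IsZero (Z⟦n⟧) := by
      rw [IsZero.iff_id_eq_zero]
      ext : 1
      exact h1.eq_of_src _ _
    exact ((shiftFunctor _ (-n)).map_isZero h2).of_iso ((shiftEquiv _ n).unitIso.app Z))
  obtain ⟨f, hf⟩ := exists_ne_zero_of_not_isZero hM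
  refine ⟨ObjectProperty.homMk ((singleFunctor _ 0).map f ≫ i.inv), fun h => hf ?_⟩
  have h1 := congrArg (fun g => g.hom) h
  apply (singleFunctor (FDMod k A) 0).map_injective
  have h2 : (singleFunctor _ 0).map f ≫ i.inv = 0 := h1
  rw [Functor.map_zero]
  simpa [Preadditive.IsIso.comp_right_eq_zero] using h2

end

end Dimension

/-! ### Evaluation of complexes in degree zero as a lax monoidal functor -/

section EvalMonoidal

open Limits HomologicalComplex

/-- Formulas for the inverses of the unitors of complexes are thereby turned into the unitality
axioms, which concern the unitors themselves. -/
lemma _root_.CategoryTheory.Iso.hom_eq_of_inv_eq_comp {C : Type*} [Category* C] {X Y Z : C}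
    (i : Y ≅ X) (j : Z ≅ X) (r : Y ⟶ Z) (h : j.inv = i.inv ≫ r) : i.hom = r ≫ j.hom := by
  rw [← cancel_epi i.inv, i.inv_hom_id, ← Category.assoc, ← h, j.inv_hom_id]

variable (C : Type*) [Category* C] [MonoidalCategory C] [Preadditive C] [HasZeroObject C]
  [(curriedTensor C).Additive] [∀ X₁ : C, ((curriedTensor C).obj X₁).Additive]
  {I : Type*} [AddMonoid I] (c : ComplexShape I) [c.TensorSigns]
  [∀ X₁ X₂ : GradedObject I C, GradedObject.HasTensor X₁ X₂]
  [∀ X₁, PreservesColimit (Functor.empty.{0} C) ((curriedTensor C).obj X₁)]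
  [∀ X₂, PreservesColimit (Functor.empty.{0} C) ((curriedTensor C).flip.obj X₂)]
  [∀ X₁ X₂ X₃ X₄ : GradedObject I C, GradedObject.HasTensor₄ObjExt X₁ X₂ X₃ X₄]
  [∀ X₁ X₂ X₃ : GradedObject I C, GradedObject.HasGoodTensor₁₂Tensor X₁ X₂ X₃]
  [∀ X₁ X₂ X₃ : GradedObject I C, GradedObject.HasGoodTensorTensor₂₃ X₁ X₂ X₃]
  [DecidableEq I]

/-- The lax monoidal structure of the evaluation of complexes in degree zero. -/
noncomputable instance evalLaxMonoidal : (HomologicalComplex.eval C c 0).LaxMonoidal where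
  ε := (singleObjXSelf c 0 (𝟙_ C)).inv
  μ K L := ιTensorObj K L 0 0 0 (add_zero 0)
  μ_natural_left {K L} f M := by
    have := ι_mapBifunctorMap f (𝟙 M) (curriedTensor C) c 0 0 0 (add_zero 0)
    refine Eq.trans ?_ this.symm
    simp
    rfl
  μ_natural_right {K L} M f := by
    have := ι_mapBifunctorMap (𝟙 M) f (curriedTensor C) c 0 0 0 (add_zero 0)
    refine Eq.trans ?_ this.symm
    simp
    rfl
  associativity K L M := by
    -- The associator of complexes is determined on triple summands; the axiom is its formula on the
    -- summand of tridegree `(0, 0, 0)`, with both triple inclusions factored into two binary ones.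
    have := GradedObject.Monoidal.ιTensorObj₃'_associator_hom (X₁ := K.X) (X₂ := L.X)
      (X₃ := M.X) 0 0 0 0 (by simp)
    rw [GradedObject.Monoidal.ιTensorObj₃'_eq _ _ _ 0 0 0 0 _ 0 (by simp),
      GradedObject.Monoidal.ιTensorObj₃_eq _ _ _ 0 0 0 0 _ 0 (by simp), Category.assoc] at this
    exact this
  left_unitality K := (Iso.hom_eq_of_inv_eq_comp (λ_ (K.X 0))
    ((HomologicalComplex.eval C c 0).mapIso (λ_ K)) _ (leftUnitor'_inv K 0)).trans
      (Category.assoc _ _ _)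
  right_unitality K := (Iso.hom_eq_of_inv_eq_comp (ρ_ (K.X 0))
    ((HomologicalComplex.eval C c 0).mapIso (ρ_ K)) _ (rightUnitor'_inv K 0)).trans
      (Category.assoc _ _ _)

end EvalMonoidal

/-! ### Complexes concentrated in one degree, between modules and the heart -/

section Single

open Limits HomologicalComplex

section

variable {C : Type*} [Category* C] [Preadditive C] [HasZeroObject C]

/-- A complex concentrated in one degree is isomorphic to a single complex. -/
noncomputable def isoSingle (K : CochainComplex C ℤ) (j : ℤ) (h : ∀ i, i ≠ j → IsZero (K.X i)) :
    K ≅ (single C (.up ℤ) j).obj (K.X j) where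
  hom := mkHomToSingle (𝟙 _) (fun i hi => (h i (by
    have : i + 1 = j := hi
    lia)).eq_of_src _ _)
  inv := mkHomFromSingle (𝟙 _) (fun i hi => (h i (by
    have : j + 1 = i := hi
    lia)).eq_of_tgt _ _)
  hom_inv_id := by
    ext i
    by_cases hi : i = j
    · subst hi
      simp
    · exact (h i hi).eq_of_src _ _
  inv_hom_id := by
    apply from_single_hom_ext
    simp

lemma isoSingle_hom_f (K : CochainComplex C ℤ) (j : ℤ) (h : ∀ i, i ≠ j → IsZero (K.X i)) :
    (isoSingle K j h).hom.f j = (singleObjXSelf (.up ℤ) j (K.X j)).inv := by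
  simp [isoSingle]

/-- A functor to complexes concentrated in one degree factors through the single complexes. -/
noncomputable def natIsoSingle {D : Type*} [Category* D] (G : D ⥤ CochainComplex C ℤ) (j : ℤ)
    (h : ∀ X i, i ≠ j → IsZero ((G.obj X).X i)) :
    G ≅ (G ⋙ HomologicalComplex.eval C (.up ℤ) j) ⋙ single C (.up ℤ) j :=
  NatIso.ofComponents (fun X => isoSingle (G.obj X) j (h X)) (fun f => by
    apply to_single_hom_ext
    change (G.map f).f j ≫ (isoSingle (G.obj _) j (h _)).hom.f j =
      (isoSingle (G.obj _) j (h _)).hom.f j ≫ ((single C (.up ℤ) j).map ((G.map f).f j)).f j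
    rw [isoSingle_hom_f, isoSingle_hom_f, single_map_f_self, Iso.inv_hom_id_assoc])

end

/-- A lift of a monoidal functor to a full monoidal subcategory is monoidal. -/
@[reducible] noncomputable def liftMonoidal {C D : Type*} [Category* C] [Category* D] [MonoidalCategory C]
    [MonoidalCategory D] (P : ObjectProperty D) [P.IsMonoidal] (F : C ⥤ D) [F.Monoidal]
    (hF : ∀ X, P (F.obj X)) : (P.lift F hF).Monoidal :=
  Functor.CoreMonoidal.toMonoidal
    { εIso := P.isoMk (Functor.Monoidal.εIso F)
      μIso X Y := P.isoMk (Functor.Monoidal.μIso F X Y)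
      μIso_hom_natural_left f X := by
        ext : 1
        exact Functor.LaxMonoidal.μ_natural_left F f X
      μIso_hom_natural_right X f := by
        ext : 1
        exact Functor.LaxMonoidal.μ_natural_right F X f
      associativity X Y Z := by
        ext : 1
        exact Functor.LaxMonoidal.associativity F X Y Z
      left_unitality X := by
        ext : 1
        exact Functor.LaxMonoidal.left_unitality F X
      right_unitality X := by
        ext : 1
        exact Functor.LaxMonoidal.right_unitality F X }

variable (k A : Type u) [Field k] [Ring A] [Algebra k A]

/-- Complexes of finite-dimensional modules concentrated in degree `n`. -/
def concCb (n : ℤ) : ObjectProperty (Cb k A) := fun K => ∀ i, i ≠ n → IsZero (K.obj.X i)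

/-- The category of complexes of finite-dimensional modules concentrated in degree zero. -/
abbrev Cb₀ := (concCb k A 0).FullSubcategory

/-- The evaluation of complexes concentrated in degree zero. -/
noncomputable def ev₀ : Cb₀ k A ⥤ FDMod k A :=
  (isFD k A).lift ((concCb k A 0).ι ⋙ (bddfd k A).ι ⋙ HomologicalComplex.eval _ (.up ℤ) 0)
    (fun K => K.obj.property.2 0)

/-- Complexes concentrated in degree zero are determined by their component in degree zero. -/
noncomputable def ev₀CompSingle : (concCb k A 0).ι ⋙ (bddfd k A).ι ≅
    ev₀ k A ⋙ (isFD k A).ι ⋙ single (ModuleCat.{u} A) (.up ℤ) 0 :=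
  natIsoSingle ((concCb k A 0).ι ⋙ (bddfd k A).ι) 0 (fun X => X.property)

/-- Up to isomorphism, the fully faithful inclusion of `Cb₀` in all complexes is `ev₀` followed by a
fully faithful functor, so `ev₀` inherits both properties; fullness is obtained next in the same
way. -/
instance : (ev₀ k A).Faithful :=
  have := Functor.Faithful.of_iso (ev₀CompSingle k A)
  Functor.Faithful.of_comp (ev₀ k A) ((isFD k A).ι ⋙ single (ModuleCat.{u} A) (.up ℤ) 0)

instance : (ev₀ k A).Full :=
  have := Functor.Full.of_iso (ev₀CompSingle k A)
  Functor.Full.of_comp_faithful (ev₀ k A) ((isFD k A).ι ⋙ single (ModuleCat.{u} A) (.up ℤ) 0)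

/-- The complex with a given finite-dimensional module in degree `n`. -/
noncomputable def singleCb (n : ℤ) (M : FDMod k A) : Cb k A :=
  ⟨(single _ (.up ℤ) n).obj M.obj,
    ⟨n, n, inferInstanceAs (CochainComplex.IsStrictlyGE ((single _ (.up ℤ) n).obj M.obj) n),
      inferInstanceAs (CochainComplex.IsStrictlyLE ((single _ (.up ℤ) n).obj M.obj) n)⟩,
    fun i => by
      by_cases h : i = n
      · exact (isFD k A).prop_of_iso (singleObjXIsoOfEq (.up ℤ) n _ i h).symm M.property
      · exact (isFD k A).prop_of_isZero (isZero_single_obj_X (.up ℤ) n _ i h)⟩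

lemma concCb_singleCb (n : ℤ) (M : FDMod k A) : concCb k A n (singleCb k A n M) :=
  fun i h => isZero_single_obj_X (.up ℤ) n _ i h

instance : (ev₀ k A).EssSurj where
  mem_essImage M := ⟨⟨singleCb k A 0 M, concCb_singleCb k A 0 M⟩,
    ⟨(isFD k A).isoMk (singleObjXSelf (.up ℤ) 0 M.obj)⟩⟩

instance : (ev₀ k A).IsEquivalence where

instance : (ev₀ k A).Additive where

instance : (ev₀ k A).Linear k where

/-- The functor from complexes concentrated in degree zero to the bounded derived category. -/
noncomputable def Q₀ : Cb₀ k A ⥤ Db k A := (concCb k A 0).ι ⋙ Qfd k A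

/-- The image of a bounded complex in the derived category. -/
noncomputable def QfdCompι : Qfd k A ⋙ DerivedCategory.Bounded.ι ≅
    toChb k A ⋙ (bddCochain (FDMod k A)).ι ⋙ DerivedCategory.Q :=
  Functor.isoWhiskerLeft (toChb k A ⋙ (bddCochain (FDMod k A)).ι)
    (DerivedCategory.quotientCompQhIso (FDMod k A))

variable {k A} in
lemma isZero_toChb {n i : ℤ} {K : Cb k A} (hK : concCb k A n K) (hi : i ≠ n) :
    IsZero (((toChb k A).obj K).obj.X i) := isZero_fd (hK i hi)

/-- The functor `Q₀` is the inclusion of the modules in the derived category. -/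
noncomputable def Q₀Compι : Q₀ k A ⋙ DerivedCategory.Bounded.ι ≅
    ev₀ k A ⋙ DerivedCategory.singleFunctor (FDMod k A) 0 :=
  Functor.isoWhiskerLeft (concCb k A 0).ι (QfdCompι k A) ≪≫
    Functor.isoWhiskerRight (natIsoSingle ((concCb k A 0).ι ⋙ toChb k A ⋙
      (bddCochain (FDMod k A)).ι) 0 (fun X _ hi => isZero_toChb X.property hi)) DerivedCategory.Q

/-- By `Q₀Compι`, composing `Q₀` with the inclusion of bounded objects gives the equivalence `ev₀`
followed by the fully faithful embedding of an abelian category in its derived category. Fullness,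
additivity and linearity of `Q₀` are read off from the same comparison. -/
instance : (Q₀ k A).Faithful :=
  have := Functor.Faithful.of_iso (Q₀Compι k A).symm
  Functor.Faithful.of_comp (Q₀ k A) DerivedCategory.Bounded.ι

instance : (Q₀ k A).Full :=
  have := Functor.Full.of_iso (Q₀Compι k A).symm
  Functor.Full.of_comp_faithful (Q₀ k A) DerivedCategory.Bounded.ι

instance : (Q₀ k A).Additive :=
  have := Functor.additive_of_iso (Q₀Compι k A).symm
  ⟨fun {_ _ f g} => DerivedCategory.Bounded.ι.map_injective
    ((Q₀ k A ⋙ DerivedCategory.Bounded.ι).map_add (f := f) (g := g))⟩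

instance : (Q₀ k A).Linear k :=
  have := Functor.linear_of_iso k (Q₀Compι k A).symm
  ⟨fun f r => DerivedCategory.Bounded.ι.map_injective
    ((Q₀ k A ⋙ DerivedCategory.Bounded.ι).map_smul r f)⟩

lemma conc_Qfd {n : ℤ} {K : Cb k A} (hK : concCb k A n K) :
    conc (tb (FDMod k A)) n ((Qfd k A).obj K) := by
  let L := ((toChb k A).obj K).obj
  have hL (i : ℤ) (hi : i ≠ n) : IsZero (L.X i) := isZero_toChb hK hi
  have : L.IsStrictlyGE n := by
    rw [CochainComplex.isStrictlyGE_iff]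
    exact fun i hi => hL i (by lia)
  have : L.IsStrictlyLE n := by
    rw [CochainComplex.isStrictlyLE_iff]
    exact fun i hi => hL i (by lia)
  rw [conc_tb_iff]
  let e : DerivedCategory.Q.obj L ≅ ((Qfd k A).obj K).obj := ((QfdCompι k A).app K).symm
  exact ⟨DerivedCategory.TStructure.t.isGE_of_iso e n,
    DerivedCategory.TStructure.t.isLE_of_iso e n⟩

/-- Being concentrated in degree `n` only constrains cohomology; the gain is a representative whose
terms vanish outside degree `n`, on which tensor products can be computed term by term. -/
lemma exists_iso_Qfd {n : ℤ} {X : Db k A} (hX : conc (tb (FDMod k A)) n X) :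
    ∃ K : Cb k A, concCb k A n K ∧ Nonempty (X ≅ (Qfd k A).obj K) := by
  obtain ⟨_, _⟩ := (conc_tb_iff n X).1 hX
  obtain ⟨M, ⟨e⟩⟩ := DerivedCategory.exists_iso_singleFunctor_obj_of_isGE_of_isLE X.obj n
  have hK := concCb_singleCb k A n M
  refine ⟨_, hK, ⟨ObjectProperty.isoMk _ (e ≪≫ ?_ ≪≫ ((QfdCompι k A).app _).symm)⟩⟩
  -- `singleCb` is built from modules and then carried to complexes in `FDMod`, so it is not
  -- literally a single complex there; `isoSingle` supplies the comparison.
  let i : ((toChb k A).obj (singleCb k A n M)).obj.X n ≅ M :=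
    (isFD k A).isoMk (singleObjXSelf (.up ℤ) n M.obj)
  exact DerivedCategory.Q.mapIso ((single _ _ n).mapIso i.symm ≪≫
    (isoSingle ((toChb k A).obj (singleCb k A n M)).obj n (fun _ hi => isZero_toChb hK hi)).symm)

/-! ### Tensor products of complexes concentrated in one degree -/

section

variable [Coalgebra k A] [IsWeakBialgebra k A] [FiniteDimensional k A]

variable {k A} in
-- A summand of bidegree `(a, b)` with `a + b` different from `p + q` has `a ≠ p` or `b ≠ q`, so one
-- of its factors vanishes.
lemma concCb_tensor {p q : ℤ} {K L : Cb k A} (hK : concCb k A p K) (hL : concCb k A q L) :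
    concCb k A (p + q) (K ⊗ L) := fun i hi => by
  refine isZero_tensor k A i fun a b h => ?_
  by_cases ha : a = p
  · exact .inr (hL b (by lia))
  · exact .inl (hK a ha)

instance : (concCb k A 0).IsMonoidal where
  prop_unit i hi := isZero_single_obj_X (.up ℤ) 0 (𝟙_ (ModuleCat.{u} A)) i hi
  prop_tensor _ _ hK hL := concCb_tensor hK hL

/-- The monoidal structure of `Db` is by construction the localized one, for which the localization
functor is strong monoidal. -/
noncomputable instance : (Qfd k A).Monoidal :=
  inferInstanceAs ((Localization.Monoidal.toMonoidalCategory (Qfd k A) (qis k A)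
    (Iso.refl ((Qfd k A).obj (𝟙_ (Cb k A))))).Monoidal)

noncomputable instance : (Q₀ k A).Monoidal :=
  inferInstanceAs ((concCb k A 0).ι ⋙ Qfd k A).Monoidal

/-- Both objects are represented by complexes with one possibly nonzero term, and `Qfd` is strong
monoidal, so additivity of degrees can be read off from complexes. -/
lemma conc_tensor (p q : ℤ) (X Y : Db k A) (hX : conc (tb (FDMod k A)) p X)
    (hY : conc (tb (FDMod k A)) q Y) : conc (tb (FDMod k A)) (p + q) (X ⊗ Y) := by
  obtain ⟨K, hK, ⟨e⟩⟩ := exists_iso_Qfd k A hX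
  obtain ⟨L, hL, ⟨e'⟩⟩ := exists_iso_Qfd k A hY
  exact (conc _ _).prop_of_iso ((e ⊗ᵢ e') ≪≫ Functor.Monoidal.μIso (Qfd k A) K L).symm
    (conc_Qfd k A (concCb_tensor hK hL))

variable {k A} in
/-- If `K` is concentrated in degree zero, the component of `K ⊗ L` in degree zero is its summand
of bidegree `(0, 0)`. -/
lemma isIso_ιTensorObj {K L : CochainComplex (ModuleCat.{u} A) ℤ} (h : ∀ i, i ≠ 0 → IsZero (K.X i)) :
    IsIso (ιTensorObj K L 0 0 0 (add_zero 0)) := by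
  let f (i : ℤ) : K.X i ⟶ K.X 0 := if h : i = 0 then (K.XIsoOfEq h).hom else 0
  let g (i : ℤ) : L.X i ⟶ L.X 0 := if h : i = 0 then (L.XIsoOfEq h).hom else 0
  have hf : f 0 = 𝟙 _ := by simp [f]
  have hg : g 0 = 𝟙 _ := by simp [g]
  -- The inverse is the projection to the summand `(0, 0)`: the maps `f` and `g` are the identity in
  -- degree zero and zero elsewhere, which makes the family of maps on summands uniform in the
  -- bidegree.
  let π : (HomologicalComplex.tensorObj K L).X 0 ⟶ K.X 0 ⊗ L.X 0 :=
    mapBifunctorDesc fun a b _ => f a ⊗ₘ g b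
  have hπ : ιTensorObj K L 0 0 0 (add_zero 0) ≫ π = 𝟙 _ := by
    refine (ι_mapBifunctorDesc _ _ _ _).trans ?_
    rw [hf, hg, id_tensorHom_id]
  refine ⟨π, hπ, ?_⟩
  apply mapBifunctor.hom_ext
  intro a b hab
  by_cases ha : a = 0
  · subst ha
    obtain rfl : b = 0 := by simpa using hab
    rw [reassoc_of% hπ, Category.comp_id]
  · exact ((tensorRight (L.X b)).map_isZero (h a ha)).eq_of_src _ _

/-- The evaluation of complexes concentrated in degree zero is monoidal. -/
noncomputable instance : (ev₀ k A).Monoidal := by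
  let F : Cb₀ k A ⥤ ModuleCat.{u} A :=
    ((concCb k A 0).ι ⋙ (bddfd k A).ι) ⋙ HomologicalComplex.eval _ (.up ℤ) 0
  let : F.LaxMonoidal := inferInstance
  have : IsIso (Functor.LaxMonoidal.ε F) := by
    have : IsIso (Functor.LaxMonoidal.ε
      (HomologicalComplex.eval (ModuleCat.{u} A) (.up ℤ) 0)) :=
      inferInstanceAs (IsIso (singleObjXSelf (.up ℤ) 0 (𝟙_ (ModuleCat.{u} A))).inv)
    rw [Functor.LaxMonoidal.comp_ε]
    infer_instance
  -- Evaluation is only lax on all complexes, because degree zero of a tensor product also contains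
  -- summands of bidegree `(i, -i)`. Concentration in degree zero removes these, so the lax
  -- structure becomes strong.
  have (K L : Cb₀ k A) : IsIso (Functor.LaxMonoidal.μ F K L) := by
    have : IsIso (Functor.LaxMonoidal.μ
      (HomologicalComplex.eval (ModuleCat.{u} A) (.up ℤ) 0)
      (((concCb k A 0).ι ⋙ (bddfd k A).ι).obj K) (((concCb k A 0).ι ⋙ (bddfd k A).ι).obj L)) :=
      isIso_ιTensorObj K.property
    rw [Functor.LaxMonoidal.comp_μ]
    infer_instance
  let : F.Monoidal := Functor.Monoidal.ofLaxMonoidal F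
  exact liftMonoidal (isFD k A) F (fun K => K.obj.property.2 0)

end

end Single

/-! ### Nonzero modules have nonzero tensor squares -/

section Square

open Limits

variable {k A : Type u} [Field k] [Ring A] [Algebra k A] [Coalgebra k A] [IsWeakBialgebra k A]

/-- Over a bialgebra, the square of a nonzero module is nonzero. -/
lemma IsBialgebra.isZero_of_isZero_tensor (h : IsBialgebra k A) {M : ModuleCat.{u} A}
    (hM : IsZero (M ⊗ M)) : IsZero M := by
  have hT : Subsingleton (tens (k := k) M M) := ModuleCat.subsingleton_of_isZero hM
  have key (x : (resk k A).obj M) : x = 0 := by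
    by_contra hx
    let v : ((resk k A).obj M ⊗ (resk k A).obj M : ModuleCat k) :=
      (x ⊗ₜ[k] x : (resk k A).obj M ⊗[k] (resk k A).obj M)
    -- For a bialgebra the projector given by `Δ(1)` is the identity, so the vector `x ⊗ x` survives
    -- in the tensor product of modules.
    have h1 : tensorAct M M 1 v = v := by
      change tl (act M) (act M) (Coalgebra.comul (1 : A)) v = v
      rw [h.comul_one, Algebra.TensorProduct.one_def]
      refine (tl_tmul (act M) (act M) 1 1 x x).trans ?_
      rw [act_one]
      rfl
    have h2 : pp M M v = 0 := Subsingleton.elim (α := tens (k := k) M M) _ _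
    have h3 : v = 0 := by
      rw [← h1, ← Corner.proj_incl, h2, map_zero]
    -- Pairing `x ⊗ x = 0` with `f ⊗ f` gives `f x * f x = 0`, so every functional vanishes on `x`.
    have h4 (f : Module.Dual k ((resk k A).obj M)) : f x = 0 := by
      have := congrArg (LinearMap.mul' k k ∘ₗ TensorProduct.map f f) h3
      simpa [v] using this
    exact hx ((Module.forall_dual_apply_eq_zero_iff k x).1 h4)
  exact @ModuleCat.isZero_of_subsingleton _ _ M ⟨fun x y => (key x).trans (key y).symm⟩

/-- The tensor product of modules embeds naturally in the tensor product over the field `k`, where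
tensoring preserves injections. -/
instance mono_whiskerLeft_module (M : ModuleCat.{u} A) {N N' : ModuleCat.{u} A} (g : N ⟶ N') [Mono g] :
    Mono (M ◁ g) := by
  have : Mono ((resk k A).map (M ◁ g) ≫ jj M N') := by
    rw [map_whiskerLeft_jj]
    infer_instance
  have := mono_of_mono ((resk k A).map (M ◁ g)) (jj M N')
  exact (resk k A).mono_of_mono_map this

instance mono_whiskerRight_module {M M' : ModuleCat.{u} A} (f : M ⟶ M') (N : ModuleCat.{u} A)
    [Mono f] : Mono (f ▷ N) := by
  -- The braiding of vector spaces reduces this to the other side; the modules themselves need not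
  -- be braided.
  have (V : ModuleCat.{u} k) {X Y : ModuleCat.{u} k} (f : X ⟶ Y) [Mono f] : Mono (f ▷ V) :=
    ((MorphismProperty.monomorphisms _).arrow_mk_iso_iff
      (Arrow.isoMk (f := Arrow.mk (f ▷ V)) (g := Arrow.mk (V ◁ f)) (β_ X V) (β_ Y V))).2
      (inferInstance : Mono (V ◁ f))
  have : Mono ((resk k A).map (f ▷ N) ≫ jj M' N) := by
    rw [map_whiskerRight_jj]
    infer_instance
  have := mono_of_mono ((resk k A).map (f ▷ N)) (jj M' N)
  exact (resk k A).mono_of_mono_map this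

variable [FiniteDimensional k A]

/-- In a discrete category of modules, the square of a nonzero module is nonzero. -/
lemma IsDiscrete.isZero_of_isZero_tensor (h : IsDiscrete k (FDMod k A)) {M : FDMod k A}
    (hM : IsZero (M ⊗ M)) : IsZero M := by
  by_contra h0
  have := (h.finite_length M).1
  -- A nonzero artinian object contains a simple one. Its square embeds in the square of `M` because
  -- tensoring on either side preserves monomorphisms, and it is nonzero because in the discrete
  -- case it is isomorphic to the simple object itself.
  obtain ⟨Y, hY⟩ := exists_simple_subobject h0
  obtain ⟨n, S, hS, -, hX, hSS, -⟩ := h.simples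
  obtain ⟨i, ⟨e⟩⟩ := hX _ hY
  obtain ⟨e'⟩ := hSS i
  have hm : Mono Y.arrow.hom := inferInstanceAs (Mono ((isFD k A).ι.map Y.arrow))
  have h1 : Mono (Y.arrow.hom ▷ (Y : FDMod k A).obj ≫ M.obj ◁ Y.arrow.hom) := mono_comp _ _
  have h2 : IsZero (M.obj ⊗ M.obj) := (isFD k A).ι.map_isZero hM
  have h3 : IsZero ((Y : FDMod k A) ⊗ (Y : FDMod k A)) :=
    isZero_fd (IsZero.of_mono (Y.arrow.hom ▷ (Y : FDMod k A).obj ≫ M.obj ◁ Y.arrow.hom) h2)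
  exact Simple.not_isZero (S i) (h3.of_iso (e'.symm ≪≫ (e ⊗ᵢ e).symm))

lemma isZero_of_isZero_tensor (h : IsBialgebra k A ∨ IsDiscrete k (FDMod k A)) {M : FDMod k A}
    (hM : IsZero (M ⊗ M)) : IsZero M := by
  rcases h with h | h
  · exact isZero_fd (h.isZero_of_isZero_tensor ((isFD k A).ι.map_isZero hM))
  · exact h.isZero_of_isZero_tensor hM

/-- The question is moved from the heart to modules through `Cb₀`: `Q₀` and `ev₀` are both strong
monoidal, and being faithful they reflect zero objects. -/
lemma isZero_of_isZero_tensor_conc (h : IsBialgebra k A ∨ IsDiscrete k (FDMod k A)) {X : Db k A}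
    (hX : conc (tb (FDMod k A)) 0 X) (hXX : IsZero (X ⊗ X)) : IsZero X := by
  obtain ⟨K, hK, ⟨e⟩⟩ := exists_iso_Qfd k A hX
  let K₀ : Cb₀ k A := ⟨K, hK⟩
  let e₀ : X ≅ (Q₀ k A).obj K₀ := e
  have h1 : IsZero ((Q₀ k A).obj (K₀ ⊗ K₀)) :=
    hXX.of_iso ((Functor.Monoidal.μIso (Q₀ k A) K₀ K₀).symm ≪≫ (e₀ ⊗ᵢ e₀).symm)
  have h2 : IsZero (K₀ ⊗ K₀) := by
    rw [IsZero.iff_id_eq_zero]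
    apply (Q₀ k A).map_injective
    exact h1.eq_of_src _ _
  have h3 : IsZero ((ev₀ k A).obj K₀) := isZero_of_isZero_tensor h
    (((ev₀ k A).map_isZero h2).of_iso (Functor.Monoidal.μIso (ev₀ k A) K₀ K₀))
  have h4 : IsZero K₀ := by
    rw [IsZero.iff_id_eq_zero]
    apply (ev₀ k A).map_injective
    exact h3.eq_of_src _ _
  exact ((Q₀ k A).map_isZero h4).of_iso e₀

end Square

/-! ### The heart as a monoidal category -/

section Equivalence

variable (k : Type*) [Field k]

section

variable {C : Type*} [Category* C] [Preadditive C] [Linear k C]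
  [MonoidalCategory C] {D : Type*} [Category* D] [Preadditive D] [Linear k D] [MonoidalCategory D]
  {E : Type*} [Category* E] [Preadditive E] [Linear k E] [MonoidalCategory E]

variable {k} in
lemma MonoidalAbelianEquivalent.symm (h : MonoidalAbelianEquivalent k C D) :
    MonoidalAbelianEquivalent k D C := by
  obtain ⟨e, _, _, ⟨_⟩⟩ := h
  exact ⟨e.symm, inferInstanceAs e.inverse.Additive, inferInstanceAs (e.inverse.Linear k),
    ⟨e.inverseMonoidal⟩⟩

variable {k} in
lemma MonoidalAbelianEquivalent.trans (h : MonoidalAbelianEquivalent k C D)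
    (h' : MonoidalAbelianEquivalent k D E) : MonoidalAbelianEquivalent k C E := by
  obtain ⟨e, _, _, ⟨_⟩⟩ := h
  obtain ⟨e', _, _, ⟨_⟩⟩ := h'
  exact ⟨e.trans e', inferInstanceAs (e.functor ⋙ e'.functor).Additive,
    inferInstanceAs ((e.functor ⋙ e'.functor).Linear k),
    ⟨inferInstanceAs (e.functor ⋙ e'.functor).Monoidal⟩⟩

/-- A fully faithful linear monoidal functor is an equivalence to its essential image. -/
lemma monoidalAbelianEquivalent_lift (F : C ⥤ D) [F.Full] [F.Faithful] [F.Additive] [F.Linear k]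
    [F.Monoidal] (P : ObjectProperty D) [P.IsMonoidal] (hF : ∀ X, P (F.obj X))
    (hP : ∀ Y, P Y → F.essImage Y) : MonoidalAbelianEquivalent k C P.FullSubcategory := by
  have : (P.lift F hF).EssSurj := ⟨fun Y => by
    obtain ⟨X, ⟨e⟩⟩ := hP Y.obj Y.property
    exact ⟨X, ⟨P.isoMk e⟩⟩⟩
  have : (P.lift F hF).IsEquivalence := { }
  refine ⟨(P.lift F hF).asEquivalence, ⟨?_⟩, ⟨?_⟩, ⟨liftMonoidal P F hF⟩⟩
  · intro X Y f g
    ext : 1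
    exact F.map_add
  · intro X Y f r
    ext : 1
    exact F.map_smul r f

end

variable (k A : Type u) [Field k] [Ring A] [Algebra k A] [Coalgebra k A] [IsWeakBialgebra k A]
  [FiniteDimensional k A]

/-- The unit lies in the heart because `Q₀` preserves the unit; products lie there because `0 + 0 =
0`. -/
instance : (conc (tb (FDMod k A)) 0).IsMonoidal where
  prop_unit := (conc _ 0).prop_of_iso (Functor.Monoidal.εIso (Q₀ k A)).symm
    (conc_Qfd k A (𝟙_ (Cb₀ k A)).property)
  prop_tensor X Y hX hY := conc_tensor k A 0 0 X Y hX hY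

lemma essImage_Q₀ {X : Db k A} (hX : conc (tb (FDMod k A)) 0 X) : (Q₀ k A).essImage X := by
  obtain ⟨K, hK, ⟨e⟩⟩ := exists_iso_Qfd k A hX
  exact ⟨⟨K, hK⟩, ⟨e.symm⟩⟩

lemma monoidalAbelianEquivalent_ev₀ : MonoidalAbelianEquivalent k (Cb₀ k A) (FDMod k A) :=
  ⟨(ev₀ k A).asEquivalence, (inferInstance : (ev₀ k A).Additive),
    (inferInstance : (ev₀ k A).Linear k), ⟨(inferInstance : (ev₀ k A).Monoidal)⟩⟩

/-- The heart of the bounded derived category is the monoidal category of modules. -/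
lemma monoidalAbelianEquivalent_heart :
    MonoidalAbelianEquivalent k (Cb₀ k A) (conc (tb (FDMod k A)) 0).FullSubcategory :=
  monoidalAbelianEquivalent_lift k (Q₀ k A) _ (fun X => conc_Qfd k A X.property)
    (fun _ hY => essImage_Q₀ k A hY)

end Equivalence

end WeakBialg

/-! ### The main theorem -/

theorem theorem0p5 {k : Type u} [Field k] [IsAlgClosed k] {A B : Type u}
    [Ring A] [Algebra k A] [Coalgebra k A] [WeakBialg.IsWeakBialgebra k A] [FiniteDimensional k A]
    [Ring B] [Algebra k B] [Coalgebra k B] [WeakBialg.IsWeakBialgebra k B] [FiniteDimensional k B]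
    (hA : WeakBialg.IsHereditary A) (hB : WeakBialg.IsHereditary B)
    (h : WeakBialg.IsBialgebra k A ∨ WeakBialg.IsDiscrete k (WeakBialg.FDMod k A))
    (hD : WeakBialg.MonoidalTriangulatedEquivalent k (WeakBialg.Db k A) (WeakBialg.Db k B)) :
    WeakBialg.MonoidalAbelianEquivalent k (WeakBialg.FDMod k A) (WeakBialg.FDMod k B) := by
  open WeakBialg in
  obtain ⟨e, _, _, ⟨_⟩, _, -⟩ := hD
  have key (X : Db k A) : conc (tb (FDMod k A)) 0 X ↔ conc (tb (FDMod k B)) 0 (e.functor.obj X) :=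
    conc_zero_iff_of_equivalence e
      (isHereditaryTStructure_tb (hasProjectiveDimensionLT_fd hA))
      (isHereditaryTStructure_tb (hasProjectiveDimensionLT_fd hB))
      (conc_tensor k A 0 0) (fun p => conc_tensor k B p p)
      (fun X hX h0 hXX => h0 (isZero_of_isZero_tensor_conc h hX hXX)) exists_generator X
  -- The forward half of `key` makes the composite of `Q₀` with the equivalence land in the heart
  -- for `B`; the backward half shows that every object of that heart is reached.
  have h1 : MonoidalAbelianEquivalent k (Cb₀ k A) (conc (tb (FDMod k B)) 0).FullSubcategory :=
    monoidalAbelianEquivalent_lift k (Q₀ k A ⋙ e.functor) _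
      (fun X => (key _).1 (conc_Qfd k A X.property)) (fun Y hY => by
        obtain ⟨X, ⟨i⟩⟩ := essImage_Q₀ k A (X := e.inverse.obj Y) ((key _).2
          ((conc _ 0).prop_of_iso (e.counitIso.app Y).symm hY))
        exact ⟨X, ⟨e.functor.mapIso i ≪≫ e.counitIso.app Y⟩⟩)
  -- The chain runs from modules over `A` through complexes in degree zero to the heart for `B`, and
  -- from there back through complexes in degree zero to modules over `B`.
  exact (monoidalAbelianEquivalent_ev₀ k A).symm.trans (h1.trans
    ((monoidalAbelianEquivalent_heart k B).symm.trans (monoidalAbelianEquivalent_ev₀ k B)))
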